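/- Let $0\le k\le N$ and let $\lambda=(\lambda_1\ge\dots\ge\lambda_r>0)$ be a partition with exactly $r\le\min(k,N-k)$ parts; let $r_1,\dots,r_m$ be the multiplicities of its distinct parts, in decreasing order of the parts, so $r=r_1+\dots+r_m$. Let $\mathbf X=\{x_1,\dots,x_r\}$, $\mathbf Y=\{y_1,\dots,y_r\}$, $\mathbf Z=\{z_1,\dots,z_{k-r}\}$, $\mathbf W=\{w_1,\dots,w_{N-k-r}\}$ be indeterminates of degree $2$, and write $\mathrm{Sym}$ for symmetric polynomials with integer coefficients. **Rings.** Identify $H^*(\mathrm{BU}(N))=\mathrm{Sym}(\mathbf X\sqcup\mathbf Y\sqcup\mathbf Z\sqcup\mathbf W)$. Let $J_\lambda\subseteq \mathrm U(N)$ be the group of unitary block diagonal matrices $\mathrm{diag}(U_1,\dots,U_m,V,U_1,\dots,U_m,W)$ with $U_j\in \mathrm U(r_j)$, $V\in \mathrm U(k-r)$, $W\in \mathrm U(N-k-r)$. Let $T$ be its torus of diagonal matrices. The ring $H^*(\mathrm BJ_\lambda)$ (integral coefficients) is taken in Borel's presentation, as the ring of Weyl group invariants in $H^*(\mathrm BT)=\mathrm{Sym}_{\mathbb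 Z}(\mathrm{Hom}(T,\mathrm U(1)))$, where characters have degree $2$ and the Weyl group is the normalizer of $T$ in $J_\lambda$ modulo $T$. It is a module over $H^*(\mathrm{BU}(N))$ through restriction, which sends the indeterminates, in the order $\mathbf X,\mathbf Z,\mathbf Y,\mathbf W$, to the $N$ diagonal entries of $T$. **Complex.** Let $R=\mathbb Z[\mathbf X]\otimes\mathrm{Sym}(\mathbf Y)$. For $1\le j<r$ let $s_j$ be the operator on $R$ swapping $x_j$ and $x_{j+1}$, and $\partial_j=(\mathrm{Id}-s_j)/(x_j-x_{j+1})$. Let $Q_r=e_r(\mathbf Y-x_r)=\sum_{j=0}^r(-1)^je_{r-j}(\mathbf Y)x_r^j$. For $v\in\{0,1\}^r$ let $R(v)$ be a copy of $R$, placed in homological degree $\sum_i v_i$ (that is, cohomological degree $-\sum_i v_i$), with internal degree shifted up by $2\sum_i i v_i$. On $C^r=\bigoplus_v R(v)$ let $d$ be the map whose component from $R(v)$ with $v_i=1$ to $R(w)$, where $w$ is $v$ with its $i$-th entry changed to $0$, is $$\theta_i\theta_{i+1}\cdots\theta_{r-1}\,Q_r\,\hat\theta_{r-1}\cdots\hat\theta_{i+1}\hat\theta_i,\qquad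 (\theta_j,\hat\theta_j)=\begin{cases}(\partial_j,s_j)& v_{j+1}=0\\(s_j,\partial_j)&v_{j+1}=1,\end{cases}$$ all other components being zero. Let $B^{r_1,\dots,r_m}=\bigoplus_v B^{r_1,\dots,r_m}(v)\subseteq C^r$, where for $v=(1^{a_1},0^{r_1-a_1},\dots,1^{a_m},0^{r_m-a_m})$ with $0\le a_j\le r_j$ the summand $B^{r_1,\dots,r_m}(v)\subseteq R(v)$ consists of the polynomials invariant under $\mathfrak S_{a_1}\times\mathfrak S_{r_1-a_1}\times\dots\times\mathfrak S_{a_m}\times\mathfrak S_{r_m-a_m}$ acting on $\mathbf X$, and $B^{r_1,\dots,r_m}(v)=0$ for all other $v$. Put $$\mathrm F_\lambda=B^{r_1,\dots,r_m}\otimes\mathrm{Sym}(\mathbf Z)\otimes\mathrm{Sym}(\mathbf W),$$ with $d$ extended linearly, and with $H^*(\mathrm{BU}(N))$ acting by multiplication. **Proposition.** The map $d$ preserves $\mathrm F_\lambda$ and makes it a free resolution of the $H^*(\mathrm{BU}(N))$-module $H^*(\mathrm BJ_\lambda)$, compatibly with the internal gradings. That is, each term of $\mathrm F_\lambda$ is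 a free $H^*(\mathrm{BU}(N))$-module with a basis of homogeneous elements, $d$ preserves internal degree, and there is a degree-preserving $H^*(\mathrm{BU}(N))$-linear map $\varepsilon\colon (\mathrm F_\lambda)_0\to H^*(\mathrm BJ_\lambda)$ such that $$\cdots\to(\mathrm F_\lambda)_2\xrightarrow{d}(\mathrm F_\lambda)_1\xrightarrow{d}(\mathrm F_\lambda)_0\xrightarrow{\varepsilon}H^*(\mathrm BJ_\lambda)\to0$$ is exact. -/

import Mathlib

namespace FlagResolution

/-! ## Divided differences on polynomial rings -/

section DividedDifference

variable {τ : Type} [DecidableEq τ]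

/-- The operator `f ↦ σ f` renaming the variables by a permutation. It is linear over the ring of
symmetric polynomials. -/
noncomputable def permOp (σ : Equiv.Perm τ) :
    Module.End (MvPolynomial.symmetricSubalgebra τ ℤ) (MvPolynomial τ ℤ) where
  toFun f := MvPolynomial.rename σ f
  map_add' f g := map_add _ f g
  map_smul' a f := by
    have h : MvPolynomial.rename σ (a : MvPolynomial τ ℤ) = a := a.2 σ
    simp only [Algebra.smul_def, map_mul, RingHom.id_apply]
    congr 1

theorem X_sub_X_dvd (a b : τ) (f : MvPolynomial τ ℤ) :
    (MvPolynomial.X a - MvPolynomial.X b) ∣ f - permOp (Equiv.swap a b) f := by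
  change _ ∣ f - MvPolynomial.rename (Equiv.swap a b) f
  induction f using MvPolynomial.induction_on with
  | C z => simp
  | add f g hf hg =>
    rw [map_add, add_sub_add_comm]
    exact dvd_add hf hg
  | mul_X f c hf =>
    have hc : (MvPolynomial.X a - MvPolynomial.X b : MvPolynomial τ ℤ) ∣
        MvPolynomial.X c - MvPolynomial.X (Equiv.swap a b c) := by
      rcases eq_or_ne c a with rfl | hca
      · simp
      rcases eq_or_ne c b with rfl | hcb
      · rw [Equiv.swap_apply_right, ← neg_sub]
        exact neg_dvd.2 dvd_rfl
      · simp [Equiv.swap_apply_of_ne_of_ne hca hcb]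
    rw [map_mul, MvPolynomial.rename_X]
    have e : f * MvPolynomial.X c -
        MvPolynomial.rename (Equiv.swap a b) f * MvPolynomial.X (Equiv.swap a b c) =
        (f - MvPolynomial.rename (Equiv.swap a b) f) * MvPolynomial.X c +
        MvPolynomial.rename (Equiv.swap a b) f *
          (MvPolynomial.X c - MvPolynomial.X (Equiv.swap a b c)) := by ring
    rw [e]
    exact dvd_add (hf.mul_right _) (hc.mul_left _)

theorem X_sub_X_ne_zero {τ : Type} {a b : τ} (h : a ≠ b) :
    (MvPolynomial.X a - MvPolynomial.X b : MvPolynomial τ ℤ) ≠ 0 :=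
  sub_ne_zero.2 fun e => h (MvPolynomial.X_injective e)

/-- The divided difference (Demazure) operator `∂ f = (f - s f) / (x_a - x_b)`, where `s` swaps the
two distinct variables `x_a` and `x_b`. -/
noncomputable def divDiff (a b : τ) (h : a ≠ b) :
    Module.End (MvPolynomial.symmetricSubalgebra τ ℤ) (MvPolynomial τ ℤ) where
  toFun f := (X_sub_X_dvd a b f).choose
  map_add' f g := by
    apply mul_left_cancel₀ (X_sub_X_ne_zero h)
    rw [mul_add, ← (X_sub_X_dvd a b (f + g)).choose_spec, ← (X_sub_X_dvd a b f).choose_spec,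
      ← (X_sub_X_dvd a b g).choose_spec, map_add]
    ring
  map_smul' c f := by
    apply mul_left_cancel₀ (X_sub_X_ne_zero h)
    rw [RingHom.id_apply, mul_smul_comm, ← (X_sub_X_dvd a b (c • f)).choose_spec,
      ← (X_sub_X_dvd a b f).choose_spec, map_smul, smul_sub]

/-- The defining property of the divided difference operator. -/
theorem divDiff_spec (a b : τ) (h : a ≠ b) (f : MvPolynomial τ ℤ) :
    (MvPolynomial.X a - MvPolynomial.X b) * divDiff a b h f =
      f - MvPolynomial.rename (Equiv.swap a b) f :=
  (X_sub_X_dvd a b f).choose_spec.symm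

end DividedDifference

/-! ## The complex -/

/-- The set of the `N` indeterminates `x_1, …, x_r, z_1, …, z_{k-r}, y_1, …, y_r, w_1, …, w_{N-k-r}`
(in this order). -/
abbrev Idx (N k r : ℕ) : Type := (Fin r ⊕ Fin (k - r)) ⊕ (Fin r ⊕ Fin (N - k - r))

/-- The position of the indeterminate `x_i`. -/
def xI (N k : ℕ) {r : ℕ} (i : Fin r) : Idx N k r := Sum.inl (Sum.inl i)

/-- The position of the indeterminate `y_i`. -/
def yI (N k : ℕ) {r : ℕ} (i : Fin r) : Idx N k r := Sum.inr (Sum.inl i)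

/-- The polynomial ring `ℤ[X, Z, Y, W]`. -/
abbrev Poly (N k r : ℕ) : Type := MvPolynomial (Idx N k r) ℤ

/-- The ring `H^*(BU(N)) = Sym(X ⊔ Y ⊔ Z ⊔ W)` of symmetric polynomials in the `N` indeterminates,
acting on `ℤ[X, Z, Y, W]` by multiplication. -/
abbrev HBU (N k r : ℕ) : Subalgebra ℤ (Poly N k r) :=
  MvPolynomial.symmetricSubalgebra (Idx N k r) ℤ

/-- The elementary symmetric polynomial `e_i(Y)` in the indeterminates `Y` only. -/
noncomputable def esymmY (N k r : ℕ) (i : ℕ) : Poly N k r :=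
  MvPolynomial.rename (yI N k) (MvPolynomial.esymm (Fin r) ℤ i)

/-- `e_r(Y - x_i) = ∑_j (-1)^j e_{r-j}(Y) h_j(x_i)`, where `h_j(x_i) = x_i ^ j`. -/
noncomputable def Qpoly (N k : ℕ) {r : ℕ} (i : Fin r) : Poly N k r :=
  ∑ j ∈ Finset.range (r + 1),
    (-1) ^ j * esymmY N k r (r - j) * MvPolynomial.X (xI N k i) ^ j

theorem xI_ne_succ (N k : ℕ) {r : ℕ} (i : Fin r) (h : (i : ℕ) + 1 < r) :
    xI N k i ≠ xI N k ⟨i + 1, h⟩ := by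
  intro e
  have := congrArg Fin.val (Sum.inl_injective (Sum.inl_injective e))
  simp at this

/-- The edge component `θ_i θ_{i+1} ⋯ θ_{r-1} Q_r θ̂_{r-1} ⋯ θ̂_{i+1} θ̂_i` of the differential, defined
recursively: with `D` the same expression without its outermost factors `θ_i` and `θ̂_i`, it is
`∂_i D s_i` if `v_{i+1} = 0` and `s_i D ∂_i` if `v_{i+1} = 1`; for the last index `i` it is
multiplication by `Q_r = e_r(Y - x_r)`. Here `true` stands for `1` and `false` for `0`. -/
noncomputable def edgeMap (N k : ℕ) {r : ℕ} (v : Fin r → Bool) (i : Fin r) :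
    Module.End (HBU N k r) (Poly N k r) :=
  if h : (i : ℕ) + 1 < r then
    if v ⟨i + 1, h⟩ then
      permOp (Equiv.swap (xI N k i) (xI N k ⟨i + 1, h⟩)) * edgeMap N k v ⟨i + 1, h⟩ *
        divDiff (xI N k i) (xI N k ⟨i + 1, h⟩) (xI_ne_succ N k i h)
    else
      divDiff (xI N k i) (xI N k ⟨i + 1, h⟩) (xI_ne_succ N k i h) * edgeMap N k v ⟨i + 1, h⟩ *
        permOp (Equiv.swap (xI N k i) (xI N k ⟨i + 1, h⟩))
  else LinearMap.mulLeft (HBU N k r) (Qpoly N k i)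
termination_by r - i

/-- The sum over the vertices `v` of the cube `{0,1}^r` of one copy of `ℤ[X, Z, Y, W]` for each
vertex; the complexes below live inside it. -/
abbrev Cube (N k r : ℕ) : Type := (Fin r → Bool) → Poly N k r

noncomputable instance (N k r : ℕ) : Module (HBU N k r) (Cube N k r) := Pi.module _ _ _

noncomputable instance (N k r : ℕ) (S : Submodule (HBU N k r) (Cube N k r)) :
    Module (HBU N k r) S := S.module

/-- The differential: its component from the vertex `v` with `v_i = 1` to the vertex `w` which
differs from `v` only in that `w_i = 0` is the edge map, and there are no other components. (The
edge map at `i` reads only the entries of the vertex after the `i`-th, where `v` and `w` agree.) -/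
noncomputable def differential (N k r : ℕ) : Cube N k r →ₗ[HBU N k r] Cube N k r :=
  LinearMap.pi fun w => ∑ i ∈ Finset.univ.filter (fun i => w i = false),
    edgeMap N k w i ∘ₗ LinearMap.proj (Function.update w i true)

/-- The number of entries of a vertex equal to `1`. -/
def numOnes {r : ℕ} (v : Fin r → Bool) : ℕ := (Finset.univ.filter fun i => v i = true).card

/-- The grading shift `∑ i v_i` of a vertex, where the indices `i` start from `1`. -/
def shift {r : ℕ} (v : Fin r → Bool) : ℕ :=
  ∑ i ∈ Finset.univ.filter (fun i => v i = true), ((i : ℕ) + 1)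

/-- For a partition `lam` with `r` positive parts in weakly decreasing order: the vertices of the
form `(1^{a_1}, 0^{r_1-a_1}, …, 1^{a_m}, 0^{r_m-a_m})`, where the `r_j` are the multiplicities of the
parts. They are those weakly decreasing on each block of equal parts. -/
def Admissible {r : ℕ} (lam : Fin r → ℕ) (v : Fin r → Bool) : Prop :=
  ∀ i j, i < j → lam i = lam j → v j = true → v i = true

/-- For an admissible vertex: the polynomials invariant under
`S_{a_1} × S_{r_1-a_1} × ⋯ × S_{a_m} × S_{r_m-a_m}` acting on `X` (the permutations preserving the parts
and the entries of the vertex) and under all permutations of `Y`, of `Z` and of `W`. -/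
noncomputable def invariants (N k : ℕ) {r : ℕ} (lam : Fin r → ℕ) (v : Fin r → Bool) :
    Submodule (HBU N k r) (Poly N k r) :=
  ⨅ (σ : Equiv.Perm (Fin r)) (_ : ∀ i, lam (σ i) = lam i ∧ v (σ i) = v i)
    (ζ : Equiv.Perm (Fin (k - r))) (η : Equiv.Perm (Fin r)) (ω : Equiv.Perm (Fin (N - k - r))),
    LinearMap.eqLocus
      (permOp (Equiv.sumCongr (Equiv.sumCongr σ ζ) (Equiv.sumCongr η ω))) LinearMap.id

open Classical in
/-- The degree `n` term of the complex `F_lam = B^{r_1,…,r_m} ⊗ Sym(Z) ⊗ Sym(W)`, with the homological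
numbering (so it sits in cohomological degree `-n`): the sum over the vertices with `n` entries equal
to `1` of the invariants at admissible vertices, and of `0` at the other ones. -/
noncomputable def Fterm (N k : ℕ) {r : ℕ} (lam : Fin r → ℕ) (n : ℕ) :
    Submodule (HBU N k r) (Cube N k r) :=
  Submodule.pi Set.univ fun v =>
    if numOnes v = n ∧ Admissible lam v then invariants N k lam v else ⊥

/-- An element of the cube is homogeneous of internal degree `2 d`, where the indeterminates have
degree `2` and the summand at the vertex `v` is shifted by `2 ∑ i v_i`. -/
def IsHomog {N k r : ℕ} (c : Cube N k r) (d : ℕ) : Prop :=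
  ∀ v, ∀ m ∈ (c v).support, m.degree + shift v = d

/-! ## The integral cohomology of classifying spaces, in Borel's presentation -/

section Borel

variable {ι : Type} [Fintype ι] [DecidableEq ι]

/-- The group of diagonal unitary matrices. -/
def diagTorus (ι : Type) [Fintype ι] [DecidableEq ι] : Subgroup (Matrix.unitaryGroup ι ℂ) where
  carrier := {g | (g : Matrix ι ι ℂ).IsDiag}
  one_mem' := Matrix.isDiag_one
  mul_mem' {a b} ha hb := by
    change ((a : Matrix ι ι ℂ) * (b : Matrix ι ι ℂ)).IsDiag
    intro i j hij
    rw [Matrix.mul_apply]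
    refine Finset.sum_eq_zero fun l _ => ?_
    rcases eq_or_ne i l with rfl | hil
    · rw [hb hij, mul_zero]
    · rw [ha hil, zero_mul]
  inv_mem' {a} ha := by
    change (star (a : Matrix ι ι ℂ)).IsDiag
    exact Matrix.IsDiag.conjTranspose ha

/-- The diagonal torus of a group `J` of unitary matrices. It is a maximal torus of `J` for the
groups of block matrices considered here. -/
def torus (J : Subgroup (Matrix.unitaryGroup ι ℂ)) : Subgroup (Matrix.unitaryGroup ι ℂ) :=
  J ⊓ diagTorus ι

/-- The character lattice `Hom(T, U(1))` of the diagonal torus `T` of `J`, written additively. -/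
abbrev CharLattice (J : Subgroup (Matrix.unitaryGroup ι ℂ)) : Type :=
  Additive (PontryaginDual (torus J))

/-- `H^*(BT; ℤ)` for the diagonal torus `T` of `J`: the symmetric algebra on the character lattice
(a character sits in cohomological degree `2`, as the first Chern class of its line bundle). -/
abbrev HBT (J : Subgroup (Matrix.unitaryGroup ι ℂ)) : Type := SymmetricAlgebra ℤ (CharLattice J)

/-- Conjugation by an element normalizing the torus. -/
def conjHom (J : Subgroup (Matrix.unitaryGroup ι ℂ)) (g : Matrix.unitaryGroup ι ℂ)
    (hg : ∀ t ∈ torus J, g * t * g⁻¹ ∈ torus J) : torus J →ₜ* torus J where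
  toFun t := ⟨g * t * g⁻¹, hg t t.2⟩
  map_one' := by ext; simp
  map_mul' s t := by ext1; simp [mul_assoc]
  continuous_toFun := by fun_prop

/-- The induced action on `H^*(BT; ℤ)`. -/
noncomputable def conjAct (J : Subgroup (Matrix.unitaryGroup ι ℂ)) (g : Matrix.unitaryGroup ι ℂ)
    (hg : ∀ t ∈ torus J, g * t * g⁻¹ ∈ torus J) : HBT J →ₐ[ℤ] HBT J :=
  SymmetricAlgebra.lift (SymmetricAlgebra.ι ℤ (CharLattice J) ∘ₗ
    (MonoidHom.toAdditive
      (PontryaginDual.map (conjHom J g hg)).toMonoidHom).toIntLinearMap)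

/-- `H^*(BJ; ℤ)`, as the ring `H^*(BT; ℤ)^W` of invariants of the Weyl group, that is, of the elements
of `J` that normalize the diagonal torus `T`. (By Borel, restriction to a maximal torus `T` identifies
`H^*(BJ; ℤ)` with these invariants when `J` is a product of unitary groups.) -/
noncomputable def HB (J : Subgroup (Matrix.unitaryGroup ι ℂ)) : Subalgebra ℤ (HBT J) :=
  ⨅ (g : Matrix.unitaryGroup ι ℂ) (_ : g ∈ J) (hg : ∀ t ∈ torus J, g * t * g⁻¹ ∈ torus J),
    AlgHom.equalizer (conjAct J g hg) (AlgHom.id ℤ (HBT J))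

theorem torus_isDiag (J : Subgroup (Matrix.unitaryGroup ι ℂ)) (t : torus J) :
    ((t : Matrix.unitaryGroup ι ℂ) : Matrix ι ι ℂ).IsDiag := t.2.2

theorem norm_diag (J : Subgroup (Matrix.unitaryGroup ι ℂ)) (t : torus J) (i : ι) :
    ((t : Matrix.unitaryGroup ι ℂ) : Matrix ι ι ℂ) i i ∈ Submonoid.unitSphere ℂ := by
  have h := congrFun (congrFun (Matrix.UnitaryGroup.star_mul_self (t : Matrix.unitaryGroup ι ℂ)) i) i
  rw [Matrix.mul_apply, Finset.sum_eq_single i, Matrix.one_apply_eq, Matrix.star_apply] at h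
  · rw [show (_ ∈ Submonoid.unitSphere ℂ ↔ _) from mem_sphere_zero_iff_norm]
    have h2 := congrArg norm h
    rw [norm_mul, norm_star, norm_one] at h2
    nlinarith [norm_nonneg (((t : Matrix.unitaryGroup ι ℂ) : Matrix ι ι ℂ) i i)]
  · intro j _ hj
    rw [torus_isDiag J t hj, mul_zero]
  · simp

/-- The `i`-th diagonal entry, as a character of the diagonal torus of `J`. -/
def coordChar (J : Subgroup (Matrix.unitaryGroup ι ℂ)) (i : ι) : torus J →ₜ* Circle where
  toFun t := ⟨((t : Matrix.unitaryGroup ι ℂ) : Matrix ι ι ℂ) i i, norm_diag J t i⟩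
  map_one' := by
    apply Circle.ext
    change (1 : Matrix ι ι ℂ) i i = 1
    simp
  map_mul' s t := by
    apply Circle.ext
    change ((s : Matrix.unitaryGroup ι ℂ) * (t : Matrix.unitaryGroup ι ℂ) : Matrix ι ι ℂ) i i =
      ((s : Matrix.unitaryGroup ι ℂ) : Matrix ι ι ℂ) i i *
      ((t : Matrix.unitaryGroup ι ℂ) : Matrix ι ι ℂ) i i
    rw [Matrix.mul_apply, Finset.sum_eq_single i]
    · intro j _ hj
      rw [torus_isDiag J t hj, mul_zero]
    · simp
  continuous_toFun := by
    refine Continuous.subtype_mk ?_ _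
    exact (continuous_subtype_val.comp continuous_subtype_val).matrix_elem i i

/-- The class in `H^2(BT; ℤ)` of the `i`-th diagonal entry. -/
noncomputable def coordClass (J : Subgroup (Matrix.unitaryGroup ι ℂ)) (i : ι) : HBT J :=
  SymmetricAlgebra.ι ℤ (CharLattice J) (Additive.ofMul (coordChar J i : PontryaginDual (torus J)))

/-- Conjugation by an element that normalizes the torus permutes the diagonal entries: the traces
agree, and distinct characters are linearly independent. -/
theorem exists_perm_coordChar (J : Subgroup (Matrix.unitaryGroup ι ℂ)) (g : Matrix.unitaryGroup ι ℂ)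
    (hg : ∀ t ∈ torus J, g * t * g⁻¹ ∈ torus J) :
    ∃ σ : Equiv.Perm ι, ∀ i, (coordChar J i).comp (conjHom J g hg) = coordChar J (σ i) := by
  classical
  let χ : ι → (torus J →* ℂ) := fun i => Circle.coeHom.comp (coordChar J i).toMonoidHom
  let χ' : ι → (torus J →* ℂ) := fun i =>
    Circle.coeHom.comp ((coordChar J i).comp (conjHom J g hg)).toMonoidHom
  have inj : Function.Injective
      (fun φ : torus J →ₜ* Circle => (Circle.coeHom.comp φ.toMonoidHom : torus J →* ℂ)) := by
    intro φ ψ h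
    ext t
    exact DFunLike.congr_fun h t
  have tr : ∑ i, ((χ' i : torus J →* ℂ) : torus J → ℂ) = ∑ i, ((χ i : torus J →* ℂ) : torus J → ℂ) := by
    funext t
    rw [Finset.sum_apply, Finset.sum_apply]
    change Matrix.trace ((g * t * g⁻¹ : Matrix.unitaryGroup ι ℂ) : Matrix ι ι ℂ) =
      Matrix.trace ((t : Matrix.unitaryGroup ι ℂ) : Matrix ι ι ℂ)
    rw [mul_assoc]
    change Matrix.trace ((g : Matrix ι ι ℂ) *
      (((t : Matrix.unitaryGroup ι ℂ) * g⁻¹ : Matrix.unitaryGroup ι ℂ) : Matrix ι ι ℂ)) = _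
    rw [Matrix.trace_mul_comm]
    congr 1
    change (((t : Matrix.unitaryGroup ι ℂ) * g⁻¹ * g : Matrix.unitaryGroup ι ℂ) : Matrix ι ι ℂ) = _
    rw [inv_mul_cancel_right]
  have li := linearIndependent_monoidHom (torus J) ℂ
  have cnt : ∑ i, Finsupp.single (χ' i) (1 : ℂ) = ∑ i, Finsupp.single (χ i) (1 : ℂ) := by
    apply li
    simpa [map_sum, Finsupp.linearCombination_single] using tr
  have card : ∀ φ : torus J →* ℂ,
      Fintype.card {i // χ' i = φ} = Fintype.card {i // χ i = φ} := by
    intro φ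
    have h := DFunLike.congr_fun cnt φ
    simp only [Finsupp.finsetSum_apply, Finsupp.single_apply, Finset.sum_boole] at h
    rw [Fintype.card_subtype, Fintype.card_subtype]
    exact_mod_cast h
  let e : ι ≃ ι := (Equiv.sigmaFiberEquiv χ').symm.trans
    ((Equiv.sigmaCongrRight fun φ => Fintype.equivOfCardEq (card φ)).trans (Equiv.sigmaFiberEquiv χ))
  refine ⟨e, fun i => inj ?_⟩
  exact (Fintype.equivOfCardEq (card (χ' i)) ⟨i, rfl⟩).2.symm

/-- The evaluation of symmetric polynomials at the diagonal entries is invariant under the Weyl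
group. -/
theorem aeval_coordClass_mem (J : Subgroup (Matrix.unitaryGroup ι ℂ))
    (p : MvPolynomial.symmetricSubalgebra ι ℤ) :
    MvPolynomial.aeval (coordClass J) (p : MvPolynomial ι ℤ) ∈ HB J := by
  simp only [HB, Algebra.mem_iInf]
  intro g _ hg
  obtain ⟨σ, hσ⟩ := exists_perm_coordChar J g hg
  rw [AlgHom.mem_equalizer, AlgHom.id_apply]
  have h1 : ∀ i, conjAct J g hg (coordClass J i) = coordClass J (σ i) := by
    intro i
    rw [conjAct, coordClass, SymmetricAlgebra.lift_ι_apply, coordClass, ← hσ i]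
    rfl
  have h2 : (conjAct J g hg).comp (MvPolynomial.aeval (coordClass J)) =
      (MvPolynomial.aeval (coordClass J)).comp (MvPolynomial.rename σ) := by
    ext i
    simp [h1]
  have h3 := DFunLike.congr_fun h2 (p : MvPolynomial ι ℤ)
  simp only [AlgHom.comp_apply] at h3
  rw [h3, p.2 σ]

/-- The restriction map `H^*(BU(ι)) → H^*(BJ)`, where `H^*(BU(ι))` is the ring of symmetric polynomials
in indeterminates indexed by `ι`: each indeterminate is sent to the corresponding diagonal entry. -/
noncomputable def restriction (J : Subgroup (Matrix.unitaryGroup ι ℂ)) :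
    MvPolynomial.symmetricSubalgebra ι ℤ →ₐ[ℤ] HB J :=
  ((MvPolynomial.aeval (coordClass J)).comp (MvPolynomial.symmetricSubalgebra ι ℤ).val).codRestrict
    (HB J) (aeval_coordClass_mem J)

/-- The ring `H^*(BJ; ℤ)` as a type. -/
def CohomBJ (J : Subgroup (Matrix.unitaryGroup ι ℂ)) : Type := HB J

noncomputable instance (J : Subgroup (Matrix.unitaryGroup ι ℂ)) : CommRing (CohomBJ J) :=
  inferInstanceAs (CommRing (HB J))

/-- The inclusion of `H^*(BJ; ℤ)` into `H^*(BT; ℤ)`. -/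
def CohomBJ.val {J : Subgroup (Matrix.unitaryGroup ι ℂ)} (p : CohomBJ J) : HBT J := Subtype.val p

/-- The elements of `H^*(BJ; ℤ)` of cohomological degree `2 d`. -/
def CohomBJ.IsHomog {J : Subgroup (Matrix.unitaryGroup ι ℂ)} (p : CohomBJ J) (d : ℕ) : Prop :=
  p.val ∈ LinearMap.range (SymmetricAlgebra.ι ℤ (CharLattice J)) ^ d

/-- `H^*(BJ)` is a module over `H^*(BU(ι))` through the restriction map. -/
noncomputable instance (J : Subgroup (Matrix.unitaryGroup ι ℂ)) :
    Module (MvPolynomial.symmetricSubalgebra ι ℤ) (CohomBJ J) :=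
  Module.compHom (HB J) (restriction J).toRingHom

end Borel

/-! ## The group `J_lam` -/

/-- The group of unitary matrices with diagonal blocks `U_1, …, U_m, V, U_1, …, U_m, W`, of sizes
`r_1, …, r_m, k - r, r_1, …, r_m, N - k - r`, where the `r_j` are the multiplicities of the parts of the
partition `lam`. The matrix `U` is the block diagonal matrix of `U_1, …, U_m`. -/
def Jgroup (N k : ℕ) {r : ℕ} (lam : Fin r → ℕ) : Subgroup (Matrix.unitaryGroup (Idx N k r) ℂ) where
  carrier := {g | ∃ (U : Matrix (Fin r) (Fin r) ℂ) (V : Matrix (Fin (k - r)) (Fin (k - r)) ℂ)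
    (W : Matrix (Fin (N - k - r)) (Fin (N - k - r)) ℂ),
    (∀ a b, lam a ≠ lam b → U a b = 0) ∧
    (g : Matrix (Idx N k r) (Idx N k r) ℂ) =
      Matrix.fromBlocks (Matrix.fromBlocks U 0 0 V) 0 0 (Matrix.fromBlocks U 0 0 W)}
  one_mem' := ⟨1, 1, 1, fun a b h => Matrix.one_apply_ne fun e => h (e ▸ rfl), by simp⟩
  mul_mem' := by
    rintro g g' ⟨U, V, W, hU, hg⟩ ⟨U', V', W', hU', hg'⟩
    refine ⟨U * U', V * V', W * W', fun a b h => ?_, ?_⟩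
    · rw [Matrix.mul_apply]
      refine Finset.sum_eq_zero fun c _ => ?_
      by_cases hc : lam a = lam c
      · rw [hU' c b fun e => h (hc.trans e), mul_zero]
      · rw [hU a c hc, zero_mul]
    · change (g : Matrix (Idx N k r) (Idx N k r) ℂ) * (g' : Matrix (Idx N k r) (Idx N k r) ℂ) = _
      rw [hg, hg']
      simp [Matrix.fromBlocks_multiply]
  inv_mem' := by
    rintro g ⟨U, V, W, hU, hg⟩
    refine ⟨U.conjTranspose, V.conjTranspose, W.conjTranspose, fun a b h => ?_, ?_⟩
    · rw [Matrix.conjTranspose_apply, hU b a h.symm, star_zero]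
    · change (g : Matrix (Idx N k r) (Idx N k r) ℂ).conjTranspose = _
      rw [hg]
      simp [Matrix.fromBlocks_conjTranspose]

end FlagResolution

/-! Enlarge the complex first: let every vertex of the cube carry all of ℤ[X] ⊗ Sym(Y) ⊗ Sym(Z) ⊗
Sym(W) (`chains`), resolve there, and recover F_λ afterwards as a complex of invariants.

The composite d² is a sum over square faces of the cube. On the face in directions i < j the edge
map in direction i reads the j-th entry, so its two occurrences differ. For adjacent directions the
required cancellation is an identity in the nilHecke algebra, proved by recursion on the edge map
(`edgeMap_relation`). For distant directions the outer factors commute past the other edge map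
(`edgeMap_anticomm`).

The full cube is an iterated mapping cone. Chains supported where the first i entries vanish form
the cone of the edge maps in direction i between two copies of the chains whose first i+1 entries
vanish. By descending induction their homology sits in degree 0 and is the image of the substitution
y_j ↦ x_j for j ≥ i (`evY`, with indices counted from 0). On the degree 0 homology of the smaller
complex the edge maps act simply as multiplication by ∏_{j≤i} (y_j - x_i), because all divided
differences collapse after the substitution (`evY_edgeMap`). This is a nonzerodivisor, and it
generates exactly the kernel of the next substitution (`exists_of_evY_eq_zero`). Hence the cone has
no new higher homology and the expected degree 0 homology (`exists_differential_eq`).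

To reach F_λ, let operators `tOp` act on the cube: they are divided differences at vertices with
equal adjacent entries, and they exchange unequal entries in one order only. They commute with d,
square to zero and satisfy the braid relations. F_λ is their joint kernel over the positions where
two consecutive parts of λ agree (`mem_Fterm_iff`). Exactness descends to this kernel one position
at a time, from right to left (`ExactAt.insert_start`). A primitive c of an invariant cycle is
corrected by boundaries so that longer, then shorter words T_{i+j-1} ⋯ T_i kill it, ending with T_i
itself. Each correction needs exactness one degree higher, which a downward induction on the degree
supplies, and the surjectivity of the word from the invariants of the smaller group onto those of
the larger one (`exists_section`), which comes from ∂_{m+n-1} ⋯ ∂_m x_m^n = 1.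

For freeness, the whole polynomial ring is free over the invariants of any coloring, with a
homogeneous basis containing 1, by adjoining variables one at a time and interpolating. So each ring
of invariants is a graded direct summand of a free module over the symmetric polynomials. Nakayama
over this connected graded ring, together with freeness of submodules of ℤ^n, makes it free
(`exists_homogeneous_basis`).

In degree 0, the characters of the torus of J_λ are freely generated by the diagonal entries at X, Z
and W (`latticeHom_bijective`). Restriction to the torus therefore has the same kernel as y_j ↦ x_j
for all j. The Weyl group acts by the permutations inside the blocks: permutation matrices realize
all of them, and linear independence of characters shows that nothing else occurs
(`exists_perm_block`). -/

namespace FlagResolution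

/-! ## Polynomials invariant under the permutations preserving a coloring of the variables -/

section Coloring

variable {τ : Type} {γ : Type*}

/-- The polynomials invariant under all permutations of the variables preserving a coloring. -/
noncomputable def colorInv (κ : τ → γ) : Subalgebra ℤ (MvPolynomial τ ℤ) where
  carrier := {f | ∀ σ : Equiv.Perm τ, (∀ a, κ (σ a) = κ a) → MvPolynomial.rename σ f = f}
  mul_mem' {f g} hf hg σ hσ := by rw [map_mul, hf σ hσ, hg σ hσ]
  add_mem' {f g} hf hg σ hσ := by rw [map_add, hf σ hσ, hg σ hσ]
  algebraMap_mem' z σ _ := by simp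

theorem mem_colorInv {κ : τ → γ} {f : MvPolynomial τ ℤ} :
    f ∈ colorInv κ ↔ ∀ σ : Equiv.Perm τ, (∀ a, κ (σ a) = κ a) → MvPolynomial.rename σ f = f :=
  Iff.rfl

theorem rename_mul_apply (σ π : Equiv.Perm τ) (f : MvPolynomial τ ℤ) :
    MvPolynomial.rename (σ * π) f = MvPolynomial.rename σ (MvPolynomial.rename π f) := by
  rw [MvPolynomial.rename_rename]; rfl

/-- Invariants of a finer coloring are more. -/
theorem colorInv_mono {γ' : Type*} {κ : τ → γ} {κ' : τ → γ'}
    (h : ∀ a b, κ' a = κ' b → κ a = κ b) : colorInv κ ≤ colorInv κ' :=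
  fun _ hf σ hσ => hf σ fun a => h _ _ (hσ a)

theorem symmetric_le_colorInv (κ : τ → γ) {f : MvPolynomial τ ℤ} (hf : f.IsSymmetric) :
    f ∈ colorInv κ := fun σ _ => hf σ

theorem mem_colorInv_const {f : MvPolynomial τ ℤ} :
    f ∈ colorInv (fun _ : τ => ()) ↔ f.IsSymmetric :=
  ⟨fun h σ => h σ fun _ => rfl, symmetric_le_colorInv _⟩

variable [DecidableEq τ]

/-- The stabilizer of a coloring is generated by the transpositions inside its color classes. -/
theorem mem_colorInv_iff_swap [Finite τ] {κ : τ → γ} {f : MvPolynomial τ ℤ} :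
    f ∈ colorInv κ ↔
      ∀ a b, a ≠ b → κ a = κ b → MvPolynomial.rename (Equiv.swap a b) f = f := by
  have := Fintype.ofFinite τ
  constructor
  · intro h a b _ hab
    refine h _ fun c => ?_
    rcases em (c = a) with rfl | hca
    · simp [hab]
    rcases em (c = b) with rfl | hcb
    · simp [hab]
    rw [Equiv.swap_apply_of_ne_of_ne hca hcb]
  · intro h
    suffices ∀ n, ∀ σ : Equiv.Perm τ, σ.support.card = n → (∀ a, κ (σ a) = κ a) →
        MvPolynomial.rename σ f = f from fun σ hσ => this _ σ rfl hσ
    intro n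
    induction n using Nat.strong_induction_on with
    | _ n ih =>
      intro σ hn hσ
      by_cases h1 : σ = 1
      · subst h1
        simp [Equiv.Perm.coe_one]
      obtain ⟨a, ha⟩ : ∃ a, σ a ≠ a := by
        by_contra! hc
        exact h1 (Equiv.ext hc)
      have hlt := Equiv.Perm.card_support_swap_mul ha
      -- The product with this transposition fixes `a`, so its support is smaller, and it still
      -- preserves colors.
      have key := ih _ (hn ▸ hlt) (Equiv.swap a (σ a) * σ) rfl fun b => by
        rw [Equiv.Perm.mul_apply]
        rcases em (σ b = a) with hb | hb
        · rw [hb, Equiv.swap_apply_left, hσ, ← hb, hσ]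
        rcases em (σ b = σ a) with hb' | hb'
        · rw [hb', Equiv.swap_apply_right, ← hσ b, hb', hσ]
        rw [Equiv.swap_apply_of_ne_of_ne hb hb', hσ]
      have e : σ = Equiv.swap a (σ a) * (Equiv.swap a (σ a) * σ) := by
        rw [← mul_assoc, Equiv.swap_mul_self, one_mul]
      rw [e, rename_mul_apply, key, h _ _ ha.symm (hσ a).symm]

/-- Setting a variable equal to another one. -/
noncomputable def subst (a b : τ) : MvPolynomial τ ℤ →ₐ[ℤ] MvPolynomial τ ℤ :=
  MvPolynomial.rename (Function.update id a b)

theorem X_sub_X_dvd_sub_subst (a b : τ) (f : MvPolynomial τ ℤ) :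
    (MvPolynomial.X a - MvPolynomial.X b) ∣ f - subst a b f := by
  induction f using MvPolynomial.induction_on with
  | C z => simp [subst]
  | add f g hf hg =>
    rw [map_add, add_sub_add_comm]
    exact dvd_add hf hg
  | mul_X f c hf =>
    have hc : (MvPolynomial.X a - MvPolynomial.X b : MvPolynomial τ ℤ) ∣
        MvPolynomial.X c - subst a b (MvPolynomial.X c) := by
      rcases eq_or_ne c a with rfl | hca
      · simp [subst]
      · simp [subst, hca]
    have e : f * MvPolynomial.X c - subst a b (f * MvPolynomial.X c) =
        (f - subst a b f) * MvPolynomial.X c +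
        subst a b f * (MvPolynomial.X c - subst a b (MvPolynomial.X c)) := by
      rw [map_mul]; ring
    rw [e]
    exact dvd_add (hf.mul_right _) (hc.mul_left _)

/-- The difference generates the kernel of a substitution into a domain; this is what makes it
prime. -/
theorem X_sub_X_dvd_iff (a b : τ) (f : MvPolynomial τ ℤ) :
    (MvPolynomial.X a - MvPolynomial.X b) ∣ f ↔ subst a b f = 0 := by
  constructor
  · rintro ⟨g, rfl⟩
    rw [map_mul]
    rcases eq_or_ne a b with rfl | h
    · simp
    · simp [subst, h.symm, Function.update_of_ne]
  · intro h
    simpa [h] using X_sub_X_dvd_sub_subst a b f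

theorem prime_X_sub_X {a b : τ} (h : a ≠ b) :
    Prime (MvPolynomial.X a - MvPolynomial.X b : MvPolynomial τ ℤ) := by
  refine ⟨X_sub_X_ne_zero h, fun hu => ?_, fun f g hfg => ?_⟩
  · have := (X_sub_X_dvd_iff a b 1).1 (isUnit_iff_dvd_one.1 hu)
    simp at this
  · rw [X_sub_X_dvd_iff, map_mul, mul_eq_zero] at hfg
    rwa [X_sub_X_dvd_iff, X_sub_X_dvd_iff]

theorem isRelPrime_X_sub_X {a b c : τ} (hab : a ≠ b) (hac : a ≠ c) (hbc : b ≠ c) :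
    IsRelPrime (MvPolynomial.X a - MvPolynomial.X b : MvPolynomial τ ℤ)
      (MvPolynomial.X a - MvPolynomial.X c) := by
  rw [(prime_X_sub_X hab).irreducible.isRelPrime_iff_not_dvd, X_sub_X_dvd_iff]
  simp [subst, hac.symm, sub_eq_zero, (MvPolynomial.X_injective (R := ℤ)).eq_iff, hbc,
    Function.update_of_ne]

/-- The factors are pairwise non-associated primes, so separate divisibilities multiply. -/
theorem prod_X_sub_X_dvd {ι : Type*} (S : Finset ι) (a : τ) (b : ι → τ) (f : MvPolynomial τ ℤ)
    (hb : ∀ i ∈ S, a ≠ b i) (hinj : Set.InjOn b S)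
    (h : ∀ i ∈ S, (MvPolynomial.X a - MvPolynomial.X (b i)) ∣ f) :
    ∏ i ∈ S, (MvPolynomial.X a - MvPolynomial.X (b i)) ∣ f :=
  Finset.prod_dvd_of_isRelPrime (fun i hi j hj hij =>
    isRelPrime_X_sub_X (hb i hi) (hb j hj) fun e => hij (hinj hi hj e)) h

/-- Refine a coloring by making the color of one element unique. -/
def splitOff (κ : τ → γ) (t : τ) : τ → γ × Bool := fun a => (κ a, decide (a = t))

variable {κ : τ → γ} {t : τ}

/-- `f` is fixed by the stabilizer of `t`, so a conjugate of `f` depends only on the coset, that is,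
on the image of `t`. -/
theorem rename_eq_of_apply_eq {f : MvPolynomial τ ℤ} (hf : f ∈ colorInv (splitOff κ t))
    {σ π : Equiv.Perm τ} (hσ : ∀ a, κ (σ a) = κ a) (hπ : ∀ a, κ (π a) = κ a) (h : σ t = π t) :
    MvPolynomial.rename σ f = MvPolynomial.rename π f := by
  have := hf (π⁻¹ * σ) fun a => by
    have h1 : κ ((π⁻¹ * σ) a) = κ a := by
      rw [← hπ, ← hσ a]; simp
    have h2 : (π⁻¹ * σ) a = t ↔ a = t := by
      rw [Equiv.Perm.mul_apply, Equiv.Perm.inv_eq_iff_eq, ← h, σ.apply_eq_iff_eq]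
    rw [splitOff, splitOff, h1, decide_eq_decide.2 h2]
  rw [rename_mul_apply] at this
  conv_rhs => rw [← this]
  rw [← rename_mul_apply]
  simp

theorem swap_preserves {a b : τ} (h : κ a = κ b) (c : τ) : κ (Equiv.swap a b c) = κ c := by
  rcases em (c = a) with rfl | hca
  · simp [h]
  rcases em (c = b) with rfl | hcb
  · simp [h]
  rw [Equiv.swap_apply_of_ne_of_ne hca hcb]

/-- Newton interpolation of the conjugates of `f` at the variables. No denominators appear: the
error at a new node is divisible by its difference with each old node, hence by the product of these
differences. -/
theorem exists_interpolation {f : MvPolynomial τ ℤ} (hf : f ∈ colorInv (splitOff κ t))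
    (S : Finset τ) (hS : ∀ s ∈ S, κ s = κ t) :
    ∃ p : Polynomial (MvPolynomial τ ℤ), p.degree < S.card ∧
      ∀ s ∈ S, p.eval (MvPolynomial.X s) = MvPolynomial.rename (Equiv.swap t s) f := by
  induction S using Finset.induction_on with
  | empty => exact ⟨0, by simp, by simp⟩
  | insert a S ha ih =>
    obtain ⟨p, hdeg, hp⟩ := ih fun s hs => hS s (Finset.mem_insert_of_mem hs)
    have hne : ∀ s ∈ S, a ≠ s := fun s hs e => ha (e ▸ hs)
    obtain ⟨c, hc⟩ : ∏ s ∈ S, (MvPolynomial.X a - MvPolynomial.X s) ∣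
        MvPolynomial.rename (Equiv.swap t a) f - p.eval (MvPolynomial.X a) := by
      refine prod_X_sub_X_dvd S a id _ hne (Set.injOn_id _) fun s hs => ?_
      have h1 : (MvPolynomial.X a - MvPolynomial.X s : MvPolynomial τ ℤ) ∣
          MvPolynomial.rename (Equiv.swap t a) f - MvPolynomial.rename (Equiv.swap t s) f := by
        -- The conjugates attached to the nodes `a` and `s` are exchanged by the transposition of
        -- `a` and `s`, so they are congruent modulo the difference of these two variables.
        have e : MvPolynomial.rename (Equiv.swap t s) f =
            MvPolynomial.rename (Equiv.swap a s) (MvPolynomial.rename (Equiv.swap t a) f) := by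
          rw [← rename_mul_apply]
          refine rename_eq_of_apply_eq hf
            (swap_preserves (hS s (Finset.mem_insert_of_mem hs)).symm) (fun c => ?_) (by simp)
          have hta := (hS a (Finset.mem_insert_self _ _)).symm
          have has : κ a = κ s := hta.symm.trans (hS s (Finset.mem_insert_of_mem hs)).symm
          rw [Equiv.Perm.mul_apply, swap_preserves has, swap_preserves hta]
        rw [e]
        exact X_sub_X_dvd a s _
      have h2 := Polynomial.sub_dvd_eval_sub (MvPolynomial.X a) (MvPolynomial.X s) p
      rw [hp s hs] at h2
      have := dvd_sub h1 h2
      simpa using this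
    refine ⟨p + Polynomial.C c * ∏ s ∈ S, (Polynomial.X - Polynomial.C (MvPolynomial.X s)), ?_, ?_⟩
    · rw [Finset.card_insert_of_notMem ha]
      refine lt_of_le_of_lt (Polynomial.degree_add_le _ _) (max_lt ?_ ?_)
      · exact hdeg.trans (by exact_mod_cast Nat.lt_succ_self _)
      · refine lt_of_le_of_lt (Polynomial.degree_mul_le _ _) ?_
        have h1 : (∏ s ∈ S, (Polynomial.X - Polynomial.C
            (MvPolynomial.X s : MvPolynomial τ ℤ))).degree = (S.card : WithBot ℕ) := by
          rw [Polynomial.degree_prod]; simp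
        rw [h1]
        calc (Polynomial.C c).degree + (S.card : WithBot ℕ) ≤ 0 + S.card :=
              by gcongr; exact Polynomial.degree_C_le
          _ < _ := by rw [zero_add]; exact_mod_cast Nat.lt_succ_self _
    · intro s hs
      rw [Polynomial.eval_add, Polynomial.eval_mul, Polynomial.eval_C, Polynomial.eval_prod]
      simp only [Polynomial.eval_sub, Polynomial.eval_X, Polynomial.eval_C]
      rcases Finset.mem_insert.1 hs with rfl | hs
      · rw [mul_comm, ← hc]; ring
      · rw [hp s hs, Finset.prod_eq_zero hs (sub_self _)]; ring

variable [Fintype τ]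

/-- The number of variables with the same color as `t`. -/
def classCard [DecidableEq γ] (κ : τ → γ) (t : τ) : ℕ :=
  (Finset.univ.filter fun s => κ s = κ t).card

/-- Moving `t` through its color class turns one equation into `classCard κ t` equations with the
same coefficients: two polynomials of smaller degree agree at that many distinct nodes. -/
theorem splitOff_expansion_unique [DecidableEq γ] (g h : ℕ → MvPolynomial τ ℤ)
    (hg : ∀ l, g l ∈ colorInv κ) (hh : ∀ l, h l ∈ colorInv κ)
    (e : ∑ l ∈ Finset.range (classCard κ t), g l * MvPolynomial.X t ^ l =
      ∑ l ∈ Finset.range (classCard κ t), h l * MvPolynomial.X t ^ l) :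
    ∀ l < classCard κ t, g l = h l := by
  let P : (ℕ → MvPolynomial τ ℤ) → Polynomial (MvPolynomial τ ℤ) := fun g =>
    ∑ l ∈ Finset.range (classCard κ t), Polynomial.C (g l) * Polynomial.X ^ l
  have hdeg : ∀ g, (P g).degree < (classCard κ t : WithBot ℕ) := fun g => by
    refine (Polynomial.degree_sum_le _ _).trans_lt ?_
    rw [Finset.sup_lt_iff (WithBot.bot_lt_coe _)]
    intro l hl
    exact (Polynomial.degree_C_mul_X_pow_le _ _).trans_lt (by exact_mod_cast Finset.mem_range.1 hl)
  have hP : P g = P h := by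
    refine Polynomial.eq_of_degrees_lt_of_eval_index_eq
      (Finset.univ.filter fun s => κ s = κ t) (v := fun s => (MvPolynomial.X s : MvPolynomial τ ℤ))
      (MvPolynomial.X_injective.injOn) (hdeg g) (hdeg h) fun s hs => ?_
    have hs : κ t = κ s := (Finset.mem_filter.1 hs).2.symm
    have := congrArg (MvPolynomial.rename (Equiv.swap t s)) e
    simp only [map_sum, map_mul, map_pow, MvPolynomial.rename_X, Equiv.swap_apply_left] at this
    simp only [P, Polynomial.eval_finsetSum, Polynomial.eval_mul, Polynomial.eval_C,
      Polynomial.eval_pow, Polynomial.eval_X]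
    simpa only [fun l => hg l _ (swap_preserves hs), fun l => hh l _ (swap_preserves hs)] using this
  intro l hl
  have := congrArg (fun p => Polynomial.coeff p l) hP
  simpa [P, Polynomial.coeff_C_mul, Polynomial.coeff_X_pow, hl] using this

/-- Interpolating all conjugates of `f` gives a polynomial whose value at the variable `t` is `f`.
Together with uniqueness, the powers of that variable form a basis over the coarser invariants. -/
theorem splitOff_expansion_exists [DecidableEq γ] {f : MvPolynomial τ ℤ}
    (hf : f ∈ colorInv (splitOff κ t)) :
    ∃ g : ℕ → MvPolynomial τ ℤ, (∀ l, g l ∈ colorInv κ) ∧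
      f = ∑ l ∈ Finset.range (classCard κ t), g l * MvPolynomial.X t ^ l := by
  obtain ⟨p, hdeg, hp⟩ := exists_interpolation hf (Finset.univ.filter fun s => κ s = κ t)
    (fun s hs => (Finset.mem_filter.1 hs).2)
  refine ⟨p.coeff, fun l σ hσ => ?_, ?_⟩
  -- A color-preserving permutation moves nodes and values alike, so it preserves the interpolation
  -- problem, and hence its unique solution.
  · have hmap : p.map (MvPolynomial.rename σ).toRingHom = p := by
      refine Polynomial.eq_of_degrees_lt_of_eval_index_eq
        (Finset.univ.filter fun s => κ s = κ t)
        (v := fun s => (MvPolynomial.X s : MvPolynomial τ ℤ))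
        (MvPolynomial.X_injective.injOn) ((Polynomial.degree_map_le).trans_lt hdeg) hdeg
        fun s hs => ?_
      have hs' : κ s = κ t := (Finset.mem_filter.1 hs).2
      have hk : ∀ a, κ (σ⁻¹ a) = κ a := fun a => by rw [← hσ]; simp
      have hs2 : κ (σ⁻¹ s) = κ t := (hk s).trans hs'
      have h1 := hp (σ⁻¹ s) (by simpa using hs2)
      have h2 := congrArg (MvPolynomial.rename σ) h1
      have h3 : (p.map (MvPolynomial.rename σ).toRingHom).eval (MvPolynomial.X s) =
          MvPolynomial.rename σ (p.eval (MvPolynomial.X (σ⁻¹ s))) := by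
        rw [show (MvPolynomial.X s : MvPolynomial τ ℤ) =
          (MvPolynomial.rename σ).toRingHom (MvPolynomial.X (σ⁻¹ s)) by simp, Polynomial.eval_map,
          Polynomial.eval₂_at_apply]
        rfl
      rw [h3, h2, hp s hs, ← rename_mul_apply]
      exact rename_eq_of_apply_eq hf
        (fun a => by rw [Equiv.Perm.mul_apply, hσ, swap_preserves hs2.symm])
        (swap_preserves hs'.symm) (by simp)
    conv_rhs => rw [← hmap]
    rw [Polynomial.coeff_map]
    rfl
  · have h1 := hp t (by simp)
    rw [Equiv.swap_self] at h1
    have h2 : MvPolynomial.rename (Equiv.refl τ) f = f := by simp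
    rw [← h2, ← h1, Polynomial.eval_eq_sum_range' (n := classCard κ t)]
    rcases eq_or_ne p 0 with rfl | h0
    · simp only [Polynomial.natDegree_zero]
      exact Finset.card_pos.2 ⟨t, by simp⟩
    · exact (Polynomial.natDegree_lt_iff_degree_lt h0).2 hdeg

end Coloring


/-! ## Relations between permutations and divided differences -/

section Operators

variable {τ : Type}

theorem permOp_apply (σ : Equiv.Perm τ) (f : MvPolynomial τ ℤ) :
    permOp σ f = MvPolynomial.rename σ f := rfl

theorem permOp_mul (σ π : Equiv.Perm τ) : permOp (σ * π) = permOp σ * permOp π :=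
  LinearMap.ext fun f => rename_mul_apply σ π f

theorem permOp_one : permOp (1 : Equiv.Perm τ) = 1 :=
  LinearMap.ext fun f => by simp [permOp_apply, Equiv.Perm.coe_one]

variable [DecidableEq τ] {a b c d : τ}

theorem divDiff_eq (h : a ≠ b) {f g : MvPolynomial τ ℤ}
    (e : (MvPolynomial.X a - MvPolynomial.X b) * g =
      f - MvPolynomial.rename (Equiv.swap a b) f) : divDiff a b h f = g :=
  mul_left_cancel₀ (X_sub_X_ne_zero h) ((divDiff_spec a b h f).trans e.symm)

theorem divDiff_eq_zero_iff (h : a ≠ b) {f : MvPolynomial τ ℤ} :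
    divDiff a b h f = 0 ↔ MvPolynomial.rename (Equiv.swap a b) f = f := by
  constructor
  · intro e
    have := divDiff_spec a b h f
    rw [e, mul_zero] at this
    exact (sub_eq_zero.1 this.symm).symm
  · intro e
    exact divDiff_eq h (by rw [e]; ring)

theorem permOp_mul_divDiff (σ : Equiv.Perm τ) (h : a ≠ b) (h' : σ a ≠ σ b) :
    permOp σ * divDiff a b h = divDiff (σ a) (σ b) h' * permOp σ := by
  refine LinearMap.ext fun f => (divDiff_eq h' ?_).symm
  have := congrArg (MvPolynomial.rename σ) (divDiff_spec a b h f)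
  simp only [map_mul, map_sub, MvPolynomial.rename_X] at this
  rw [Module.End.mul_apply, permOp_apply, permOp_apply, this, ← rename_mul_apply,
    ← rename_mul_apply, Equiv.mul_swap_eq_swap_mul]

theorem swap_mul_divDiff (h : a ≠ b) :
    permOp (Equiv.swap a b) * divDiff a b h = divDiff a b h := by
  refine LinearMap.ext fun f => (divDiff_eq h ?_).symm
  have := congrArg (MvPolynomial.rename (Equiv.swap a b)) (divDiff_spec a b h f)
  simp only [map_mul, map_sub, MvPolynomial.rename_X, Equiv.swap_apply_left,
    Equiv.swap_apply_right, ← rename_mul_apply, Equiv.swap_mul_self] at this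
  rw [Module.End.mul_apply, permOp_apply]
  simp only [Equiv.Perm.coe_one, MvPolynomial.rename_id_apply] at this
  linear_combination -this

theorem divDiff_mul_swap (h : a ≠ b) :
    divDiff a b h * permOp (Equiv.swap a b) = -divDiff a b h := by
  refine LinearMap.ext fun f => divDiff_eq h ?_
  rw [LinearMap.neg_apply, mul_neg, divDiff_spec, permOp_apply, ← rename_mul_apply,
    Equiv.swap_mul_self, Equiv.Perm.coe_one, MvPolynomial.rename_id_apply]
  ring

theorem divDiff_mul_self (h : a ≠ b) : divDiff a b h * divDiff a b h = 0 := by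
  refine LinearMap.ext fun f => (divDiff_eq_zero_iff h).2 ?_
  exact congrArg (fun T => T f) (swap_mul_divDiff h)

theorem divDiff_mulLeft (h : a ≠ b) (p f : MvPolynomial τ ℤ)
    (hp : MvPolynomial.rename (Equiv.swap a b) p = p) :
    divDiff a b h (p * f) = p * divDiff a b h f := by
  refine divDiff_eq h ?_
  rw [mul_left_comm, divDiff_spec, map_mul, hp]
  ring

theorem divDiff_comm (hab : a ≠ b) (hcd : c ≠ d) (hac : a ≠ c) (had : a ≠ d) (hbc : b ≠ c)
    (hbd : b ≠ d) : divDiff a b hab * divDiff c d hcd = divDiff c d hcd * divDiff a b hab := by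
  -- The identity is checked after clearing both denominators, where only commuting transpositions
  -- remain.
  refine LinearMap.ext fun f => divDiff_eq hab (mul_left_cancel₀ (X_sub_X_ne_zero hcd) ?_)
  have h1 := divDiff_spec c d hcd f
  have h2 := divDiff_spec c d hcd (divDiff a b hab f)
  have h3 := divDiff_spec a b hab f
  have h4 := congrArg (MvPolynomial.rename (Equiv.swap a b)) h1
  have h5 := congrArg (MvPolynomial.rename (Equiv.swap c d)) h3
  have hsc : Equiv.swap a b * Equiv.swap c d = Equiv.swap c d * Equiv.swap a b :=
    (Equiv.Perm.disjoint_swap_swap (by simp [*])).commute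
  simp only [map_mul, map_sub, MvPolynomial.rename_X,
    Equiv.swap_apply_of_ne_of_ne hac.symm hbc.symm,
    Equiv.swap_apply_of_ne_of_ne had.symm hbd.symm, ← rename_mul_apply] at h4
  simp only [map_mul, map_sub, MvPolynomial.rename_X, Equiv.swap_apply_of_ne_of_ne hac had,
    Equiv.swap_apply_of_ne_of_ne hbc hbd, ← rename_mul_apply, ← hsc] at h5
  simp only [Module.End.mul_apply]
  rw [mul_sub]
  linear_combination (MvPolynomial.X a - MvPolynomial.X b) * h2 + h3 - h1 + h4 - h5

end Operators

/-! ### Braid and mixed relations in three variables -/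

section Operators

variable {τ : Type} [DecidableEq τ] {a b c : τ}

theorem swap_braid (hab : a ≠ b) (hac : a ≠ c) (hbc : b ≠ c) :
    Equiv.swap a b * Equiv.swap b c * Equiv.swap a b =
      Equiv.swap b c * Equiv.swap a b * Equiv.swap b c := by
  rw [Equiv.swap_mul_swap_mul_swap hab hac, Equiv.swap_comm a b, Equiv.swap_comm b c,
    Equiv.swap_mul_swap_mul_swap hbc.symm hac.symm, Equiv.swap_comm]

theorem swap_swap_divDiff (hab : a ≠ b) (hac : a ≠ c) (hbc : b ≠ c) :
    permOp (Equiv.swap a b) * permOp (Equiv.swap b c) * divDiff a b hab =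
      divDiff b c hbc * permOp (Equiv.swap a b) * permOp (Equiv.swap b c) := by
  have e1 : Equiv.swap b c a = a := Equiv.swap_apply_of_ne_of_ne hab hac
  have e2 : Equiv.swap a b c = c := Equiv.swap_apply_of_ne_of_ne hac.symm hbc.symm
  rw [← permOp_mul, permOp_mul_divDiff _ _ (by simpa [e1, e2] using hbc), permOp_mul]
  simp only [Equiv.Perm.mul_apply, e1, e2, Equiv.swap_apply_left, mul_assoc]

theorem divDiff_symm (h : a ≠ b) : divDiff b a h.symm = -divDiff a b h := by
  refine LinearMap.ext fun f => divDiff_eq h.symm ?_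
  rw [LinearMap.neg_apply, Equiv.swap_comm, ← divDiff_spec a b h]
  ring

/-- Clearing denominators by the Vandermonde product leaves the alternating sum over the symmetric
group on three letters. It no longer distinguishes the two reduced words of the longest element,
which is the braid relation. -/
theorem clear_divDiff_braid (hab : a ≠ b) (hac : a ≠ c) (hbc : b ≠ c) (f : MvPolynomial τ ℤ) :
    (MvPolynomial.X a - MvPolynomial.X b) * (MvPolynomial.X a - MvPolynomial.X c) *
      (MvPolynomial.X b - MvPolynomial.X c) *
      divDiff a b hab (divDiff b c hbc (divDiff a b hab f)) =
      f - permOp (Equiv.swap a b) f - permOp (Equiv.swap b c) f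
      + permOp (Equiv.swap a b * Equiv.swap b c) f + permOp (Equiv.swap b c * Equiv.swap a b) f
      - permOp (Equiv.swap a b * Equiv.swap b c * Equiv.swap a b) f := by
  have e1 := divDiff_spec a b hab f
  have e2 := divDiff_spec b c hbc (divDiff a b hab f)
  have e3 := divDiff_spec a b hab (divDiff b c hbc (divDiff a b hab f))
  have t1 := congrArg (MvPolynomial.rename (Equiv.swap b c)) e1
  have t2 := congrArg (MvPolynomial.rename (Equiv.swap a b)) t1
  have u := congrArg (MvPolynomial.rename (Equiv.swap a b)) e2
  have sp : MvPolynomial.rename (Equiv.swap a b) (divDiff a b hab f) = divDiff a b hab f :=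
    congrArg (fun T => T f) (swap_mul_divDiff hab)
  simp only [map_mul, map_sub, MvPolynomial.rename_X, Equiv.swap_apply_left,
    Equiv.swap_apply_right, Equiv.swap_apply_of_ne_of_ne hab hac,
    Equiv.swap_apply_of_ne_of_ne hac.symm hbc.symm, sp] at t1 t2 u
  simp only [permOp_apply, rename_mul_apply]
  linear_combination (MvPolynomial.X a - MvPolynomial.X c) *
    (MvPolynomial.X b - MvPolynomial.X c) * e3 + (MvPolynomial.X a - MvPolynomial.X c) * e2
    - (MvPolynomial.X b - MvPolynomial.X c) * u + e1 - t1 + t2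

theorem divDiff_braid (hab : a ≠ b) (hac : a ≠ c) (hbc : b ≠ c) :
    divDiff a b hab * divDiff b c hbc * divDiff a b hab =
      divDiff b c hbc * divDiff a b hab * divDiff b c hbc := by
  refine LinearMap.ext fun f => ?_
  have h1 := clear_divDiff_braid hab hac hbc f
  -- The same formula with `a` and `c` exchanged: three signs from the operators and three from the
  -- Vandermonde product cancel.
  have h2 := clear_divDiff_braid hbc.symm hac.symm hab.symm f
  rw [divDiff_symm hbc, divDiff_symm hab] at h2
  simp only [LinearMap.neg_apply, map_neg, Equiv.swap_comm c b, Equiv.swap_comm b a] at h2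
  rw [← swap_braid hab hac hbc] at h2
  refine mul_left_cancel₀ (mul_ne_zero (mul_ne_zero (X_sub_X_ne_zero hab) (X_sub_X_ne_zero hac))
    (X_sub_X_ne_zero hbc)) (h1.trans ?_)
  simp only [Module.End.mul_apply]
  linear_combination -h2

end Operators

/-! ### Noncommutative identities for the recursion of the edge maps -/

section Ring

variable {A : Type*} [Ring A] {s d s' d' E : A}

/-- The inductive step of `edgeMap_relation` as a formal identity: `s`, `d` act at one position,
`s'`, `d'` at the next one, and `E` is the edge map two positions further on, which commutes with
`s` and `d`. The `true` version serves the other value of the entry read by the recursion. -/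
theorem edge_relation_false (hs : s * E = E * s)
    (hd : d * E = E * d) (h1 : s' * s * d' = d * s' * s) (h2 : s * s' * d = d' * s * s')
    (hbr : d * d' * d = d' * d * d') (ih : d' * E * s' * E + E * s' * E * d' = 0) :
    d * (d' * E * s') * s * (d' * E * s') + (d' * E * s') * s * (d' * E * s') * d = 0 := by
  linear_combination (norm := noncomm_ring) d * d' * E * h1 * E * s' - d * d' * hd * s' * s * E * s'
    + d * d' * d * E * s' * hs * s' + d' * E * h1 * E * s' * d - d' * hd * s' * s * E * s' * d
    + d' * d * E * s' * hs * s' * d + d' * d * E * s' * E * h2 + d' * d * ih * s * s'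
    + hbr * E * s' * E * s * s'

theorem edge_relation_true (hs : s * E = E * s)
    (hd : d * E = E * d) (h1 : s' * s * d' = d * s' * s) (h2 : s * s' * d = d' * s * s')
    (hbr : d * d' * d = d' * d * d') (ih : d' * E * s' * E + E * s' * E * d' = 0) :
    d * (s' * E * d') * s * (s' * E * d') + (s' * E * d') * s * (s' * E * d') * d = 0 := by
  linear_combination (norm := noncomm_ring) -(d * s' * E * h2 * E * d')
    - d * s' * hs * s' * d * E * d' + d * s' * s * E * s' * hd * d' - h1 * E * s' * E * d * d'
    - s' * E * h2 * E * d' * d - s' * hs * s' * d * E * d' * d + s' * s * E * s' * hd * d' * d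
    + s' * s * E * s' * E * hbr + s' * s * ih * d * d'

end Ring


/-! ## The operators acting on the indeterminates `X` -/

section Adjacent

variable {N k r : ℕ}

theorem xI_injective : Function.Injective (xI N k : Fin r → Idx N k r) :=
  fun _ _ e => Sum.inl_injective (Sum.inl_injective e)

variable (N k r)

/-- The operator exchanging the variables `x_l` and `x_{l+1}` (the identity if there is no `x_{l+1}`). -/
noncomputable def sOp (l : ℕ) : Module.End (HBU N k r) (Poly N k r) :=
  if h : l + 1 < r then
    permOp (Equiv.swap (xI N k ⟨l, (Nat.lt_succ_self l).trans h⟩) (xI N k ⟨l + 1, h⟩)) else 1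

/-- The divided difference operator of the variables `x_l` and `x_{l+1}` (zero if there is no
`x_{l+1}`). -/
noncomputable def dOp (l : ℕ) : Module.End (HBU N k r) (Poly N k r) :=
  if h : l + 1 < r then
    divDiff (xI N k ⟨l, (Nat.lt_succ_self l).trans h⟩) (xI N k ⟨l + 1, h⟩)
      (xI_ne_succ N k ⟨l, (Nat.lt_succ_self l).trans h⟩ h) else 0

variable {N k r}

theorem sOp_mul_self (l : ℕ) : sOp N k r l * sOp N k r l = 1 := by
  unfold sOp
  split_ifs with h
  · rw [← permOp_mul, Equiv.swap_mul_self, permOp_one]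
  · simp

theorem sOp_mul_dOp (l : ℕ) : sOp N k r l * dOp N k r l = dOp N k r l := by
  unfold sOp dOp
  split_ifs with h
  · exact swap_mul_divDiff _
  · simp

theorem dOp_mul_sOp (l : ℕ) : dOp N k r l * sOp N k r l = -dOp N k r l := by
  unfold sOp dOp
  split_ifs with h
  · exact divDiff_mul_swap _
  · simp

theorem dOp_mul_self (l : ℕ) : dOp N k r l * dOp N k r l = 0 := by
  unfold dOp
  split_ifs with h
  · exact divDiff_mul_self _
  · simp

theorem xI_ne {a b : Fin r} (h : (a : ℕ) ≠ b) : xI N k a ≠ xI N k b :=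
  fun e => h (congrArg Fin.val (xI_injective e))

theorem permOp_comm_dOp {σ : Equiv.Perm (Idx N k r)} {l : ℕ}
    (hσ : ∀ i : Fin r, (i : ℕ) = l ∨ (i : ℕ) = l + 1 → σ (xI N k i) = xI N k i) :
    permOp σ * dOp N k r l = dOp N k r l * permOp σ := by
  unfold dOp
  split_ifs with h
  · have h1 := hσ ⟨l, (Nat.lt_succ_self l).trans h⟩ (Or.inl rfl)
    have h2 := hσ ⟨l + 1, h⟩ (Or.inr rfl)
    rw [permOp_mul_divDiff _ _ (by rw [h1, h2]; exact xI_ne (by simp))]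
    simp only [h1, h2]
  · simp

theorem permOp_comm_sOp {σ : Equiv.Perm (Idx N k r)} {l : ℕ}
    (hσ : ∀ i : Fin r, (i : ℕ) = l ∨ (i : ℕ) = l + 1 → σ (xI N k i) = xI N k i) :
    permOp σ * sOp N k r l = sOp N k r l * permOp σ := by
  unfold sOp
  split_ifs with h
  · rw [← permOp_mul, ← permOp_mul, Equiv.mul_swap_eq_swap_mul,
      hσ ⟨l, (Nat.lt_succ_self l).trans h⟩ (Or.inl rfl), hσ ⟨l + 1, h⟩ (Or.inr rfl)]
  · simp

theorem swap_xI_apply {a b c : Fin r} (h1 : (a : ℕ) ≠ c) (h2 : (b : ℕ) ≠ c) :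
    Equiv.swap (xI N k a) (xI N k b) (xI N k c) = xI N k c :=
  Equiv.swap_apply_of_ne_of_ne (xI_ne h1.symm) (xI_ne h2.symm)

theorem sOp_comm_dOp {l m : ℕ} (h : l + 1 < m ∨ m + 1 < l) :
    sOp N k r l * dOp N k r m = dOp N k r m * sOp N k r l := by
  unfold sOp
  split_ifs with h1
  · exact permOp_comm_dOp fun i hi => swap_xI_apply (by simp; omega) (by simp; omega)
  · simp

theorem sOp_comm_sOp {l m : ℕ} (h : l + 1 < m ∨ m + 1 < l) :
    sOp N k r l * sOp N k r m = sOp N k r m * sOp N k r l := by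
  by_cases h1 : l + 1 < r
  · rw [show sOp N k r l = _ from dif_pos h1]
    exact permOp_comm_sOp fun i hi => swap_xI_apply (by simp; omega) (by simp; omega)
  · rw [show sOp N k r l = 1 from dif_neg h1, one_mul, mul_one]

theorem dOp_comm_dOp {l m : ℕ} (h : l + 1 < m ∨ m + 1 < l) :
    dOp N k r l * dOp N k r m = dOp N k r m * dOp N k r l := by
  unfold dOp
  split_ifs with h1 h2
  · exact divDiff_comm _ _ (xI_ne (by simp; omega)) (xI_ne (by simp; omega))
      (xI_ne (by simp; omega)) (xI_ne (by simp; omega))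
  all_goals simp

variable {l : ℕ}

theorem dOp_braid (l : ℕ) :
    dOp N k r l * dOp N k r (l + 1) * dOp N k r l =
      dOp N k r (l + 1) * dOp N k r l * dOp N k r (l + 1) := by
  by_cases h : l + 2 < r
  · have h1 : l + 1 < r := by omega
    simp only [dOp, dif_pos h, dif_pos h1, add_assoc, Nat.reduceAdd]
    exact divDiff_braid _ (xI_ne (by simp)) _
  · simp [dOp, h, add_assoc]

theorem s_s_d_up (h : l + 2 < r) :
    sOp N k r l * sOp N k r (l + 1) * dOp N k r l =
      dOp N k r (l + 1) * sOp N k r l * sOp N k r (l + 1) := by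
  have h1 : l + 1 < r := by omega
  simp only [sOp, dOp, dif_pos h, dif_pos h1, add_assoc, Nat.reduceAdd]
  exact swap_swap_divDiff _ (xI_ne (by simp)) _

theorem s_s_d_down (h : l + 2 < r) :
    sOp N k r (l + 1) * sOp N k r l * dOp N k r (l + 1) =
      dOp N k r l * sOp N k r (l + 1) * sOp N k r l := by
  have h1 := s_s_d_up (N := N) (k := k) h
  have a := sOp_mul_self (N := N) (k := k) (r := r) l
  have b := sOp_mul_self (N := N) (k := k) (r := r) (l + 1)
  linear_combination (norm := noncomm_ring)
    -(sOp N k r (l + 1) * sOp N k r l * h1 * sOp N k r (l + 1) * sOp N k r l)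
    + sOp N k r (l + 1) * a * sOp N k r (l + 1) * dOp N k r l * sOp N k r (l + 1) * sOp N k r l
    + b * dOp N k r l * sOp N k r (l + 1) * sOp N k r l
    - sOp N k r (l + 1) * sOp N k r l * dOp N k r (l + 1) * sOp N k r l * b * sOp N k r l
    - sOp N k r (l + 1) * sOp N k r l * dOp N k r (l + 1) * a

end Adjacent

/-! ### Edge maps and anticommuting squares -/

section Edge

variable {N k r : ℕ}

/-- Mirrors the recursion defining the edge maps, which starts at the last index. -/
theorem fin_down_induction {P : Fin r → Prop} (last : ∀ i : Fin r, ¬ (i : ℕ) + 1 < r → P i)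
    (step : ∀ (i : Fin r) (h : (i : ℕ) + 1 < r), P ⟨i + 1, h⟩ → P i) (i : Fin r) : P i := by
  suffices ∀ n, ∀ i : Fin r, r - i = n → P i from this _ i rfl
  intro n
  induction n with
  | zero => intro i hi; omega
  | succ n ih =>
    intro i hi
    by_cases h : (i : ℕ) + 1 < r
    · exact step i h (ih _ (by simp; omega))
    · exact last i h

theorem edgeMap_true {w : Fin r → Bool} {i : Fin r} (h : (i : ℕ) + 1 < r)
    (hw : w ⟨i + 1, h⟩ = true) :
    edgeMap N k w i = sOp N k r i * edgeMap N k w ⟨i + 1, h⟩ * dOp N k r i := by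
  conv_lhs => rw [edgeMap]
  rw [dif_pos h, if_pos hw, sOp, dOp, dif_pos h, dif_pos h]

theorem edgeMap_false {w : Fin r → Bool} {i : Fin r} (h : (i : ℕ) + 1 < r)
    (hw : w ⟨i + 1, h⟩ = false) :
    edgeMap N k w i = dOp N k r i * edgeMap N k w ⟨i + 1, h⟩ * sOp N k r i := by
  conv_lhs => rw [edgeMap]
  rw [dif_pos h, if_neg (by simp [hw]), sOp, dOp, dif_pos h, dif_pos h]

theorem edgeMap_last {w : Fin r → Bool} {i : Fin r} (h : ¬ (i : ℕ) + 1 < r) :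
    edgeMap N k w i = LinearMap.mulLeft (HBU N k r) (Qpoly N k i) := by
  rw [edgeMap, dif_neg h]

theorem edgeMap_congr {w w' : Fin r → Bool} (i : Fin r) (h : ∀ j, i < j → w j = w' j) :
    edgeMap N k w i = edgeMap N k w' i := by
  induction i using fin_down_induction with
  | last i hi => rw [edgeMap_last hi, edgeMap_last hi]
  | step i hi ih =>
    have e := ih fun j hj => h j (lt_trans (Fin.lt_def.2 (by simp)) hj)
    have e2 := h ⟨i + 1, hi⟩ (Fin.lt_def.2 (by simp))
    cases hw : w ⟨i + 1, hi⟩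
    · rw [edgeMap_false hi hw, edgeMap_false hi (e2 ▸ hw), e]
    · rw [edgeMap_true hi hw, edgeMap_true hi (e2 ▸ hw), e]

/-- An operator commuting with the building blocks of an edge map commutes with the edge map. -/
theorem comm_edgeMap {O : Module.End (HBU N k r) (Poly N k r)} (w : Fin r → Bool) (i : Fin r)
    (hs : ∀ l, (i : ℕ) ≤ l → O * sOp N k r l = sOp N k r l * O)
    (hd : ∀ l, (i : ℕ) ≤ l → O * dOp N k r l = dOp N k r l * O)
    (hQ : ∀ j : Fin r, (j : ℕ) + 1 = r → O * LinearMap.mulLeft (HBU N k r) (Qpoly N k j) =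
      LinearMap.mulLeft (HBU N k r) (Qpoly N k j) * O) :
    O * edgeMap N k w i = edgeMap N k w i * O := by
  induction i using fin_down_induction with
  | last i hi => rw [edgeMap_last hi]; exact hQ i (by omega)
  | step i hi ih =>
    have e := ih (fun l hl => hs l (by simp at hl; omega)) (fun l hl => hd l (by simp at hl; omega))
    have e1 := hs i le_rfl
    have e2 := hd i le_rfl
    cases hw : w ⟨i + 1, hi⟩
    · rw [edgeMap_false hi hw, ← mul_assoc, ← mul_assoc, e2, mul_assoc _ O, e, ← mul_assoc,
        mul_assoc _ O, e1, ← mul_assoc]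
    · rw [edgeMap_true hi hw, ← mul_assoc, ← mul_assoc, e1, mul_assoc _ O, e, ← mul_assoc,
        mul_assoc _ O, e2, ← mul_assoc]

theorem rename_Qpoly (σ : Equiv.Perm (Idx N k r)) (i : Fin r) (η : Equiv.Perm (Fin r))
    (hx : σ (xI N k i) = xI N k i) (hy : ∀ a, σ (yI N k a) = yI N k (η a)) :
    MvPolynomial.rename σ (Qpoly N k i) = Qpoly N k i := by
  have h : ∀ j, MvPolynomial.rename σ (esymmY N k r j) = esymmY N k r j := fun j => by
    have : (σ : Idx N k r → Idx N k r) ∘ yI N k = yI N k ∘ η := funext hy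
    rw [esymmY, MvPolynomial.rename_rename, this, ← MvPolynomial.rename_rename,
      (MvPolynomial.esymm_isSymmetric (Fin r) ℤ j) η]
  simp [Qpoly, h, hx]

theorem permOp_comm_mulLeft {σ : Equiv.Perm (Idx N k r)} {p : Poly N k r}
    (hp : MvPolynomial.rename σ p = p) :
    permOp σ * LinearMap.mulLeft (HBU N k r) p = LinearMap.mulLeft (HBU N k r) p * permOp σ :=
  LinearMap.ext fun f => by
    simp only [Module.End.mul_apply, permOp_apply, LinearMap.mulLeft_apply, map_mul, hp]

/-- Permutations of the variables `Y` and of variables not entering the edge map commute with it. -/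
theorem permOp_comm_edgeMap (σ : Equiv.Perm (Idx N k r)) (η : Equiv.Perm (Fin r))
    (w : Fin r → Bool) (i : Fin r) (hx : ∀ j, i ≤ j → σ (xI N k j) = xI N k j)
    (hy : ∀ a, σ (yI N k a) = yI N k (η a)) :
    permOp σ * edgeMap N k w i = edgeMap N k w i * permOp σ :=
  comm_edgeMap w i
    (fun l hl => permOp_comm_sOp fun j hj => hx j (Fin.le_def.2 (by omega)))
    (fun l hl => permOp_comm_dOp fun j hj => hx j (Fin.le_def.2 (by omega)))
    (fun j hj => permOp_comm_mulLeft (rename_Qpoly σ j η (hx j (Fin.le_def.2 (by omega))) hy))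

theorem swap_xI_yI (a b c : Fin r) :
    Equiv.swap (xI N k a) (xI N k b) (yI N k c) = yI N k ((1 : Equiv.Perm (Fin r)) c) :=
  Equiv.swap_apply_of_ne_of_ne (by simp [xI, yI]) (by simp [xI, yI])

/-- The edge map at `i` involves no variable of X before the `i`-th, so an exchange of two earlier
variables passes through. -/
theorem sOp_comm_edgeMap {l : ℕ} (w : Fin r → Bool) (i : Fin r) (h : l + 1 < i) :
    sOp N k r l * edgeMap N k w i = edgeMap N k w i * sOp N k r l := by
  unfold sOp
  split_ifs with hl
  · refine permOp_comm_edgeMap _ 1 w i (fun j hj => swap_xI_apply ?_ ?_) (swap_xI_yI _ _)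
    · have := Fin.le_def.1 hj; simp; omega
    · have := Fin.le_def.1 hj; simp; omega
  · simp

theorem dOp_mulLeft {l : ℕ} {p : Poly N k r} (hp : sOp N k r l p = p) (f : Poly N k r) :
    dOp N k r l (p * f) = p * dOp N k r l f := by
  unfold sOp dOp at *
  split_ifs with h
  · rw [dif_pos h] at hp
    exact divDiff_mulLeft _ p f hp
  · simp

theorem dOp_comm_edgeMap {l : ℕ} (w : Fin r → Bool) (i : Fin r) (h : l + 1 < i) :
    dOp N k r l * edgeMap N k w i = edgeMap N k w i * dOp N k r l := by
  refine comm_edgeMap w i (fun m hm => (sOp_comm_dOp (by omega)).symm)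
    (fun m hm => dOp_comm_dOp (by omega)) fun j hj => LinearMap.ext fun f => dOp_mulLeft ?_ f
  unfold sOp
  rw [dif_pos (by omega)]
  exact rename_Qpoly _ j 1 (swap_xI_apply (by simp; omega) (by simp; omega)) (swap_xI_yI _ _)

/-- The fundamental relation between consecutive edge maps. -/
theorem edgeMap_relation (w : Fin r → Bool) (j : Fin r) : ∀ l : ℕ, l + 1 = j →
    dOp N k r l * edgeMap N k w j * sOp N k r l * edgeMap N k w j +
      edgeMap N k w j * sOp N k r l * edgeMap N k w j * dOp N k r l = 0 := by
  induction j using fin_down_induction with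
  | last j hj =>
    intro l hl
    have hlr : l + 1 < r := by omega
    rw [edgeMap_last hj]
    set Q := Qpoly N k j
    refine LinearMap.ext fun f => ?_
    simp only [LinearMap.add_apply, Module.End.mul_apply, LinearMap.mulLeft_apply,
      LinearMap.zero_apply]
    have hsm : ∀ f g, sOp N k r l (f * g) = sOp N k r l f * sOp N k r l g := fun f g => by
      unfold sOp
      rw [dif_pos hlr]
      simp only [permOp_apply, map_mul]
    have hss : ∀ f, sOp N k r l (sOp N k r l f) = f := fun f =>
      congrArg (fun T => T f) (sOp_mul_self l)
    have hsd : ∀ f, sOp N k r l (dOp N k r l f) = dOp N k r l f := fun f =>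
      congrArg (fun T => T f) (sOp_mul_dOp l)
    have hds : ∀ f, dOp N k r l (sOp N k r l f) = -dOp N k r l f := fun f =>
      congrArg (fun T => T f) (dOp_mul_sOp l)
    -- The product of `Q` with its swap is symmetric, so it leaves the divided difference. The two
    -- terms then cancel because ∂s = -∂ and s∂ = ∂.
    rw [hsm Q f, hsm Q (dOp N k r l f), ← mul_assoc, dOp_mulLeft (by rw [hsm, hss, mul_comm]), hds, hsd]
    ring
  | step j hj ih =>
    intro l hl
    have ih' := ih j rfl
    have hr : l + 2 < r := by omega
    have h1 : sOp N k r j * sOp N k r l * dOp N k r j = dOp N k r l * sOp N k r j * sOp N k r l := by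
      rw [← hl]; exact s_s_d_down hr
    have h2 : sOp N k r l * sOp N k r j * dOp N k r l = dOp N k r j * sOp N k r l * sOp N k r j := by
      rw [← hl]; exact s_s_d_up hr
    have hbr : dOp N k r l * dOp N k r j * dOp N k r l =
        dOp N k r j * dOp N k r l * dOp N k r j := by
      rw [← hl]; exact dOp_braid l
    have hs := sOp_comm_edgeMap (N := N) (k := k) (l := l) w ⟨j + 1, hj⟩ (by simp; omega)
    have hd := dOp_comm_edgeMap (N := N) (k := k) (l := l) w ⟨j + 1, hj⟩ (by simp; omega)
    cases hw : w ⟨j + 1, hj⟩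
    · rw [edgeMap_false hj hw]
      exact edge_relation_false hs hd h1 h2 hbr ih'
    · rw [edgeMap_true hj hw]
      exact edge_relation_true hs hd h1 h2 hbr ih'

/-- One square face of the cube. Induction on the distance of the directions: adjacent ones are
`edgeMap_relation`, and otherwise the outer factors at `i` commute with the edge map at `j`. -/
theorem edgeMap_anticomm (w : Fin r → Bool) (j i : Fin r) (hij : i < j) :
    edgeMap N k (Function.update w j false) i * edgeMap N k w j +
      edgeMap N k w j * edgeMap N k (Function.update w j true) i = 0 := by
  suffices ∀ n, ∀ i : Fin r, (i : ℕ) + 1 + n = j →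
      edgeMap N k (Function.update w j false) i * edgeMap N k w j +
      edgeMap N k w j * edgeMap N k (Function.update w j true) i = 0 from
    this (j - i - 1) i (by have := Fin.lt_def.1 hij; omega)
  intro n
  induction n with
  | zero =>
    intro i hi
    have hi1 : (i : ℕ) + 1 < r := by omega
    have e : (⟨i + 1, hi1⟩ : Fin r) = j := Fin.ext hi
    rw [edgeMap_false hi1 (by rw [e]; simp), edgeMap_true hi1 (by rw [e]; simp), e,
      edgeMap_congr (w := Function.update w j false) (w' := w) j
        (fun l hl => by simp [hl.ne']), edgeMap_congr (w := Function.update w j true) (w' := w) j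
        (fun l hl => by simp [hl.ne'])]
    have := edgeMap_relation (N := N) (k := k) w j i hi
    linear_combination (norm := noncomm_ring) this
  | succ n ih =>
    intro i hi
    have hi1 : (i : ℕ) + 1 < r := by omega
    have e := ih ⟨i + 1, hi1⟩ (by simp; omega)
    have hne : (⟨i + 1, hi1⟩ : Fin r) ≠ j := fun h => by
      have := congrArg Fin.val h; simp at this; omega
    have hs := sOp_comm_edgeMap (N := N) (k := k) (l := i) w j (by omega)
    have hd := dOp_comm_edgeMap (N := N) (k := k) (l := i) w j (by omega)
    cases hw : w ⟨i + 1, hi1⟩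
    · rw [edgeMap_false hi1 (by simpa [hne] using hw), edgeMap_false hi1 (by simpa [hne] using hw)]
      linear_combination (norm := noncomm_ring) dOp N k r i * e * sOp N k r i +
        dOp N k r i * edgeMap N k (Function.update w j false) ⟨i + 1, hi1⟩ * hs -
        hd * edgeMap N k (Function.update w j true) ⟨i + 1, hi1⟩ * sOp N k r i
    · rw [edgeMap_true hi1 (by simpa [hne] using hw), edgeMap_true hi1 (by simpa [hne] using hw)]
      linear_combination (norm := noncomm_ring) sOp N k r i * e * dOp N k r i +
        sOp N k r i * edgeMap N k (Function.update w j false) ⟨i + 1, hi1⟩ * hd -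
        hs * edgeMap N k (Function.update w j true) ⟨i + 1, hi1⟩ * dOp N k r i

end Edge


/-! ### The differential squares to zero -/

section Differential

variable {N k r : ℕ}

theorem differential_apply (c : Cube N k r) (w : Fin r → Bool) :
    differential N k r c w =
      ∑ i, if w i then 0 else edgeMap N k w i (c (Function.update w i true)) := by
  rw [differential, LinearMap.pi_apply, LinearMap.sum_apply, Finset.sum_filter]
  refine Finset.sum_congr rfl fun i _ => ?_
  cases w i <;> simp

theorem differential_differential (c : Cube N k r) :
    differential N k r (differential N k r c) = 0 := by
  funext w
  -- The contribution of the path that lowers direction `j` first and then `i`. The array is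
  -- antisymmetric, so its total is its own negative, which forces it to vanish over ℤ.
  let t : Fin r → Fin r → Poly N k r := fun i j =>
    if w i then 0 else if Function.update w i true j then 0 else
      edgeMap N k w i (edgeMap N k (Function.update w i true) j
        (c (Function.update (Function.update w i true) j true)))
  have key : ∀ i j, i < j → t i j + t j i = 0 := by
    intro i j hij
    simp only [t]
    rw [Function.update_of_ne hij.ne', Function.update_of_ne hij.ne,
      Function.update_comm hij.ne]
    cases hi : w i
    · cases hj : w j
      · have h := congrArg (fun T => T (c (Function.update (Function.update w j true) i true)))
          (edgeMap_anticomm (N := N) (k := k) w j i hij)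
        rw [← hj, Function.update_eq_self] at h
        rw [edgeMap_congr (w := Function.update w i true) (w' := w) j fun l hl => by
          rw [Function.update_of_ne (hij.trans hl).ne']]
        simpa using h
      · simp
    · simp
  have h0 : ∀ i, t i i = 0 := fun i => by simp [t]
  have anti : ∀ i j, t i j = -t j i := fun i j => by
    rcases lt_trichotomy i j with h | h | h
    · exact eq_neg_of_add_eq_zero_left (key i j h)
    · subst h; simp [h0]
    · exact eq_neg_of_add_eq_zero_right (key j i h)
  have e : differential N k r (differential N k r c) w = ∑ i, ∑ j, t i j := by
    rw [differential_apply]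
    refine Finset.sum_congr rfl fun i _ => ?_
    simp only [t]
    cases w i
    · simp only [Bool.false_eq_true, if_false]
      rw [differential_apply, map_sum]
      refine Finset.sum_congr rfl fun j _ => ?_
      rw [apply_ite (edgeMap N k w i), map_zero]
    · simp
  have e2 : ∑ i, ∑ j, t i j = -∑ i, ∑ j, t i j := by
    conv_lhs => rw [Finset.sum_comm]
    rw [← Finset.sum_neg_distrib]
    refine Finset.sum_congr rfl fun i _ => ?_
    rw [← Finset.sum_neg_distrib]
    exact Finset.sum_congr rfl fun j _ => anti j i
  rw [e, Pi.zero_apply]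
  exact self_eq_neg.1 e2

end Differential

/-! ## Divided differences acting on the cube -/

section TOp

variable {N k r : ℕ}

variable (N k r) in
/-- The divided difference operators on the cube, which commute with the differential: the operator
acts by the divided difference on the vertices with `v_l = v_{l+1}`, takes the vertices with
`(v_l, v_{l+1}) = (0, 1)` to those with `(1, 0)` by exchanging the variables, and kills the latter. -/
noncomputable def tOp (l : ℕ) : Cube N k r →ₗ[HBU N k r] Cube N k r :=
  LinearMap.pi fun w =>
    if h : l + 1 < r then
      if w ⟨l, (Nat.lt_succ_self l).trans h⟩ = w ⟨l + 1, h⟩ then dOp N k r l ∘ₗ LinearMap.proj w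
      else if w ⟨l, (Nat.lt_succ_self l).trans h⟩ then
        sOp N k r l ∘ₗ LinearMap.proj
          (w ∘ Equiv.swap ⟨l, (Nat.lt_succ_self l).trans h⟩ ⟨l + 1, h⟩)
      else 0
    else 0

variable {l : ℕ} {a b : Fin r} {w : Fin r → Bool}

theorem tOp_same (ha : (a : ℕ) = l) (hb : (b : ℕ) = l + 1) (h : w a = w b) (c : Cube N k r) :
    tOp N k r l c w = dOp N k r l (c w) := by
  subst ha
  obtain ⟨b, hbr⟩ := b
  obtain rfl : b = a + 1 := hb
  rw [tOp, LinearMap.pi_apply, dif_pos hbr, if_pos h]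
  rfl

theorem tOp_swap (ha : (a : ℕ) = l) (hb : (b : ℕ) = l + 1) (h1 : w a = true) (h2 : w b = false)
    (c : Cube N k r) : tOp N k r l c w = sOp N k r l (c (w ∘ Equiv.swap a b)) := by
  subst ha
  obtain ⟨b, hbr⟩ := b
  obtain rfl : b = a + 1 := hb
  rw [tOp, LinearMap.pi_apply, dif_pos hbr, if_neg (by simp [h1, h2]), if_pos h1]
  rfl

theorem tOp_zero (ha : (a : ℕ) = l) (hb : (b : ℕ) = l + 1) (h1 : w a = false) (h2 : w b = true)
    (c : Cube N k r) : tOp N k r l c w = 0 := by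
  subst ha
  obtain ⟨b, hbr⟩ := b
  obtain rfl : b = a + 1 := hb
  rw [tOp, LinearMap.pi_apply, dif_pos hbr, if_neg (by simp [h1, h2]), if_neg (by simp [h1])]
  rfl

theorem edgeMap_cons_true (ha : (a : ℕ) = l) (hb : (b : ℕ) = l + 1) (h : w b = true) :
    edgeMap N k w a = sOp N k r l * edgeMap N k w b * dOp N k r l := by
  subst ha
  obtain ⟨b, hbr⟩ := b
  obtain rfl : b = a + 1 := hb
  exact edgeMap_true _ h

theorem edgeMap_cons_false (ha : (a : ℕ) = l) (hb : (b : ℕ) = l + 1) (h : w b = false) :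
    edgeMap N k w a = dOp N k r l * edgeMap N k w b * sOp N k r l := by
  subst ha
  obtain ⟨b, hbr⟩ := b
  obtain rfl : b = a + 1 := hb
  exact edgeMap_false _ h

theorem s_d_s (h : l + 2 < r) :
    sOp N k r (l + 1) * dOp N k r l * sOp N k r (l + 1) =
      sOp N k r l * dOp N k r (l + 1) * sOp N k r l := by
  have h1 := s_s_d_up (N := N) (k := k) h
  have a := sOp_mul_self (N := N) (k := k) (r := r) l
  have b := sOp_mul_self (N := N) (k := k) (r := r) (l + 1)
  linear_combination (norm := noncomm_ring) sOp N k r l * h1 * sOp N k r (l + 1)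
    - a * sOp N k r (l + 1) * dOp N k r l * sOp N k r (l + 1)
    + sOp N k r l * dOp N k r (l + 1) * sOp N k r l * b

/-- The edge starts just before the pair `a`, `b`, so its two outermost layers interact with the
operator. The braid and mixed relations carry the operator to the other side, turning ∂_a into ∂_j
in the middle, where it commutes with the inner edge map. -/
theorem edgeMap_pred_dOp {w : Fin r → Bool} {j a b : Fin r} (hj : (j : ℕ) + 1 = a)
    (hb : (b : ℕ) = a + 1) (h : w a = w b) :
    dOp N k r a * edgeMap N k w j = edgeMap N k w j * dOp N k r a := by
  have hr : (j : ℕ) + 2 < r := by omega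
  have h1 := s_s_d_down (N := N) (k := k) hr
  have h2 := s_s_d_up (N := N) (k := k) hr
  have hbr := dOp_braid (N := N) (k := k) (r := r) j
  have hd := dOp_comm_edgeMap (N := N) (k := k) (l := j) w b (by omega)
  rw [hj] at h1 h2 hbr
  cases hw : w a
  · rw [edgeMap_cons_false rfl hj.symm hw, edgeMap_cons_false rfl hb (h ▸ hw)]
    linear_combination (norm := noncomm_ring)
      -(dOp N k r j * dOp N k r a * edgeMap N k w b * h1)
      + dOp N k r j * dOp N k r a * hd * sOp N k r a * sOp N k r j
      - hbr * edgeMap N k w b * sOp N k r a * sOp N k r j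
  · rw [edgeMap_cons_true rfl hj.symm hw, edgeMap_cons_true rfl hb (h ▸ hw)]
    linear_combination (norm := noncomm_ring)
      -(h2 * edgeMap N k w b * dOp N k r a * dOp N k r j)
      + sOp N k r j * sOp N k r a * hd * dOp N k r a * dOp N k r j
      + sOp N k r j * sOp N k r a * edgeMap N k w b * hbr

theorem edgeMap_pred_sOp {w : Fin r → Bool} {j a b : Fin r} (hj : (j : ℕ) + 1 = a)
    (hb : (b : ℕ) = a + 1) (h1 : w a = true) (h2 : w b = false) :
    sOp N k r a * edgeMap N k (w ∘ Equiv.swap a b) j = edgeMap N k w j * sOp N k r a := by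
  have hr : (j : ℕ) + 2 < r := by omega
  have h5 := s_d_s (N := N) (k := k) hr
  have hs := sOp_comm_edgeMap (N := N) (k := k) (l := j) w b (by omega)
  have ew : edgeMap N k (w ∘ Equiv.swap a b) b = edgeMap N k w b := edgeMap_congr b fun l hl => by
    have := Fin.lt_def.1 hl
    rw [Function.comp_apply, Equiv.swap_apply_of_ne_of_ne]
    · rintro rfl; omega
    · exact hl.ne'
  rw [hj] at h5
  rw [edgeMap_cons_false (w := w ∘ Equiv.swap a b) rfl hj.symm (by simpa using h2),
    edgeMap_cons_true (w := w ∘ Equiv.swap a b) rfl hb (by simpa using h1), ew,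
    edgeMap_cons_true rfl hj.symm h1, edgeMap_cons_false rfl hb h2]
  linear_combination (norm := noncomm_ring)
    h5 * edgeMap N k w b * dOp N k r a * sOp N k r j
    + sOp N k r j * dOp N k r a * hs * dOp N k r a * sOp N k r j
    - sOp N k r j * dOp N k r a * edgeMap N k w b * h5

/-- If `j` lies beyond the pair, the operators involve disjoint variables. If it lies before,
descending induction starts at the immediate predecessor and peels off layers that commute with the
operator at `a`. -/
theorem edgeMap_dOp {w : Fin r → Bool} {j a b : Fin r} (hb : (b : ℕ) = a + 1) (hja : j ≠ a)
    (hjb : j ≠ b) (h : w a = w b) :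
    dOp N k r a * edgeMap N k w j = edgeMap N k w j * dOp N k r a := by
  have hja' : (j : ℕ) ≠ a := fun e => hja (Fin.ext e)
  have hjb' : (j : ℕ) ≠ b := fun e => hjb (Fin.ext e)
  by_cases hlt : (b : ℕ) < j
  · exact dOp_comm_edgeMap w j (by omega)
  clear hja hjb
  obtain ⟨n, hn⟩ : ∃ n, (j : ℕ) + 1 + n = a := ⟨a - j - 1, by omega⟩
  clear hja' hjb' hlt
  induction n generalizing j with
  | zero => exact edgeMap_pred_dOp hn hb h
  | succ n ih =>
    have hj1 : (j : ℕ) + 1 < r := by omega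
    have e := ih (j := ⟨j + 1, hj1⟩) (by simp; omega)
    have hs := sOp_comm_dOp (N := N) (k := k) (r := r) (l := j) (m := a) (by omega)
    have hd := dOp_comm_dOp (N := N) (k := k) (r := r) (l := j) (m := a) (by omega)
    cases hw : w ⟨j + 1, hj1⟩
    · rw [edgeMap_false hj1 hw]
      linear_combination (norm := noncomm_ring)
        -(hd * edgeMap N k w ⟨j + 1, hj1⟩ * sOp N k r j) + dOp N k r j * e * sOp N k r j
        - dOp N k r j * edgeMap N k w ⟨j + 1, hj1⟩ * hs
    · rw [edgeMap_true hj1 hw]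
      linear_combination (norm := noncomm_ring)
        -(hs * edgeMap N k w ⟨j + 1, hj1⟩ * dOp N k r j) + sOp N k r j * e * dOp N k r j
        - sOp N k r j * edgeMap N k w ⟨j + 1, hj1⟩ * hd

theorem edgeMap_sOp {w : Fin r → Bool} {j a b : Fin r} (hb : (b : ℕ) = a + 1) (hja : j ≠ a)
    (hjb : j ≠ b) (h1 : w a = true) (h2 : w b = false) :
    sOp N k r a * edgeMap N k (w ∘ Equiv.swap a b) j = edgeMap N k w j * sOp N k r a := by
  have hja' : (j : ℕ) ≠ a := fun e => hja (Fin.ext e)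
  have hjb' : (j : ℕ) ≠ b := fun e => hjb (Fin.ext e)
  by_cases hlt : (b : ℕ) < j
  · rw [edgeMap_congr (w := w ∘ Equiv.swap a b) (w' := w)]
    · exact sOp_comm_edgeMap w j (by omega)
    · intro l hl
      have := Fin.lt_def.1 hl
      rw [Function.comp_apply, Equiv.swap_apply_of_ne_of_ne] <;> rintro rfl <;> omega
  clear hja hjb
  obtain ⟨n, hn⟩ : ∃ n, (j : ℕ) + 1 + n = a := ⟨a - j - 1, by omega⟩
  clear hja' hjb' hlt
  induction n generalizing j with
  | zero => exact edgeMap_pred_sOp hn hb h1 h2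
  | succ n ih =>
    have hj1 : (j : ℕ) + 1 < r := by omega
    have e := ih (j := ⟨j + 1, hj1⟩) (by simp; omega)
    have hs := sOp_comm_sOp (N := N) (k := k) (r := r) (l := j) (m := a) (by omega)
    have hd := sOp_comm_dOp (N := N) (k := k) (r := r) (l := a) (m := j) (by omega)
    have hw' : (w ∘ Equiv.swap a b) ⟨j + 1, hj1⟩ = w ⟨j + 1, hj1⟩ := by
      rw [Function.comp_apply, Equiv.swap_apply_of_ne_of_ne] <;> intro he <;>
        have := congrArg Fin.val he <;> simp at this <;> omega
    cases hw : w ⟨j + 1, hj1⟩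
    · rw [edgeMap_false hj1 hw, edgeMap_false hj1 (hw'.trans hw)]
      linear_combination (norm := noncomm_ring)
        hd * edgeMap N k (w ∘ Equiv.swap a b) ⟨j + 1, hj1⟩ * sOp N k r j
        + dOp N k r j * e * sOp N k r j
        - dOp N k r j * edgeMap N k w ⟨j + 1, hj1⟩ * hs
    · rw [edgeMap_true hj1 hw, edgeMap_true hj1 (hw'.trans hw)]
      linear_combination (norm := noncomm_ring)
        -(hs * edgeMap N k (w ∘ Equiv.swap a b) ⟨j + 1, hj1⟩ * dOp N k r j)
        + sOp N k r j * e * dOp N k r j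
        + sOp N k r j * edgeMap N k w ⟨j + 1, hj1⟩ * hd

theorem update_comp_swap (w : Fin r → Bool) (a b j : Fin r) (x : Bool) :
    Function.update (w ∘ Equiv.swap a b) j x =
      Function.update w (Equiv.swap a b j) x ∘ Equiv.swap a b := by
  rw [Function.update_comp_equiv]
  simp

theorem sOp_sOp (l : ℕ) (f : Poly N k r) : sOp N k r l (sOp N k r l f) = f :=
  congrArg (fun T => T f) (sOp_mul_self l)

theorem dOp_dOp (l : ℕ) (f : Poly N k r) : dOp N k r l (dOp N k r l f) = 0 :=
  congrArg (fun T => T f) (dOp_mul_self l)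

/-- The divided difference operators on the cube commute with the differential. -/
theorem tOp_differential (l : ℕ) (c : Cube N k r) :
    tOp N k r l (differential N k r c) = differential N k r (tOp N k r l c) := by
  by_cases hl : l + 1 < r
  swap
  · have : tOp N k r l = 0 := by
      refine LinearMap.ext fun c => funext fun w => ?_
      rw [tOp, LinearMap.pi_apply, dif_neg hl]
      rfl
    simp [this]
  obtain ⟨a, ha⟩ : ∃ a : Fin r, (a : ℕ) = l := ⟨⟨l, by omega⟩, rfl⟩
  obtain ⟨b, hb⟩ : ∃ b : Fin r, (b : ℕ) = l + 1 := ⟨⟨l + 1, hl⟩, rfl⟩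
  have hba : (b : ℕ) = a + 1 := by omega
  have hab : a ≠ b := fun e => by have := congrArg Fin.val e; omega
  funext w
  rw [differential_apply]
  rcases hwa : w a with _ | _ <;> rcases hwb : w b with _ | _
  · rw [tOp_same ha hb (hwa.trans hwb.symm), differential_apply, map_sum]
    -- Directions `a` and `b` are matched crosswise. Direction `a` on the left vanishes by ∂² = 0
    -- and meets a zero value of `tOp`; direction `b` on the left equals direction `a` on the right,
    -- where the exchange of entries occurs.
    refine Fintype.sum_equiv (Equiv.swap a b) _ _ fun j => ?_
    rcases eq_or_ne j a with rfl | hja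
    · rw [Equiv.swap_apply_left, hwa, hwb, tOp_zero ha hb (by rw [Function.update_of_ne hab, hwa])
        (by simp), edgeMap_cons_false ha hb hwb]
      simp [Module.End.mul_apply, dOp_dOp]
    rcases eq_or_ne j b with rfl | hjb
    · rw [Equiv.swap_apply_right, hwa, hwb, tOp_swap ha hb (by simp)
        (by rw [Function.update_of_ne hab.symm, hwb]),
        edgeMap_cons_false ha hb hwb]
      have : Function.update w a true ∘ Equiv.swap a j = Function.update w j true := by
        have h := update_comp_swap w a j j true
        rw [Equiv.swap_apply_right] at h
        rw [← h]
        congr 1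
        funext x
        rw [Function.comp_apply, Equiv.swap_apply_def]
        split_ifs with h1 h2
        · rw [h1, hwa, hwb]
        · rw [h2, hwa, hwb]
        · rfl
      simp [Module.End.mul_apply, sOp_sOp, this]
    · rw [Equiv.swap_apply_of_ne_of_ne hja hjb, tOp_same ha hb (by
        rw [Function.update_of_ne hja.symm, Function.update_of_ne hjb.symm, hwa, hwb])]
      have := congrArg (fun T => T (c (Function.update w j true)))
        (edgeMap_dOp (N := N) (k := k) hba hja hjb (hwa.trans hwb.symm))
      rw [ha] at this
      cases w j
      · simpa using this
      · simp
  · rw [tOp_zero ha hb hwa hwb]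
    -- Only direction `a` reaches a vertex where `tOp` may be nonzero, namely one with both entries
    -- 1; there the edge map begins with the divided difference already applied, so ∂² = 0 ends it.
    refine (Finset.sum_eq_zero fun j _ => ?_).symm
    rcases eq_or_ne j a with rfl | hja
    · rw [tOp_same ha hb (by rw [Function.update_of_ne hab.symm, hwb]; simp),
        edgeMap_cons_true ha hb hwb]
      simp [Module.End.mul_apply, dOp_dOp]
    rcases eq_or_ne j b with rfl | hjb
    · simp [hwb]
    · rw [tOp_zero ha hb (by rw [Function.update_of_ne hja.symm, hwa])
        (by rw [Function.update_of_ne hjb.symm, hwb])]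
      simp
  · rw [tOp_swap ha hb hwa hwb, differential_apply, map_sum]
    refine Fintype.sum_equiv (Equiv.swap a b) _ _ fun j => ?_
    rcases eq_or_ne j a with rfl | hja
    · rw [Equiv.swap_apply_left, Function.comp_apply, Equiv.swap_apply_left, hwb,
        tOp_same ha hb (by rw [Function.update_of_ne hab, hwa]; simp),
        edgeMap_cons_true (w := w ∘ Equiv.swap j b) ha hb (by simpa using hwa)]
      have e1 : Function.update (w ∘ Equiv.swap j b) j true = Function.update w b true := by
        funext x
        rcases eq_or_ne x j with rfl | hxa
        · rw [Function.update_self, Function.update_of_ne hab, hwa]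
        rcases eq_or_ne x b with rfl | hxb
        · rw [Function.update_of_ne hxa, Function.update_self]
          simpa using hwa
        · simp [Function.update_of_ne, hxa, hxb, Equiv.swap_apply_of_ne_of_ne]
      have e2 : edgeMap N k (w ∘ Equiv.swap j b) b = edgeMap N k w b := edgeMap_congr b
        fun x hx => by
          rw [Function.comp_apply, Equiv.swap_apply_of_ne_of_ne _ hx.ne']
          rintro rfl
          have := Fin.lt_def.1 hx
          omega
      simp [Module.End.mul_apply, sOp_sOp, e1, e2]
    rcases eq_or_ne j b with rfl | hjb
    · simp [hwa]
    · rw [Equiv.swap_apply_of_ne_of_ne hja hjb, tOp_swap ha hb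
        (by rw [Function.update_of_ne hja.symm, hwa])
        (by rw [Function.update_of_ne hjb.symm, hwb]), update_comp_swap,
        Function.comp_apply, Equiv.swap_apply_of_ne_of_ne hja hjb]
      have := congrArg (fun T => T (c (Function.update w j true ∘ Equiv.swap a b)))
        (edgeMap_sOp (N := N) (k := k) hba hja hjb hwa hwb)
      rw [ha] at this
      cases w j
      · simpa using this
      · simp
  · rw [tOp_same ha hb (hwa.trans hwb.symm), differential_apply, map_sum]
    refine Finset.sum_congr rfl fun j _ => ?_
    rcases eq_or_ne j a with rfl | hja
    · simp [hwa]
    rcases eq_or_ne j b with rfl | hjb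
    · simp [hwb]
    · rw [tOp_same ha hb (by
        rw [Function.update_of_ne hja.symm, Function.update_of_ne hjb.symm, hwa, hwb])]
      have := congrArg (fun T => T (c (Function.update w j true)))
        (edgeMap_dOp (N := N) (k := k) hba hja hjb (hwa.trans hwb.symm))
      rw [ha] at this
      cases w j
      · simpa using this
      · simp

end TOp


/-! ### NilHecke relations for the operators on the cube -/

section TOpRelations

variable {N k r : ℕ} {l : ℕ} {a b e : Fin r}

theorem tOp_of_not_lt (hl : ¬ l + 1 < r) (c : Cube N k r) : tOp N k r l c = 0 := by
  funext w
  rw [tOp, LinearMap.pi_apply, dif_neg hl]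
  rfl

/-- The vertexwise description of the kernel of the operator `tOp`. -/
theorem tOp_eq_zero_iff (ha : (a : ℕ) = l) (hb : (b : ℕ) = l + 1) {c : Cube N k r} :
    tOp N k r l c = 0 ↔ ∀ v, (v a = v b → dOp N k r l (c v) = 0) ∧
      (v a = false → v b = true → c v = 0) := by
  have hab : a ≠ b := fun e => by have := congrArg Fin.val e; omega
  constructor
  · intro h v
    refine ⟨fun hv => ?_, fun h1 h2 => ?_⟩
    · rw [← tOp_same ha hb hv, h]; rfl
    · have := congrFun h (v ∘ Equiv.swap a b)
      rw [tOp_swap ha hb (by simpa using h2) (by simpa using h1)] at this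
      have e : (v ∘ Equiv.swap a b) ∘ Equiv.swap a b = v := by
        funext x; simp
      rw [e] at this
      rw [← sOp_sOp l (c v), this]
      simp
  · intro h
    funext v
    rcases hwa : v a with _ | _ <;> rcases hwb : v b with _ | _
    · rw [tOp_same ha hb (hwa.trans hwb.symm), (h v).1 (hwa.trans hwb.symm)]; rfl
    · rw [tOp_zero ha hb hwa hwb]; rfl
    · rw [tOp_swap ha hb hwa hwb, (h _).2 (by simpa using hwb) (by simpa using hwa), map_zero]; rfl
    · rw [tOp_same ha hb (hwa.trans hwb.symm), (h v).1 (hwa.trans hwb.symm)]; rfl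

theorem tOp_tOp (l : ℕ) (c : Cube N k r) : tOp N k r l (tOp N k r l c) = 0 := by
  by_cases hl : l + 1 < r
  swap
  · exact tOp_of_not_lt hl _
  obtain ⟨a, ha⟩ : ∃ a : Fin r, (a : ℕ) = l := ⟨⟨l, by omega⟩, rfl⟩
  obtain ⟨b, hb⟩ : ∃ b : Fin r, (b : ℕ) = l + 1 := ⟨⟨l + 1, hl⟩, rfl⟩
  refine (tOp_eq_zero_iff ha hb).2 fun v => ⟨fun h => ?_, fun h1 h2 => tOp_zero ha hb h1 h2 c⟩
  rw [tOp_same ha hb h, dOp_dOp]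

theorem tOp_comm {l m : ℕ} (h : l + 1 < m) (c : Cube N k r) :
    tOp N k r l (tOp N k r m c) = tOp N k r m (tOp N k r l c) := by
  by_cases hm : m + 1 < r
  swap
  · rw [tOp_of_not_lt hm, tOp_of_not_lt hm, map_zero]
  obtain ⟨a, ha⟩ : ∃ a : Fin r, (a : ℕ) = l := ⟨⟨l, by omega⟩, rfl⟩
  obtain ⟨b, hb⟩ : ∃ b : Fin r, (b : ℕ) = l + 1 := ⟨⟨l + 1, by omega⟩, rfl⟩
  obtain ⟨a', ha'⟩ : ∃ a : Fin r, (a : ℕ) = m := ⟨⟨m, by omega⟩, rfl⟩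
  obtain ⟨b', hb'⟩ : ∃ b : Fin r, (b : ℕ) = m + 1 := ⟨⟨m + 1, hm⟩, rfl⟩
  have n1 : a ≠ a' := fun e => by have := congrArg Fin.val e; omega
  have n2 : a ≠ b' := fun e => by have := congrArg Fin.val e; omega
  have n3 : b ≠ a' := fun e => by have := congrArg Fin.val e; omega
  have n4 : b ≠ b' := fun e => by have := congrArg Fin.val e; omega
  have f1 : ∀ w : Fin r → Bool, (w ∘ Equiv.swap a b) a' = w a' := fun w => by
    simp [Equiv.swap_apply_of_ne_of_ne n1.symm n3.symm]
  have f2 : ∀ w : Fin r → Bool, (w ∘ Equiv.swap a b) b' = w b' := fun w => by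
    simp [Equiv.swap_apply_of_ne_of_ne n2.symm n4.symm]
  have f3 : ∀ w : Fin r → Bool, (w ∘ Equiv.swap a' b') a = w a := fun w => by
    simp [Equiv.swap_apply_of_ne_of_ne n1 n2]
  have f4 : ∀ w : Fin r → Bool, (w ∘ Equiv.swap a' b') b = w b := fun w => by
    simp [Equiv.swap_apply_of_ne_of_ne n3 n4]
  have key : ∀ w : Fin r → Bool, (w ∘ Equiv.swap a b) ∘ Equiv.swap a' b' =
      (w ∘ Equiv.swap a' b') ∘ Equiv.swap a b := fun w => by
    have : Equiv.swap a b * Equiv.swap a' b' = Equiv.swap a' b' * Equiv.swap a b := by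
      rw [Equiv.mul_swap_eq_swap_mul, Equiv.swap_apply_of_ne_of_ne n1.symm n3.symm,
        Equiv.swap_apply_of_ne_of_ne n2.symm n4.symm]
    funext x
    exact congrArg w (congrArg (fun σ : Equiv.Perm (Fin r) => σ x) this)
  have dd : ∀ f, dOp N k r l (dOp N k r m f) = dOp N k r m (dOp N k r l f) := fun f =>
    congrArg (fun T => T f) (dOp_comm_dOp (Or.inl h))
  have sd : ∀ f, sOp N k r l (dOp N k r m f) = dOp N k r m (sOp N k r l f) := fun f =>
    congrArg (fun T => T f) (sOp_comm_dOp (Or.inl h))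
  have ds : ∀ f, dOp N k r l (sOp N k r m f) = sOp N k r m (dOp N k r l f) := fun f =>
    (congrArg (fun T => T f) (sOp_comm_dOp (Or.inr h))).symm
  have ss : ∀ f, sOp N k r l (sOp N k r m f) = sOp N k r m (sOp N k r l f) := fun f =>
    congrArg (fun T => T f) (sOp_comm_sOp (Or.inl h))
  have tri : ∀ x y : Bool, x = y ∨ (x = true ∧ y = false) ∨ (x = false ∧ y = true) := by decide
  funext w
  rcases tri (w a) (w b) with h1 | ⟨h1, h2⟩ | ⟨h1, h2⟩ <;>
  rcases tri (w a') (w b') with h3 | ⟨h3, h4⟩ | ⟨h3, h4⟩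
  · rw [tOp_same ha hb h1, tOp_same ha' hb' h3, tOp_same ha' hb' h3, tOp_same ha hb h1, dd]
  · rw [tOp_same ha hb h1, tOp_swap ha' hb' h3 h4, tOp_swap ha' hb' h3 h4,
      tOp_same ha hb (by rw [f3, f4, h1]), ds]
  · rw [tOp_same ha hb h1, tOp_zero ha' hb' h3 h4, tOp_zero ha' hb' h3 h4, map_zero]
  · rw [tOp_swap ha hb h1 h2, tOp_same ha' hb' (by rw [f1, f2, h3]), tOp_same ha' hb' h3,
      tOp_swap ha hb h1 h2, sd]
  · rw [tOp_swap ha hb h1 h2, tOp_swap ha' hb' (by rw [f1, h3]) (by rw [f2, h4]),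
      tOp_swap ha' hb' h3 h4, tOp_swap ha hb (by rw [f3, h1]) (by rw [f4, h2]), ss, key]
  · rw [tOp_swap ha hb h1 h2, tOp_zero ha' hb' (by rw [f1, h3]) (by rw [f2, h4]),
      tOp_zero ha' hb' h3 h4, map_zero]
  · rw [tOp_zero ha hb h1 h2, tOp_same ha' hb' h3, tOp_zero ha hb h1 h2, map_zero]
  · rw [tOp_zero ha hb h1 h2, tOp_swap ha' hb' h3 h4,
      tOp_zero ha hb (by rw [f3, h1]) (by rw [f4, h2]), map_zero]
  · rw [tOp_zero ha hb h1 h2, tOp_zero ha' hb' h3 h4]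

theorem tOp_braid (l : ℕ) (c : Cube N k r) :
    tOp N k r l (tOp N k r (l + 1) (tOp N k r l c)) =
      tOp N k r (l + 1) (tOp N k r l (tOp N k r (l + 1) c)) := by
  by_cases hm : l + 2 < r
  swap
  · rw [tOp_of_not_lt (l := l + 1) hm, tOp_of_not_lt (l := l + 1) hm, map_zero]
  obtain ⟨a, ha⟩ : ∃ a : Fin r, (a : ℕ) = l := ⟨⟨l, by omega⟩, rfl⟩
  obtain ⟨b, hb⟩ : ∃ b : Fin r, (b : ℕ) = l + 1 := ⟨⟨l + 1, by omega⟩, rfl⟩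
  obtain ⟨e, he⟩ : ∃ e : Fin r, (e : ℕ) = l + 1 + 1 := ⟨⟨l + 1 + 1, by omega⟩, rfl⟩
  have nab : a ≠ b := fun e => by have := congrArg Fin.val e; omega
  have nae : a ≠ e := fun e => by have := congrArg Fin.val e; omega
  have nbe : b ≠ e := fun e => by have := congrArg Fin.val e; omega
  have f1 : ∀ w : Fin r → Bool, (w ∘ Equiv.swap a b) a = w b := fun w => by simp
  have f2 : ∀ w : Fin r → Bool, (w ∘ Equiv.swap a b) b = w a := fun w => by simp
  have f3 : ∀ w : Fin r → Bool, (w ∘ Equiv.swap a b) e = w e := fun w => by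
    simp [Equiv.swap_apply_of_ne_of_ne nae.symm nbe.symm]
  have f4 : ∀ w : Fin r → Bool, (w ∘ Equiv.swap b e) b = w e := fun w => by simp
  have f5 : ∀ w : Fin r → Bool, (w ∘ Equiv.swap b e) e = w b := fun w => by simp
  have f6 : ∀ w : Fin r → Bool, (w ∘ Equiv.swap b e) a = w a := fun w => by
    simp [Equiv.swap_apply_of_ne_of_ne nab nae]
  funext w
  -- Only weakly decreasing triples contribute. Constant triples give the braid relation for divided
  -- differences, (1,0,0) and (1,1,0) give the two mixed relations, and at all others both sides
  -- vanish.
  rcases hwa : w a with _ | _ <;> rcases hwb : w b with _ | _ <;> rcases hwe : w e with _ | _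
  · rw [tOp_same ha hb (by simp [*]), tOp_same hb he (by simp [*]), tOp_same ha hb (by simp [*]),
      tOp_same hb he (by simp [*]), tOp_same ha hb (by simp [*]), tOp_same hb he (by simp [*])]
    exact congrArg (fun T => T (c w)) (dOp_braid l)
  · rw [tOp_zero hb he hwb hwe, tOp_same ha hb (by simp [*]), tOp_zero hb he hwb hwe, map_zero]
  · rw [tOp_zero ha hb hwa hwb, tOp_swap hb he hwb hwe, tOp_same ha hb (by simp only [*]),
      tOp_zero hb he (by simp only [*]) (by simp only [*]), map_zero, map_zero]
  · rw [tOp_zero ha hb hwa hwb, tOp_same hb he (by simp [*]), tOp_zero ha hb hwa hwb, map_zero]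
  · rw [tOp_swap ha hb hwa hwb, tOp_swap hb he (by simp only [*]) (by simp only [*]),
      tOp_same ha hb (by simp only [*]), tOp_same hb he (by simp [*]),
      tOp_swap ha hb hwa hwb, tOp_swap hb he (by simp only [*]) (by simp only [*])]
    exact LinearMap.congr_fun (s_s_d_up hm) _
  · rw [tOp_swap ha hb hwa hwb, tOp_same hb he (by simp only [*]),
      tOp_zero ha hb (by simp only [*]) (by simp only [*]), tOp_zero hb he hwb hwe,
      map_zero, map_zero]
  · rw [tOp_same ha hb (by simp [*]), tOp_swap hb he hwb hwe,
      tOp_swap ha hb (by simp only [*]) (by simp only [*]), tOp_swap hb he hwb hwe,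
      tOp_swap ha hb (by simp only [*]) (by simp only [*]),
      tOp_same hb he (by simp only [*])]
    exact (LinearMap.congr_fun (s_s_d_down hm) _).symm
  · rw [tOp_same ha hb (by simp [*]), tOp_same hb he (by simp [*]), tOp_same ha hb (by simp [*]),
      tOp_same hb he (by simp [*]), tOp_same ha hb (by simp [*]), tOp_same hb he (by simp [*])]
    exact congrArg (fun T => T (c w)) (dOp_braid l)

end TOpRelations

/-! ## Symmetric coefficients -/

section Coefficients

variable {N k r : ℕ}

variable (N k r) in
/-- The coloring of the indeterminates whose invariants are the polynomials symmetric in `Y`, in `Z`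
and in `W`. -/
def coeffColor : Idx N k r → Fin r ⊕ Fin 3
  | Sum.inl (Sum.inl i) => Sum.inl i
  | Sum.inl (Sum.inr _) => Sum.inr 0
  | Sum.inr (Sum.inl _) => Sum.inr 1
  | Sum.inr (Sum.inr _) => Sum.inr 2

variable (N k r) in
/-- The ring `ℤ[X] ⊗ Sym(Y) ⊗ Sym(Z) ⊗ Sym(W)`. -/
noncomputable abbrev coeffRing : Subalgebra ℤ (Poly N k r) := colorInv (coeffColor N k r)

theorem coeffColor_swap {s t : Idx N k r} (hst : s ≠ t) (h : coeffColor N k r s = coeffColor N k r t) :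
    (∀ i, Equiv.swap s t (xI N k i) = xI N k i) ∧
      ∃ η : Equiv.Perm (Fin r), ∀ i, Equiv.swap s t (yI N k i) = yI N k (η i) := by
  rcases s with (i | i) | (i | i) <;> rcases t with (j | j) | (j | j) <;>
    simp [coeffColor] at h <;> refine ⟨fun a => ?_, ?_⟩
  · exact absurd (by rw [h]) hst
  · exact absurd (by rw [h]) hst
  · exact Equiv.swap_apply_of_ne_of_ne (by simp [xI]) (by simp [xI])
  · exact ⟨1, fun a => Equiv.swap_apply_of_ne_of_ne (by simp [yI]) (by simp [yI])⟩
  · exact Equiv.swap_apply_of_ne_of_ne (by simp [xI]) (by simp [xI])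
  · refine ⟨Equiv.swap i j, fun a => ?_⟩
    have hinj : Function.Injective (yI N k : Fin r → Idx N k r) :=
      fun _ _ e => Sum.inl_injective (Sum.inr_injective e)
    exact (hinj.map_swap (x := i) (y := j) (z := a)).symm
  · exact Equiv.swap_apply_of_ne_of_ne (by simp [xI]) (by simp [xI])
  · exact ⟨1, fun a => Equiv.swap_apply_of_ne_of_ne (by simp [yI]) (by simp [yI])⟩

/-- Transpositions within Y, Z or W generate the group defining the coefficient ring, so commuting
with permutations that fix X and preserve Y is enough. -/
theorem mem_coeffRing_of_comm {O : Module.End (HBU N k r) (Poly N k r)}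
    (h : ∀ (σ : Equiv.Perm (Idx N k r)) (η : Equiv.Perm (Fin r)),
      (∀ i, σ (xI N k i) = xI N k i) → (∀ i, σ (yI N k i) = yI N k (η i)) →
      permOp σ * O = O * permOp σ) {f : Poly N k r} (hf : f ∈ coeffRing N k r) :
    O f ∈ coeffRing N k r := by
  refine mem_colorInv_iff_swap.2 fun s t hst e => ?_
  obtain ⟨hx, η, hy⟩ := coeffColor_swap hst e
  have := congrArg (fun T => T f) (h _ η hx hy)
  rw [Module.End.mul_apply, Module.End.mul_apply, permOp_apply, permOp_apply,
    mem_colorInv_iff_swap.1 hf s t hst e] at this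
  exact this

theorem sOp_mem (l : ℕ) {f : Poly N k r} (hf : f ∈ coeffRing N k r) :
    sOp N k r l f ∈ coeffRing N k r :=
  mem_coeffRing_of_comm (fun _ _ hx _ => permOp_comm_sOp fun i _ => hx i) hf

theorem dOp_mem (l : ℕ) {f : Poly N k r} (hf : f ∈ coeffRing N k r) :
    dOp N k r l f ∈ coeffRing N k r :=
  mem_coeffRing_of_comm (fun _ _ hx _ => permOp_comm_dOp fun i _ => hx i) hf

theorem edgeMap_mem (w : Fin r → Bool) (i : Fin r) {f : Poly N k r} (hf : f ∈ coeffRing N k r) :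
    edgeMap N k w i f ∈ coeffRing N k r :=
  mem_coeffRing_of_comm (fun σ η hx hy => permOp_comm_edgeMap σ η w i (fun j _ => hx j) hy) hf

theorem X_xI_mem (i : Fin r) : (MvPolynomial.X (xI N k i) : Poly N k r) ∈ coeffRing N k r := by
  refine mem_colorInv_iff_swap.2 fun s t hst e => ?_
  rw [MvPolynomial.rename_X, (coeffColor_swap hst e).1]

variable (N k r) in
/-- The chains of homological degree `n` with coefficients symmetric in `Y`, `Z` and `W`. -/
noncomputable def chains (n : ℕ) : Submodule (HBU N k r) (Cube N k r) where
  carrier := {c | ∀ v, c v ∈ coeffRing N k r ∧ (numOnes v ≠ n → c v = 0)}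
  zero_mem' v := ⟨zero_mem _, fun _ => rfl⟩
  add_mem' {c c'} h h' v := ⟨add_mem (h v).1 (h' v).1, fun hv => by
    rw [Pi.add_apply, (h v).2 hv, (h' v).2 hv, add_zero]⟩
  smul_mem' p c h v := ⟨mul_mem (symmetric_le_colorInv _ p.2) (h v).1, fun hv => by
    rw [Pi.smul_apply, (h v).2 hv, smul_zero]⟩

theorem numOnes_comp (v : Fin r → Bool) (σ : Equiv.Perm (Fin r)) : numOnes (v ∘ σ) = numOnes v := by
  unfold numOnes
  exact Finset.card_bij (fun i _ => σ i) (by simp) (by simp) fun i hi =>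
    ⟨σ.symm i, by simpa using hi, by simp⟩

theorem numOnes_update {v : Fin r → Bool} {i : Fin r} (h : v i = false) :
    numOnes (Function.update v i true) = numOnes v + 1 := by
  unfold numOnes
  rw [← Finset.card_insert_of_notMem (a := i) (by simp [h])]
  congr 1
  ext j
  rcases eq_or_ne j i with rfl | hj
  · simp
  · simp [hj]

theorem differential_mem {n : ℕ} {c : Cube N k r} (hc : c ∈ chains N k r (n + 1)) :
    differential N k r c ∈ chains N k r n := by
  intro v
  rw [differential_apply]
  refine ⟨sum_mem fun i _ => ?_, fun hv => Finset.sum_eq_zero fun i _ => ?_⟩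
  · split_ifs
    · exact zero_mem _
    · exact edgeMap_mem _ _ (hc _).1
  · split_ifs with h
    · rfl
    · rw [(hc _).2 (by rw [numOnes_update (by simpa using h)]; omega), map_zero]

theorem tOp_mem {n l : ℕ} {c : Cube N k r} (hc : c ∈ chains N k r n) :
    tOp N k r l c ∈ chains N k r n := by
  by_cases hl : l + 1 < r
  swap
  · rw [tOp_of_not_lt hl]; exact zero_mem _
  obtain ⟨a, ha⟩ : ∃ a : Fin r, (a : ℕ) = l := ⟨⟨l, by omega⟩, rfl⟩
  obtain ⟨b, hb⟩ : ∃ b : Fin r, (b : ℕ) = l + 1 := ⟨⟨l + 1, by omega⟩, rfl⟩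
  have tri : ∀ x y : Bool, x = y ∨ (x = true ∧ y = false) ∨ (x = false ∧ y = true) := by decide
  intro w
  rcases tri (w a) (w b) with h1 | ⟨h1, h2⟩ | ⟨h1, h2⟩
  · rw [tOp_same ha hb h1]
    exact ⟨dOp_mem _ (hc w).1, fun h => by rw [(hc w).2 h, map_zero]⟩
  · rw [tOp_swap ha hb h1 h2]
    exact ⟨sOp_mem _ (hc _).1, fun h => by rw [(hc _).2 (by rwa [numOnes_comp]), map_zero]⟩
  · rw [tOp_zero ha hb h1 h2]
    exact ⟨zero_mem _, fun _ => rfl⟩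

theorem chains_eq_zero {n : ℕ} (hn : r < n) {c : Cube N k r} (hc : c ∈ chains N k r n) : c = 0 := by
  funext v
  refine (hc v).2 (ne_of_lt (lt_of_le_of_lt ?_ hn))
  exact (Finset.card_le_univ _).trans (by simp)

end Coefficients


/-! ## Passing from the cube to the subcomplex of invariants -/

section Words

variable {N k r : ℕ}

variable (N k r) in
/-- The composition `T_{m+n-1} ⋯ T_{m+1} T_m`. -/
noncomputable def tWord (m : ℕ) : ℕ → Cube N k r →ₗ[HBU N k r] Cube N k r
  | 0 => LinearMap.id
  | n + 1 => tOp N k r (m + n) ∘ₗ tWord m n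

theorem tWord_succ (m n : ℕ) (c : Cube N k r) :
    tWord N k r m (n + 1) c = tOp N k r (m + n) (tWord N k r m n c) := rfl

theorem tWord_add (m p n : ℕ) (c : Cube N k r) :
    tWord N k r m (p + n) c = tWord N k r (m + p) n (tWord N k r m p c) := by
  induction n with
  | zero => rfl
  | succ n ih => rw [← add_assoc, tWord_succ, ih, tWord_succ, add_assoc]

theorem tWord_succ' (m n : ℕ) (c : Cube N k r) :
    tWord N k r m (n + 1) c = tWord N k r (m + 1) n (tOp N k r m c) := by
  rw [add_comm, tWord_add]
  rfl

theorem tWord_differential (m n : ℕ) (c : Cube N k r) :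
    tWord N k r m n (differential N k r c) = differential N k r (tWord N k r m n c) := by
  induction n with
  | zero => rfl
  | succ n ih => rw [tWord_succ, ih, tOp_differential, tWord_succ]

theorem tWord_mem {m n d : ℕ} {c : Cube N k r} (hc : c ∈ chains N k r d) :
    tWord N k r m n c ∈ chains N k r d := by
  induction n with
  | zero => exact hc
  | succ n ih => exact tOp_mem ih

theorem tOp_tWord_comm {m n l : ℕ} (h : m + n < l) (c : Cube N k r) :
    tOp N k r l (tWord N k r m n c) = tWord N k r m n (tOp N k r l c) := by
  induction n with
  | zero => rfl
  | succ n ih => rw [tWord_succ, ← tOp_comm (by omega), ih (by omega), tWord_succ]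

/-- The image of a divided difference word is killed by the divided differences inside the word. -/
theorem tOp_tWord_eq_zero {m p n : ℕ} (hp : p < n) {c : Cube N k r}
    (hc : ∀ l, m < l → l < m + n → tOp N k r l c = 0) :
    tOp N k r (m + p) (tWord N k r m n c) = 0 := by
  induction n with
  | zero => omega
  | succ n ih =>
    rw [tWord_succ]
    rcases Nat.lt_or_ge p n with h | h
    · rcases Nat.lt_or_ge (p + 1) n with h' | h'
      · rw [tOp_comm (by omega), ih h fun l h1 h2 => hc l h1 (by omega), map_zero]
      · obtain rfl : n = p + 1 := by omega
        -- The braid relation converts the extra letter into the next one on the right of the last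
        -- two letters; that letter commutes with the rest of the word and reaches `c`, which it
        -- kills.
        rw [tWord_succ, ← add_assoc, tOp_braid, tOp_tWord_comm (by omega),
          hc _ (by omega) (by omega), map_zero, map_zero, map_zero]
    · obtain rfl : p = n := by omega
      exact tOp_tOp _ _

/-! ### Sections of the words -/

variable (N k r) in
/-- The variable `x_l` (zero if there is none). -/
noncomputable def xVar (l : ℕ) : Poly N k r :=
  if h : l < r then MvPolynomial.X (xI N k ⟨l, h⟩) else 0

theorem xVar_mem (l : ℕ) : xVar N k r l ∈ coeffRing N k r := by
  unfold xVar
  split_ifs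
  · exact X_xI_mem _
  · exact zero_mem _

theorem sOp_xVar_of_ne {l m : ℕ} (h1 : m ≠ l) (h2 : m ≠ l + 1) :
    sOp N k r l (xVar N k r m) = xVar N k r m := by
  unfold sOp
  split_ifs
  · unfold xVar
    split_ifs
    · rw [permOp_apply, MvPolynomial.rename_X, swap_xI_apply (by simpa using h1.symm)
        (by simpa using h2.symm)]
    · exact map_zero _
  · rfl

theorem sOp_pow (l : ℕ) (f : Poly N k r) (n : ℕ) : sOp N k r l (f ^ n) = sOp N k r l f ^ n := by
  unfold sOp
  split_ifs
  · simp only [permOp_apply, map_pow]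
  · rfl

theorem dOp_xVar_pow_mul {l m : ℕ} (h : m + 1 ≤ l) (t : ℕ) (f : Poly N k r) :
    dOp N k r l (xVar N k r m ^ t * f) = xVar N k r m ^ t * dOp N k r l f :=
  dOp_mulLeft (by rw [sOp_pow, sOp_xVar_of_ne (by omega) (by omega)]) f

theorem dOp_xVar_pow_mul_of_lt {l m : ℕ} (h : l + 1 < m) (t : ℕ) (f : Poly N k r) :
    dOp N k r l (xVar N k r m ^ t * f) = xVar N k r m ^ t * dOp N k r l f :=
  dOp_mulLeft (by rw [sOp_pow, sOp_xVar_of_ne (by omega) (by omega)]) f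

/-- `f` is symmetric in the two variables and factors out; the rest is the geometric sum for the
divided difference of a power. -/
theorem dOp_self_xVar_pow_mul {l : ℕ} (hl : l + 1 < r) (t : ℕ) {f : Poly N k r}
    (hf : dOp N k r l f = 0) :
    dOp N k r l (xVar N k r l ^ t * f) =
      ∑ u ∈ Finset.range t, xVar N k r l ^ u * (xVar N k r (l + 1) ^ (t - 1 - u) * f) := by
  have hl' : l < r := by omega
  unfold dOp at *
  rw [dif_pos hl] at *
  refine divDiff_eq _ ?_
  rw [divDiff_eq_zero_iff] at hf
  rw [map_mul, hf, map_pow, xVar, xVar, dif_pos hl', dif_pos hl, MvPolynomial.rename_X,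
    Equiv.swap_apply_left, ← sub_mul, ← geom_sum₂_mul, Finset.mul_sum, Finset.sum_mul,
    Finset.sum_mul]
  exact Finset.sum_congr rfl fun u _ => by ring

variable (N k r) in
/-- The composition `∂_{m+n-1} ⋯ ∂_m`. -/
noncomputable def dWord (m : ℕ) : ℕ → Poly N k r →ₗ[HBU N k r] Poly N k r
  | 0 => LinearMap.id
  | n + 1 => dOp N k r (m + n) ∘ₗ dWord m n

theorem dWord_succ' (m n : ℕ) (f : Poly N k r) :
    dWord N k r m (n + 1) f = dWord N k r (m + 1) n (dOp N k r m f) := by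
  induction n with
  | zero => rfl
  | succ n ih =>
    rw [dWord, LinearMap.comp_apply, ih, dWord, LinearMap.comp_apply]
    congr 2
    omega

theorem dWord_xVar_pow_mul {m l : ℕ} (h : m + 1 ≤ l) (n t : ℕ) (f : Poly N k r) :
    dWord N k r l n (xVar N k r m ^ t * f) = xVar N k r m ^ t * dWord N k r l n f := by
  induction n with
  | zero => rfl
  | succ n ih =>
    rw [dWord, LinearMap.comp_apply, ih, dOp_xVar_pow_mul (by omega), LinearMap.comp_apply]

/-- The word lowers the degree by its length, so on the powers of x_m considered here only the top
one survives, with coefficient 1. In the recursion, only the summand free of x_m can still have the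
required degree in the next variable. -/
theorem dWord_xVar_pow {m n t : ℕ} (hmn : m + n < r) (ht : t ≤ n) {f : Poly N k r}
    (hf : ∀ l, m ≤ l → l < m + n → dOp N k r l f = 0) :
    dWord N k r m n (xVar N k r m ^ t * f) = if t = n then f else 0 := by
  induction n generalizing m t with
  | zero =>
    obtain rfl : t = 0 := by omega
    simp [dWord]
  | succ n ih =>
    rw [dWord_succ', dOp_self_xVar_pow_mul (by omega) _ (hf m le_rfl (by omega)), map_sum]
    have e : ∀ u ∈ Finset.range t, dWord N k r (m + 1) n
        (xVar N k r m ^ u * (xVar N k r (m + 1) ^ (t - 1 - u) * f)) =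
        xVar N k r m ^ u * if t - 1 - u = n then f else 0 := fun u hu => by
      rw [dWord_xVar_pow_mul le_rfl, ih (by omega) (by omega) fun l h1 h2 =>
        hf l (by omega) (by omega)]
    rw [Finset.sum_congr rfl e]
    split_ifs with h
    · subst h
      rw [Finset.sum_eq_single 0]
      · simp
      · intro u hu' hu
        rw [if_neg (by have := Finset.mem_range.1 hu'; omega), mul_zero]
      · simp
    · refine Finset.sum_eq_zero fun u hu => ?_
      rw [if_neg (by have := Finset.mem_range.1 hu; omega), mul_zero]

/-- Divided differences of chains supported on vertices with constant entries. -/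
theorem tWord_of_const {m n : ℕ} (hmn : m + n < r) {c : Cube N k r}
    (hc : ∀ v, c v ≠ 0 → ∀ a b : Fin r, m ≤ a → (a : ℕ) ≤ m + n → m ≤ b → (b : ℕ) ≤ m + n →
      v a = v b) :
    tWord N k r m n c = fun v => dWord N k r m n (c v) := by
  suffices ∀ p ≤ n, tWord N k r m p c = fun v => dWord N k r m p (c v) from this n le_rfl
  intro p hp
  induction p with
  | zero => rfl
  | succ p ih =>
    rw [tWord_succ, ih (by omega)]
    obtain ⟨a, ha⟩ : ∃ a : Fin r, (a : ℕ) = m + p := ⟨⟨m + p, by omega⟩, rfl⟩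
    obtain ⟨b, hb⟩ : ∃ b : Fin r, (b : ℕ) = m + p + 1 := ⟨⟨m + p + 1, by omega⟩, rfl⟩
    have hc0 : ∀ v, v a ≠ v b → c v = 0 := fun v hv => by
      by_contra h
      exact hv (hc v h a b (by omega) (by omega) (by omega) (by omega))
    have tri : ∀ x y : Bool, x = y ∨ (x = true ∧ y = false) ∨ (x = false ∧ y = true) := by decide
    funext w
    rcases tri (w a) (w b) with h1 | ⟨h1, h2⟩ | ⟨h1, h2⟩
    · rw [tOp_same ha hb h1]; rfl
    · rw [tOp_swap ha hb h1 h2, hc0 w (by simp [h1, h2]), hc0 _ (by simp [h1, h2]), map_zero,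
        map_zero, map_zero]
    · rw [tOp_zero ha hb h1 h2, hc0 w (by simp [h1, h2]), map_zero]

/-- Multiplication by a polynomial at every vertex. -/
noncomputable def vMul (p : Poly N k r) (c : Cube N k r) : Cube N k r := fun v => p * c v

/-- On chains whose vertices are constant along the word, the operators are plain divided
differences, and multiplication by the top power is a section. -/
theorem tWord_vMul {m n : ℕ} (hmn : m + n < r) {c : Cube N k r}
    (hc : ∀ v, c v ≠ 0 → ∀ a b : Fin r, m ≤ a → (a : ℕ) ≤ m + n → m ≤ b → (b : ℕ) ≤ m + n →
      v a = v b) (hd : ∀ l, m ≤ l → l < m + n → ∀ v, dOp N k r l (c v) = 0) :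
    tWord N k r m n (vMul (xVar N k r m ^ n) c) = c := by
  rw [tWord_of_const hmn fun v hv => hc v fun h => hv (by rw [vMul, h, mul_zero])]
  funext v
  rw [vMul, dWord_xVar_pow hmn le_rfl fun l h1 h2 => hd l h1 h2 v, if_pos rfl]

variable (N k r) in
/-- The section of `tOp` on the chains supported on the vertices with `(v_l, v_{l+1}) = (1, 0)`. -/
noncomputable def lift (l : ℕ) (c : Cube N k r) : Cube N k r := fun w =>
  if h : l + 1 < r then
    if w ⟨l, (Nat.lt_succ_self l).trans h⟩ = false ∧ w ⟨l + 1, h⟩ = true then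
      sOp N k r l (c (w ∘ Equiv.swap ⟨l, (Nat.lt_succ_self l).trans h⟩ ⟨l + 1, h⟩))
    else 0
  else 0

variable {l : ℕ} {a b : Fin r}

theorem lift_apply (ha : (a : ℕ) = l) (hb : (b : ℕ) = l + 1) (c : Cube N k r) (w : Fin r → Bool) :
    lift N k r l c w = if w a = false ∧ w b = true then
      sOp N k r l (c (w ∘ Equiv.swap a b)) else 0 := by
  subst ha
  obtain ⟨b, hbr⟩ := b
  obtain rfl : b = a + 1 := hb
  rw [lift, dif_pos hbr]

theorem tOp_lift (ha : (a : ℕ) = l) (hb : (b : ℕ) = l + 1) {c : Cube N k r}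
    (hc : ∀ v, c v ≠ 0 → v a = true ∧ v b = false) : tOp N k r l (lift N k r l c) = c := by
  have hc0 : ∀ v, ¬ (v a = true ∧ v b = false) → c v = 0 := fun v hv => by
    by_contra h
    exact hv (hc v h)
  have tri : ∀ x y : Bool, x = y ∨ (x = true ∧ y = false) ∨ (x = false ∧ y = true) := by decide
  funext w
  rcases tri (w a) (w b) with h1 | ⟨h1, h2⟩ | ⟨h1, h2⟩
  · rw [tOp_same ha hb h1, lift_apply ha hb, if_neg (by rw [h1]; simp), map_zero,
      hc0 w (by rw [h1]; simp)]
  · have e : (w ∘ Equiv.swap a b) ∘ Equiv.swap a b = w := by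
      funext x; simp
    rw [tOp_swap ha hb h1 h2, lift_apply ha hb, if_pos (by simp [h1, h2]), e, sOp_sOp]
  · rw [tOp_zero ha hb h1 h2, hc0 w (by simp [h1])]

variable (N k r) in
/-- The composition of the sections `lift m, …, lift (m + n - 1)`. -/
noncomputable def liftWord (m : ℕ) : ℕ → Cube N k r → Cube N k r
  | 0, c => c
  | n + 1, c => liftWord m n (lift N k r (m + n) c)

theorem lift_support (ha : (a : ℕ) = l) (hb : (b : ℕ) = l + 1) {c : Cube N k r} {v : Fin r → Bool}
    (hv : lift N k r l c v ≠ 0) :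
    v a = false ∧ v b = true ∧ c (v ∘ Equiv.swap a b) ≠ 0 := by
  rw [lift_apply ha hb] at hv
  split_ifs at hv with h
  · exact ⟨h.1, h.2, fun e => hv (by rw [e, map_zero])⟩
  · exact absurd rfl hv

theorem swap_fix {a b x : Fin r} (h1 : (x : ℕ) ≠ a) (h2 : (x : ℕ) ≠ b) (v : Fin r → Bool) :
    (v ∘ Equiv.swap a b) x = v x := by
  rw [Function.comp_apply, Equiv.swap_apply_of_ne_of_ne] <;> rintro rfl <;> omega

/-- The lifts carry the zero entry at position `m + n` to the left across the ones, to position `m`;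
the word carries it back. -/
theorem tWord_liftWord {m n : ℕ} (hmn : m + n < r) {c : Cube N k r}
    (hc : ∀ v, c v ≠ 0 → ∀ x : Fin r, m ≤ x → (x : ℕ) ≤ m + n → (v x = true ↔ (x : ℕ) < m + n)) :
    tWord N k r m n (liftWord N k r m n c) = c := by
  induction n generalizing c with
  | zero => rfl
  | succ n ih =>
    obtain ⟨a, ha⟩ : ∃ a : Fin r, (a : ℕ) = m + n := ⟨⟨m + n, by omega⟩, rfl⟩
    obtain ⟨b, hb⟩ : ∃ b : Fin r, (b : ℕ) = m + n + 1 := ⟨⟨m + n + 1, by omega⟩, rfl⟩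
    rw [tWord_succ, liftWord, ih (by omega), tOp_lift ha hb]
    · intro v hv
      have h1 := hc v hv a (by omega) (by omega)
      have h2 := hc v hv b (by omega) (by omega)
      refine ⟨h1.2 (by omega), ?_⟩
      rw [← Bool.not_eq_true, h2]
      omega
    · intro v hv x h1 h2
      obtain ⟨va, vb, hv'⟩ := lift_support ha hb hv
      rcases eq_or_ne x a with rfl | hx
      · simp [va, ha]
      · have hx' : (x : ℕ) ≠ a := fun e => hx (Fin.ext e)
        have := hc _ hv' x h1 (by omega)
        rw [swap_fix hx' (by omega)] at this
        rw [this]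
        omega

theorem liftWord_support {m n : ℕ} (hmn : m + n < r) {c : Cube N k r} {v : Fin r → Bool}
    (hv : liftWord N k r m n c v ≠ 0) :
    (∀ x : Fin r, m < x → (x : ℕ) ≤ m + n → v x = true) ∧
      ∃ v', c v' ≠ 0 ∧ ∀ x : Fin r, m + n < x → v' x = v x := by
  induction n generalizing c with
  | zero => exact ⟨fun x h1 h2 => by omega, v, hv, fun _ _ => rfl⟩
  | succ n ih =>
    obtain ⟨a, ha⟩ : ∃ a : Fin r, (a : ℕ) = m + n := ⟨⟨m + n, by omega⟩, rfl⟩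
    obtain ⟨b, hb⟩ : ∃ b : Fin r, (b : ℕ) = m + n + 1 := ⟨⟨m + n + 1, by omega⟩, rfl⟩
    obtain ⟨h1, v', hv', hvv'⟩ := ih (by omega) hv
    obtain ⟨va, vb, hv''⟩ := lift_support ha hb hv'
    refine ⟨fun x hx hx' => ?_, v' ∘ Equiv.swap a b, hv'', fun x hx => ?_⟩
    · rcases Nat.lt_or_ge (m + n) x with h | h
      · obtain rfl : x = b := Fin.ext (by omega)
        rw [← hvv' x (by omega), vb]
      · exact h1 x hx h
    · rw [swap_fix (by omega) (by omega), hvv' x (by omega)]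

/-- A divided difference at every vertex. -/
noncomputable def vDiff (l : ℕ) (c : Cube N k r) : Cube N k r := fun v => dOp N k r l (c v)

theorem vDiff_lift {l m : ℕ} (h : l + 1 < m ∨ m + 1 < l) (c : Cube N k r) :
    vDiff l (lift N k r m c) = lift N k r m (vDiff l c) := by
  funext w
  rw [vDiff, lift, lift]
  split_ifs
  · exact (LinearMap.congr_fun (sOp_comm_dOp h.symm) _).symm
  all_goals exact map_zero _

theorem vDiff_lift_lift {l : ℕ} (h : l + 2 < r) (c : Cube N k r) :
    vDiff (l + 1) (lift N k r l (lift N k r (l + 1) c)) =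
      lift N k r l (lift N k r (l + 1) (vDiff l c)) := by
  obtain ⟨a, ha⟩ : ∃ a : Fin r, (a : ℕ) = l := ⟨⟨l, by omega⟩, rfl⟩
  obtain ⟨b, hb⟩ : ∃ b : Fin r, (b : ℕ) = l + 1 := ⟨⟨l + 1, by omega⟩, rfl⟩
  obtain ⟨e, he⟩ : ∃ e : Fin r, (e : ℕ) = l + 1 + 1 := ⟨⟨l + 1 + 1, by omega⟩, rfl⟩
  funext w
  rw [vDiff, lift_apply ha hb, lift_apply ha hb, lift_apply hb he, lift_apply hb he]
  split_ifs
  · exact (LinearMap.congr_fun (s_s_d_up h) _).symm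
  all_goals simp

theorem vDiff_liftWord_of_lt {l m n : ℕ} (h : m + n < l) (c : Cube N k r) :
    vDiff l (liftWord N k r m n c) = liftWord N k r m n (vDiff l c) := by
  induction n generalizing c with
  | zero => rfl
  | succ n ih => rw [liftWord, ih (by omega), vDiff_lift (by omega)]; rfl

/-- The composite lift rotates the variables cyclically, so it shifts the position of a divided
difference by one. This is how symmetry in the ones survives lifting. -/
theorem vDiff_liftWord {p m n : ℕ} (hmn : m + n < r) (h1 : p + 1 < n) (c : Cube N k r) :
    vDiff (m + p + 1) (liftWord N k r m n c) = liftWord N k r m n (vDiff (m + p) c) := by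
  induction n generalizing c with
  | zero => omega
  | succ n ih =>
    rcases Nat.lt_or_ge (p + 1) n with h | h
    · rw [liftWord, ih (by omega) h, vDiff_lift (by omega)]; rfl
    · obtain rfl : n = p + 1 := by omega
      rw [liftWord, liftWord, vDiff_liftWord_of_lt (by omega), ← add_assoc,
        vDiff_lift_lift (by omega)]
      rfl

theorem lift_mem {n : ℕ} (l : ℕ) {c : Cube N k r} (hc : c ∈ chains N k r n) :
    lift N k r l c ∈ chains N k r n := by
  intro w
  rw [lift]
  split_ifs
  · exact ⟨sOp_mem _ (hc _).1, fun h => by rw [(hc _).2 (by rwa [numOnes_comp]), map_zero]⟩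
  all_goals exact ⟨zero_mem _, fun _ => rfl⟩

theorem liftWord_mem {d : ℕ} (m n : ℕ) {c : Cube N k r} (hc : c ∈ chains N k r d) :
    liftWord N k r m n c ∈ chains N k r d := by
  induction n generalizing c with
  | zero => exact hc
  | succ n ih => exact ih (lift_mem _ hc)

theorem vMul_mem {d : ℕ} {p : Poly N k r} (hp : p ∈ coeffRing N k r) {c : Cube N k r}
    (hc : c ∈ chains N k r d) : vMul p c ∈ chains N k r d := fun v =>
  ⟨mul_mem hp (hc v).1, fun h => by rw [vMul, (hc v).2 h, mul_zero]⟩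

theorem liftWord_zero (m n : ℕ) : liftWord N k r m n (0 : Cube N k r) = 0 := by
  induction n with
  | zero => rfl
  | succ n ih =>
    have : lift N k r (m + n) (0 : Cube N k r) = 0 := by
      funext w
      rw [lift]
      split_ifs <;> simp
    rw [liftWord, this, ih]

end Words

/-! ### Subcomplexes of invariants -/

section Invariant

variable {N k r : ℕ}

variable (N k r) in
/-- The chains of degree `n` killed by the divided differences at the positions in `P`. -/
def IsInvariant (P : Set ℕ) (n : ℕ) (c : Cube N k r) : Prop :=
  c ∈ chains N k r n ∧ ∀ l ∈ P, tOp N k r l c = 0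

/-- The position `i` and the block of positions starting there. -/
structure BlockStart (r i q : ℕ) (P : Set ℕ) : Prop where
  lt : i + q < r
  pos : ∀ l ∈ P, i < l
  mem : ∀ l, i < l → l < i + q → l ∈ P
  notMem : i + q ∉ P
  lt_of_mem : ∀ l ∈ P, l + 1 < r

variable {i q : ℕ} {P : Set ℕ} (hP : BlockStart r i q P)

include hP in
-- Positions inside the word are handled by `tOp_tWord_eq_zero`, positions beyond `i + j` by
-- commutation. Position `i + j` itself is the delicate one: applying it gives the next longer word,
-- which vanishes by `h0`, and when `j = q` it is not in `P`.
theorem isInvariant_tWord {j n : ℕ} (hj0 : 0 < j) (hj : j ≤ q) {c : Cube N k r}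
    (hc : IsInvariant N k r P n c)
    (h0 : j < q → tWord N k r i (j + 1) c = 0) :
    IsInvariant N k r (insert i P) n (tWord N k r i j c) := by
  refine ⟨tWord_mem hc.1, fun l hl => ?_⟩
  rcases Nat.lt_or_ge l (i + j) with h | h
  · obtain ⟨p, rfl⟩ : ∃ p, l = i + p := by
      rcases Set.mem_insert_iff.1 hl with rfl | hl
      · exact ⟨0, rfl⟩
      · exact ⟨l - i, by have := hP.pos l hl; omega⟩
    exact tOp_tWord_eq_zero (by omega) fun l h1 h2 => hc.2 l (hP.mem l h1 (by omega))
  · have hlP : l ∈ P := (Set.mem_insert_iff.1 hl).resolve_left (by omega)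
    rcases Nat.lt_or_ge (i + j) l with h' | h'
    · rw [tOp_tWord_comm h', hc.2 l hlP, map_zero]
    · obtain rfl : l = i + j := by omega
      exact h0 (lt_of_le_of_ne hj fun e => hP.notMem (e ▸ hlP))

end Invariant


/-! ### Surjectivity of the words and descent of exactness -/

section Invariant

variable {N k r : ℕ}

theorem IsInvariant.sum {P : Set ℕ} {n : ℕ} {ι : Type*} {s : Finset ι} {f : ι → Cube N k r}
    (h : ∀ a ∈ s, IsInvariant N k r P n (f a)) : IsInvariant N k r P n (∑ a ∈ s, f a) :=
  ⟨sum_mem fun a ha => (h a ha).1, fun l hl => by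
    rw [map_sum]; exact Finset.sum_eq_zero fun a ha => (h a ha).2 l hl⟩

theorem IsInvariant.sub {P : Set ℕ} {n : ℕ} {f g : Cube N k r} (hf : IsInvariant N k r P n f)
    (hg : IsInvariant N k r P n g) : IsInvariant N k r P n (f - g) :=
  ⟨sub_mem hf.1 hg.1, fun l hl => by rw [map_sub, hf.2 l hl, hg.2 l hl, sub_zero]⟩

theorem IsInvariant.mono {P Q : Set ℕ} {n : ℕ} {f : Cube N k r} (hf : IsInvariant N k r P n f)
    (h : Q ⊆ P) : IsInvariant N k r Q n f :=
  ⟨hf.1, fun l hl => hf.2 l (h hl)⟩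

theorem IsInvariant.differential {P : Set ℕ} {n : ℕ} {f : Cube N k r}
    (hf : IsInvariant N k r P (n + 1) f) :
    IsInvariant N k r P n (FlagResolution.differential N k r f) :=
  ⟨differential_mem hf.1, fun l hl => by rw [tOp_differential, hf.2 l hl, map_zero]⟩

variable {i q : ℕ} {P : Set ℕ}

/-- The value of an invariant chain at a vertex with `v_l = v_{l+1}` is killed by `dOp l`. -/
theorem IsInvariant.dOp_eq_zero {n l : ℕ} {g : Cube N k r} (hg : IsInvariant N k r P n g)
    (hl : l ∈ P) {a b : Fin r} (ha : (a : ℕ) = l) (hb : (b : ℕ) = l + 1) {v : Fin r → Bool}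
    (hv : v a = v b) : dOp N k r l (g v) = 0 :=
  ((tOp_eq_zero_iff ha hb).1 (hg.2 l hl) v).1 hv

theorem IsInvariant.eq_zero {n l : ℕ} {g : Cube N k r} (hg : IsInvariant N k r P n g)
    (hl : l ∈ P) {a b : Fin r} (ha : (a : ℕ) = l) (hb : (b : ℕ) = l + 1) {v : Fin r → Bool}
    (h1 : v a = false) (h2 : v b = true) : g v = 0 :=
  ((tOp_eq_zero_iff ha hb).1 (hg.2 l hl) v).2 h1 h2

theorem exists_fin_pair {l : ℕ} (h : l + 1 < r) :
    ∃ a b : Fin r, (a : ℕ) = l ∧ (b : ℕ) = l + 1 :=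
  ⟨⟨l, by omega⟩, ⟨l + 1, h⟩, rfl, rfl⟩

/-- The block starting at `i` has exactly `a` entries equal to `1`, in front of the others. -/
def HasPattern (i q a : ℕ) (v : Fin r → Bool) : Prop :=
  ∀ x : Fin r, i ≤ x → (x : ℕ) ≤ i + q → (v x = true ↔ (x : ℕ) < i + a)

variable (hP : BlockStart r i q P)

include hP in
-- The word stays within the `a` leading ones, so multiplying by a power of x_i is a section. All
-- positions in `P` exceed `i`, so the factor does not disturb invariance there.
theorem exists_section_small {j n a : ℕ} (hj : j ≤ q) (hja : j < a) {g : Cube N k r}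
    (hg : IsInvariant N k r (insert i P) n g) (hs : ∀ v, g v ≠ 0 → HasPattern i q a v) :
    ∃ f, IsInvariant N k r P n f ∧ tWord N k r i j f = g := by
  have hlt := hP.lt
  refine ⟨vMul (xVar N k r i ^ j) g, ⟨vMul_mem (pow_mem (xVar_mem i) j) hg.1, fun l hl => ?_⟩,
    tWord_vMul (by omega) ?_ ?_⟩
  · obtain ⟨x, y, hx, hy⟩ := exists_fin_pair (hP.lt_of_mem l hl)
    have := hP.pos l hl
    refine (tOp_eq_zero_iff hx hy).2 fun v => ⟨fun h => ?_, fun h1 h2 => ?_⟩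
    · rw [vMul, dOp_xVar_pow_mul (by omega), hg.dOp_eq_zero (Set.mem_insert_of_mem _ hl) hx hy h,
        mul_zero]
    · rw [vMul, hg.eq_zero (Set.mem_insert_of_mem _ hl) hx hy h1 h2, mul_zero]
  · intro v hv x y h1 h2 h3 h4
    rw [(hs v hv x h1 (by omega)).2 (by omega), (hs v hv y h3 (by omega)).2 (by omega)]
  · intro l h1 h2 v
    by_cases hv : g v = 0
    · rw [hv, map_zero]
    obtain ⟨x, y, hx, hy⟩ := exists_fin_pair (r := r) (l := l) (by omega)
    refine hg.dOp_eq_zero ?_ hx hy ?_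
    · rcases eq_or_ne l i with rfl | hne
      · exact Set.mem_insert _ _
      · exact Set.mem_insert_of_mem _ (hP.mem l (by omega) (by omega))
    · rw [(hs v hv x (by omega) (by omega)).2 (by omega),
        (hs v hv y (by omega) (by omega)).2 (by omega)]

include hP in
-- The word splits: its first `a` letters move a zero from the front of the block past the `a` ones,
-- and the other `j - a` act as divided differences on zeros. The preimage therefore multiplies by
-- x_{i+a} to the power `j - a` and then moves the zero at `i + a` to the front.
theorem exists_section_large {j n a : ℕ} (hj : j ≤ q) (hja : a ≤ j) {g : Cube N k r}
    (hg : IsInvariant N k r (insert i P) n g) (hs : ∀ v, g v ≠ 0 → HasPattern i q a v) :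
    ∃ f, IsInvariant N k r P n f ∧ tWord N k r i j f = g := by
  have hlt := hP.lt
  set g' := vMul (xVar N k r (i + a) ^ (j - a)) g with hg'
  have hs' : ∀ v, g' v ≠ 0 → g v ≠ 0 := fun v hv h => hv (by rw [hg', vMul, h, mul_zero])
  have hin : ∀ l, i ≤ l → l < i + q → l ∈ insert i P := fun l h1 h2 => by
    rcases eq_or_ne l i with rfl | hne
    · exact Set.mem_insert _ _
    · exact Set.mem_insert_of_mem _ (hP.mem l (by omega) (by omega))
  refine ⟨liftWord N k r i a g',
    ⟨liftWord_mem _ _ (vMul_mem (pow_mem (xVar_mem _) _) hg.1), fun l hl => ?_⟩, ?_⟩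
  · obtain ⟨x, y, hx, hy⟩ := exists_fin_pair (hP.lt_of_mem l hl)
    have hil := hP.pos l hl
    have hl' := Set.mem_insert_of_mem i hl
    refine (tOp_eq_zero_iff hx hy).2 fun v => ⟨fun h => ?_, fun h1 h2 => ?_⟩
    -- Among the moved ones, the lift rotates the symmetry condition. At the boundary, the supported
    -- vertices have entries 1 and 0, so equality cannot hold. Beyond it, the divided difference
    -- commutes with the lift.
    · rcases lt_trichotomy l (i + a) with hla | rfl | hla
      · obtain ⟨p, rfl⟩ : ∃ p, l = i + p + 1 := ⟨l - i - 1, by omega⟩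
        have h0 : vDiff (i + p) g' = 0 := by
          funext u
          rw [vDiff, hg', vMul, dOp_xVar_pow_mul_of_lt (by omega)]
          by_cases hu : g u = 0
          · rw [hu, map_zero, mul_zero]; rfl
          obtain ⟨x', y', hx', hy'⟩ := exists_fin_pair (r := r) (l := i + p) (by omega)
          rw [hg.dOp_eq_zero (hin _ (by omega) (by omega)) hx' hy', mul_zero]
          · rfl
          rw [(hs u hu x' (by omega) (by omega)).2 (by omega),
            (hs u hu y' (by omega) (by omega)).2 (by omega)]
        have := congrFun (vDiff_liftWord (N := N) (k := k) (m := i) (n := a) (p := p) (by omega)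
          (by omega) g') v
        rw [h0, liftWord_zero] at this
        exact this
      · have hlq : i + a < i + q := by
          have : i + a ≠ i + q := fun e => hP.notMem (e ▸ hl)
          omega
        have : liftWord N k r i a g' v = 0 := by
          by_contra hv
          obtain ⟨h1, v', hv', hvv'⟩ := liftWord_support (by omega) hv
          have e1 := h1 x (by omega) (by omega)
          have e2 := (hs v' (hs' v' hv') y (by omega) (by omega)).not.2 (by omega)
          rw [hvv' y (by omega), ← h, e1] at e2
          exact e2 rfl
        rw [this, map_zero]
      · by_contra hv
        have hv : vDiff l (liftWord N k r i a g') v ≠ 0 := hv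
        rw [vDiff_liftWord_of_lt hla] at hv
        obtain ⟨-, v', hv', hvv'⟩ := liftWord_support (by omega) hv
        refine hv' ?_
        rw [vDiff, hg', vMul, dOp_xVar_pow_mul (by omega), hg.dOp_eq_zero hl' hx hy, mul_zero]
        rw [hvv' x (by omega), hvv' y (by omega), h]
    · by_contra hv
      obtain ⟨h3, v', hv', hvv'⟩ := liftWord_support (by omega) hv
      have hxa : i + a < x := by
        by_contra hxa
        rw [h3 x (by omega) (by omega)] at h1
        cases h1
      exact hs' v' hv' (hg.eq_zero hl' hx hy (by rw [hvv' x hxa, h1])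
        (by rw [hvv' y (by omega), h2]))
  · obtain ⟨t, rfl⟩ : ∃ t, j = a + t := ⟨j - a, by omega⟩
    rw [tWord_add, tWord_liftWord (by omega) fun v hv x h1 h2 =>
      hs v (hs' v hv) x h1 (by omega), hg', Nat.add_sub_cancel_left]
    refine tWord_vMul (by omega) (fun v hv x y h1 h2 h3 h4 => ?_) fun l h1 h2 v => ?_
    · have e1 := (hs v hv x (by omega) (by omega)).not.2 (by omega)
      have e2 := (hs v hv y (by omega) (by omega)).not.2 (by omega)
      rw [Bool.not_eq_true] at e1 e2
      rw [e1, e2]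
    · by_cases hv : g v = 0
      · rw [hv, map_zero]
      obtain ⟨x, y, hx, hy⟩ := exists_fin_pair (r := r) (l := l) (by omega)
      refine hg.dOp_eq_zero (hin _ (by omega) (by omega)) hx hy ?_
      have e1 := (hs v hv x (by omega) (by omega)).not.2 (by omega)
      have e2 := (hs v hv y (by omega) (by omega)).not.2 (by omega)
      rw [Bool.not_eq_true] at e1 e2
      rw [e1, e2]

include hP in
-- An invariant chain vanishes where a 0 is followed by a 1 in the block, so every entry after the
-- first 0 is 0.
theorem exists_hasPattern {n : ℕ} {g : Cube N k r} (hg : IsInvariant N k r (insert i P) n g)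
    {v : Fin r → Bool} (hv : g v ≠ 0) : ∃ a ≤ q + 1, HasPattern i q a v := by
  have hlt := hP.lt
  have hstep : ∀ x y : Fin r, i ≤ x → (y : ℕ) = x + 1 → (y : ℕ) ≤ i + q → v x = false →
      v y = false := fun x y h1 h2 h3 h4 => by
    by_contra h
    rw [Bool.not_eq_false] at h
    refine hv (hg.eq_zero ?_ rfl h2 h4 h)
    rcases eq_or_ne (x : ℕ) i with e | hne
    · rw [e]; exact Set.mem_insert _ _
    · exact Set.mem_insert_of_mem _ (hP.mem x (by omega) (by omega))
  by_cases hex : ∃ a, a ≤ q ∧ ∃ h : i + a < r, v ⟨i + a, h⟩ = false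
  · classical
    have hmin := fun m => Nat.find_min hex (m := m)
    obtain ⟨h1, h2, h3⟩ := Nat.find_spec hex
    set a := Nat.find hex
    have hge : ∀ t, (h : i + (a + t) < r) → a + t ≤ q → v ⟨i + (a + t), h⟩ = false := by
      intro t
      induction t with
      | zero => intro _ _; exact h3
      | succ t ih =>
        intro h hq
        exact hstep ⟨i + (a + t), by omega⟩ _ (by simp) (by simp; omega) (by simp; omega)
          (ih _ (by omega))
    refine ⟨a, by omega, fun x hx1 hx2 => ?_⟩
    rcases Nat.lt_or_ge (x : ℕ) (i + a) with h | h
    · have := hmin (x - i) (by omega)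
      simp only [h, iff_true]
      by_contra hx
      rw [Bool.not_eq_true] at hx
      refine this ⟨by omega, by omega, ?_⟩
      rw [← hx]
      congr 1
      exact Fin.ext (by simp; omega)
    · have := hge (x - i - a) (by omega) (by omega)
      have e : (⟨i + (a + (x - i - a)), by omega⟩ : Fin r) = x := Fin.ext (by simp; omega)
      rw [e] at this
      simp [this, h]
  · refine ⟨q + 1, le_rfl, fun x h1 h2 => ?_⟩
    have : v x = true := by
      by_contra hx
      rw [Bool.not_eq_true] at hx
      refine hex ⟨x - i, by omega, by omega, ?_⟩
      rw [← hx]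
      congr 1
      exact Fin.ext (by simp; omega)
    simp only [this, true_iff]
    omega

theorem HasPattern.unique {v : Fin r → Bool} {a a' : ℕ} (hq : i + q < r) (ha : a ≤ q + 1)
    (ha' : a' ≤ q + 1) (h : HasPattern i q a v) (h' : HasPattern i q a' v) : a = a' := by
  by_contra hne
  wlog hlt : a < a' generalizing a a'
  · exact this ha' ha h' h (Ne.symm hne) (by omega)
  have h1 := h ⟨i + a, by omega⟩ (by simp) (by simp; omega)
  have h2 := h' ⟨i + a, by omega⟩ (by simp) (by simp; omega)
  rw [h1] at h2
  simp at h2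
  omega

include hP in
-- The chain is cut according to the number of ones in the block, and the two explicit constructions
-- are added up.
theorem exists_section {j n : ℕ} (hq : 0 < q) (hj : j ≤ q) {g : Cube N k r}
    (hg : IsInvariant N k r (insert i P) n g) :
    ∃ f, IsInvariant N k r P n f ∧ tWord N k r i j f = g := by
  classical
  have hlt := hP.lt
  -- Each piece stays invariant because membership in the kernel of `tOp` is a condition on each
  -- vertex separately.
  let res : ℕ → Cube N k r := fun a v => if HasPattern i q a v then g v else 0
  have hres : ∀ a, IsInvariant N k r (insert i P) n (res a) := fun a => by
    refine ⟨fun v => ?_, fun l hl => ?_⟩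
    · simp only [res]
      split_ifs
      · exact hg.1 v
      · exact ⟨zero_mem _, fun _ => rfl⟩
    · have hlr : l + 1 < r := by
        rcases Set.mem_insert_iff.1 hl with rfl | h
        · omega
        · exact hP.lt_of_mem l h
      obtain ⟨x, y, hx, hy⟩ := exists_fin_pair hlr
      refine (tOp_eq_zero_iff hx hy).2 fun v => ?_
      have := (tOp_eq_zero_iff hx hy).1 (hg.2 l hl) v
      simp only [res]
      split_ifs
      · exact this
      · simp
  have hsec : ∀ a, ∃ f, IsInvariant N k r P n f ∧ tWord N k r i j f = res a := fun a => by
    have hs : ∀ v, res a v ≠ 0 → HasPattern i q a v := fun v hv => by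
      by_contra h
      exact hv (if_neg h)
    rcases Nat.lt_or_ge j a with h | h
    · exact exists_section_small hP hj h (hres a) hs
    · exact exists_section_large hP hj h (hres a) hs
  choose f hf hfr using hsec
  refine ⟨∑ a ∈ Finset.range (q + 2), f a, IsInvariant.sum fun a _ => hf a, ?_⟩
  rw [map_sum, Finset.sum_congr rfl fun a _ => hfr a]
  funext v
  rw [Finset.sum_apply]
  by_cases hv : g v = 0
  · rw [hv]
    exact Finset.sum_eq_zero fun a _ => ite_self _
  · obtain ⟨a, ha, hpat⟩ := exists_hasPattern hP hg hv
    rw [Finset.sum_eq_single a]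
    · exact if_pos hpat
    · intro b hb hba
      refine if_neg fun h => hba ?_
      exact HasPattern.unique hlt (by have := Finset.mem_range.1 hb; omega) ha h hpat
    · intro h
      exact absurd (Finset.mem_range.2 (by omega)) h

variable (N k r) in
/-- Exactness of the complex of chains killed by the divided differences at the positions in `P`,
with a notion `Z` of cycles that may be augmented in degree `0`. -/
def ExactAt (Z : ℕ → Cube N k r → Prop) (P : Set ℕ) : Prop :=
  ∀ n b, IsInvariant N k r P n b → Z n b →
    ∃ c, IsInvariant N k r P (n + 1) c ∧ differential N k r c = b

include hP in
-- Enlarges the symmetry on a block by one position. A primitive `c` invariant under the old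
-- positions is changed by boundaries until the new operator kills it too. The words T_{i+j-1} ⋯ T_i
-- measure the failure, and vanishing of a longer word makes the next shorter one land in the new
-- invariants.
theorem ExactAt.insert_start {Z : ℕ → Cube N k r → Prop}
    (hZ : ∀ n, ∀ c ∈ chains N k r (n + 1), differential N k r c = 0 → Z (n + 1) c) (hq : 0 < q)
    (hex : ExactAt N k r Z P) : ExactAt N k r Z (insert i P) := by
  -- Correcting in degree `n` uses exactness in degree `n + 1`, so the induction runs downwards from
  -- degrees above `r`, where there are no chains.
  suffices ∀ m n, r < n + m → ∀ b, IsInvariant N k r (insert i P) n b → Z n b →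
      ∃ c, IsInvariant N k r (insert i P) (n + 1) c ∧ differential N k r c = b from
    fun n => this (r + 1) n (by omega)
  intro m
  induction m with
  | zero =>
    intro n hn b hb _
    exact ⟨0, ⟨zero_mem _, fun _ _ => map_zero _⟩, by rw [map_zero, chains_eq_zero hn hb.1]⟩
  | succ m ih =>
    intro n hn b hb hbZ
    have ih' := ih (n + 1) (by omega)
    -- After `t` corrections the word of length `q - t + 1` kills `c`; for `t = 0` nothing is asked,
    -- and `t = q` leaves the single letter at `i`.
    have key : ∀ t ≤ q, ∃ c, IsInvariant N k r P (n + 1) c ∧ differential N k r c = b ∧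
        (q - t < q → tWord N k r i (q - t + 1) c = 0) := by
      intro t ht
      induction t with
      | zero =>
        obtain ⟨c, hc, hcb⟩ := hex n b (hb.mono (Set.subset_insert _ _)) hbZ
        exact ⟨c, hc, hcb, fun h => absurd h (by omega)⟩
      | succ t iht =>
        obtain ⟨c, hc, hcb, h0⟩ := iht (by omega)
        set j := q - t with hj
        have hg := isInvariant_tWord hP (by omega) (by omega) hc h0
        -- The word commutes with d, and its first letter already kills `b`.
        have hgd : differential N k r (tWord N k r i j c) = 0 := by
          obtain ⟨j', hj'⟩ : ∃ j', j = j' + 1 := ⟨j - 1, by omega⟩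
          rw [← tWord_differential, hcb, hj', tWord_succ', hb.2 i (Set.mem_insert _ _), map_zero]
        obtain ⟨g', hg', hgg'⟩ := ih' _ hg (hZ _ _ hg.1 hgd)
        obtain ⟨f, hf, hfg⟩ := exists_section hP hq (j := j) (by omega) hg'
        refine ⟨c - differential N k r f, hc.sub hf.differential, ?_, fun _ => ?_⟩
        · rw [map_sub, hcb, differential_differential, sub_zero]
        · rw [show q - (t + 1) + 1 = j by omega, map_sub, tWord_differential, hfg, hgg', sub_self]
    obtain ⟨c, hc, hcb, h0⟩ := key q le_rfl
    refine ⟨c, ⟨hc.1, fun l hl => ?_⟩, hcb⟩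
    rcases Set.mem_insert_iff.1 hl with rfl | hl
    · have := h0 (by omega)
      rw [Nat.sub_self] at this
      exact this
    · exact hc.2 l hl

end Invariant


/-! ### Exactness for all blocks of equal parts -/

section AdjSet

variable {N k r : ℕ} (lam : Fin r → ℕ)

/-- The positions at which two consecutive parts are equal. -/
def adjSet : Set ℕ :=
  {l | ∃ a b : Fin r, (a : ℕ) = l ∧ (b : ℕ) = l + 1 ∧ lam a = lam b}

theorem lt_of_mem_adjSet {l : ℕ} (h : l ∈ adjSet lam) : l + 1 < r := by
  obtain ⟨a, b, -, hb, -⟩ := h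
  omega

/-- Positions are added from right to left, so each one starts a block whose remaining positions are
already present. -/
theorem ExactAt.adjSet {Z : ℕ → Cube N k r → Prop}
    (hZ : ∀ n, ∀ c ∈ chains N k r (n + 1), differential N k r c = 0 → Z (n + 1) c)
    (hex : ExactAt N k r Z ∅) : ExactAt N k r Z (adjSet lam) := by
  suffices ∀ i, ExactAt N k r Z {l | l ∈ FlagResolution.adjSet lam ∧ r - i ≤ l} by
    have h := this r
    simpa using h
  intro i
  induction i with
  | zero =>
    convert hex
    ext l
    simp only [Set.mem_ofPred_eq, Set.mem_empty_iff_false, iff_false, not_and]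
    intro h
    have := lt_of_mem_adjSet lam h
    omega
  | succ i ih =>
    by_cases hi : r - (i + 1) ∈ FlagResolution.adjSet lam ∧ i < r
    · obtain ⟨hi, hir⟩ := hi
      classical
      set s := r - (i + 1) with hs
      -- The least such `t` is the length parameter of the block starting at `s`; `r + 1` is a
      -- witness since it leads out of range.
      have hex : ∃ t, 0 < t ∧ s + t ∉ FlagResolution.adjSet lam :=
        ⟨r + 1, by omega, fun h => by have := lt_of_mem_adjSet lam h; omega⟩
      obtain ⟨h1, h2⟩ := Nat.find_spec hex
      have hmin := fun m => Nat.find_min hex (m := m)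
      set q := Nat.find hex
      have hall : ∀ t < q, s + t ∈ FlagResolution.adjSet lam := fun t ht => by
        rcases Nat.eq_zero_or_pos t with rfl | hpos
        · exact hi
        · by_contra h
          exact hmin t ht ⟨hpos, h⟩
      have hP : BlockStart r s q {l | l ∈ FlagResolution.adjSet lam ∧ r - i ≤ l} :=
        { lt := by
            have := lt_of_mem_adjSet lam (hall (q - 1) (by omega))
            omega
          pos := fun l hl => by have := hl.2; omega
          mem := fun l h3 h4 => by
            have := hall (l - s) (by omega)
            rw [show s + (l - s) = l by omega] at this
            exact ⟨this, by omega⟩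
          notMem := fun h => h2 h.1
          lt_of_mem := fun l hl => lt_of_mem_adjSet lam hl.1 }
      convert ih.insert_start hP hZ h1 using 1
      ext l
      simp only [Set.mem_ofPred_eq, Set.mem_insert_iff]
      constructor
      · rintro ⟨h3, h4⟩
        rcases eq_or_ne l s with h | h
        · exact Or.inl h
        · exact Or.inr ⟨h3, by omega⟩
      · rintro (rfl | ⟨h3, h4⟩)
        · exact ⟨hi, le_rfl⟩
        · exact ⟨h3, by omega⟩
    · convert ih using 1
      ext l
      simp only [Set.mem_ofPred_eq]
      constructor
      · rintro ⟨h3, h4⟩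
        refine ⟨h3, ?_⟩
        have hlr := lt_of_mem_adjSet lam h3
        by_contra h
        obtain rfl : l = r - (i + 1) := by omega
        exact hi ⟨h3, by omega⟩
      · rintro ⟨h3, h4⟩
        exact ⟨h3, by omega⟩

end AdjSet

/-! ### The terms of F_λ as joint kernels -/

section Invariants

variable {N k r : ℕ} {lam : Fin r → ℕ}

variable (N k) in
/-- The coloring of the indeterminates whose invariants are the term of the complex at a vertex. -/
def termColor (lam : Fin r → ℕ) (v : Fin r → Bool) : Idx N k r → (ℕ × Bool) ⊕ Fin 3
  | Sum.inl (Sum.inl i) => Sum.inl (lam i, v i)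
  | Sum.inl (Sum.inr _) => Sum.inr 0
  | Sum.inr (Sum.inl _) => Sum.inr 1
  | Sum.inr (Sum.inr _) => Sum.inr 2

theorem mem_invariants {v : Fin r → Bool} {f : Poly N k r} :
    f ∈ invariants N k lam v ↔ f ∈ colorInv (termColor N k lam v) := by
  have h0 : f ∈ invariants N k lam v ↔ ∀ (σ : Equiv.Perm (Fin r)),
      (∀ i, lam (σ i) = lam i ∧ v (σ i) = v i) → ∀ (ζ : Equiv.Perm (Fin (k - r)))
      (η : Equiv.Perm (Fin r)) (ω : Equiv.Perm (Fin (N - k - r))),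
      MvPolynomial.rename (Equiv.sumCongr (Equiv.sumCongr σ ζ) (Equiv.sumCongr η ω)) f = f := by
    simp only [invariants, Submodule.mem_iInf, LinearMap.mem_eqLocus, permOp_apply,
      LinearMap.id_apply]
  rw [h0]
  constructor
  · intro h
    refine mem_colorInv_iff_swap.2 fun s t hst e => ?_
    rcases s with (i | i) | (i | i) <;> rcases t with (j | j) | (j | j) <;>
      simp [termColor] at e
    · convert h (Equiv.swap i j) (fun a => ⟨swap_preserves e.1 a, swap_preserves e.2 a⟩) 1 1 1
      ext x
      rcases x with (x | x) | (x | x) <;> simp [Equiv.swap_apply_def]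
    · convert h 1 (fun a => by simp) (Equiv.swap i j) 1 1
      ext x
      rcases x with (x | x) | (x | x) <;> simp [Equiv.swap_apply_def]
    · convert h 1 (fun a => by simp) 1 (Equiv.swap i j) 1
      ext x
      rcases x with (x | x) | (x | x) <;> simp [Equiv.swap_apply_def]
    · convert h 1 (fun a => by simp) 1 1 (Equiv.swap i j)
      ext x
      rcases x with (x | x) | (x | x) <;> simp [Equiv.swap_apply_def]
  · intro h σ hσ ζ η ω
    refine h _ fun a => ?_
    rcases a with (x | x) | (x | x) <;> simp [termColor, hσ]

/-- The classes of equal part and equal entry are intervals, so adjacent transpositions generate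
their symmetric groups. -/
theorem Admissible.eq_of_between (hanti : Antitone lam) {v : Fin r → Bool} (hv : Admissible lam v)
    {i m j : Fin r} (h1 : i ≤ m) (h2 : m ≤ j) (hl : lam i = lam j) (hvij : v i = v j) :
    lam m = lam i ∧ v m = v i := by
  have e : lam m = lam i := le_antisymm (hanti h1) (hl ▸ hanti h2)
  refine ⟨e, ?_⟩
  rcases h1.lt_or_eq with h1 | rfl
  · rcases h2.lt_or_eq with h2 | rfl
    · cases hi : v i
      · by_contra h
        rw [Bool.not_eq_false] at h
        have := hv i m h1 e.symm h
        rw [hi] at this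
        cases this
      · exact hv m j h2 (e.trans hl) (hvij ▸ hi)
    · exact hvij.symm
  · rfl

theorem mem_invariants_iff (hanti : Antitone lam) {v : Fin r → Bool} (hv : Admissible lam v)
    {f : Poly N k r} : f ∈ invariants N k lam v ↔ f ∈ coeffRing N k r ∧
      ∀ a b : Fin r, (b : ℕ) = a + 1 → lam a = lam b → v a = v b → dOp N k r a f = 0 := by
  have hd : ∀ a b : Fin r, (b : ℕ) = a + 1 → (dOp N k r a f = 0 ↔
      MvPolynomial.rename (Equiv.swap (xI N k a) (xI N k b)) f = f) := fun a b hb => by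
    obtain ⟨b, hbr⟩ := b
    obtain rfl : b = a + 1 := hb
    rw [dOp, dif_pos hbr]
    exact divDiff_eq_zero_iff _
  rw [mem_invariants]
  constructor
  · intro h
    refine ⟨colorInv_mono (fun s t e => ?_) h, fun a b hb h1 h2 => ?_⟩
    · rcases s with (i | i) | (i | i) <;> rcases t with (j | j) | (j | j) <;>
        simp [coeffColor] at e <;> simp [termColor, e]
    · rw [hd a b hb]
      exact mem_colorInv_iff_swap.1 h _ _ (xI_ne (by omega)) (by simp [termColor, xI, h1, h2])
  · rintro ⟨h1, h2⟩
    have key : ∀ n, ∀ i j : Fin r, (j : ℕ) = i + n + 1 → lam i = lam j → v i = v j →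
        MvPolynomial.rename (Equiv.swap (xI N k i) (xI N k j)) f = f := by
      intro n
      induction n with
      | zero => intro i j hij h3 h4; exact (hd i j hij).1 (h2 i j hij h3 h4)
      | succ n ih =>
        intro i j hij h3 h4
        obtain ⟨m, hm⟩ : ∃ m : Fin r, (m : ℕ) = i + n + 1 := ⟨⟨i + n + 1, by omega⟩, rfl⟩
        obtain ⟨e1, e2⟩ := hv.eq_of_between hanti (m := m) (Fin.le_def.2 (by omega))
          (Fin.le_def.2 (by omega)) h3 h4
        have s1 := ih i m hm e1.symm e2.symm
        have s2 := (hd m j (by omega)).1 (h2 m j (by omega) (e1.trans h3) (e2.trans h4))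
        -- Here `m` is the predecessor of `j`, and a transposition of distant variables is a
        -- conjugate of one at smaller distance by an adjacent one.
        have e : Equiv.swap (xI N k i) (xI N k j) = Equiv.swap (xI N k m) (xI N k j) *
            Equiv.swap (xI N k i) (xI N k m) * Equiv.swap (xI N k m) (xI N k j) := by
          rw [Equiv.swap_mul_swap_mul_swap (xI_ne (by omega)) (xI_ne (by omega)), Equiv.swap_comm]
        rw [e, rename_mul_apply, rename_mul_apply, s2, s1, s2]
    refine mem_colorInv_iff_swap.2 fun s t hst e => ?_
    rcases s with (i | i) | (i | i) <;> rcases t with (j | j) | (j | j) <;>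
      simp [termColor] at e
    · have hij : (i : ℕ) ≠ j := fun h => hst (by rw [Fin.ext h])
      rcases Nat.lt_or_gt_of_ne hij with h | h
      · exact key (j - i - 1) i j (by omega) e.1 e.2
      · rw [Equiv.swap_comm]
        exact key (i - j - 1) j i (by omega) e.1.symm e.2.symm
    all_goals exact mem_colorInv_iff_swap.1 h1 _ _ hst rfl

/-- The two halves of `tOp_eq_zero_iff` correspond to the two halves of the definition: vanishing at
a 0 followed by a 1 means support on admissible vertices, and vanishing divided differences mean
invariance. -/
theorem mem_Fterm_iff (hanti : Antitone lam) {n : ℕ} {c : Cube N k r} :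
    c ∈ Fterm N k lam n ↔ IsInvariant N k r (adjSet lam) n c := by
  classical
  have h0 : c ∈ Fterm N k lam n ↔ ∀ v, (numOnes v = n ∧ Admissible lam v →
      c v ∈ invariants N k lam v) ∧ (¬ (numOnes v = n ∧ Admissible lam v) → c v = 0) := by
    simp only [Fterm, Submodule.mem_pi, Set.mem_univ, true_implies]
    refine forall_congr' fun v => ?_
    split_ifs with h <;> simp [h]
  rw [h0]
  constructor
  · intro h
    refine ⟨fun v => ⟨?_, fun hv => (h v).2 fun h' => hv h'.1⟩, ?_⟩
    · by_cases hv : numOnes v = n ∧ Admissible lam v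
      · exact ((mem_invariants_iff hanti hv.2).1 ((h v).1 hv)).1
      · rw [(h v).2 hv]
        exact zero_mem _
    · rintro l ⟨a, b, ha, hb, hab⟩
      refine (tOp_eq_zero_iff ha hb).2 fun v => ⟨fun e => ?_, fun h1 h2 => (h v).2 fun hv => ?_⟩
      · by_cases hv : numOnes v = n ∧ Admissible lam v
        · rw [← ha]
          exact ((mem_invariants_iff hanti hv.2).1 ((h v).1 hv)).2 a b (by omega) hab e
        · rw [(h v).2 hv, map_zero]
      · have := hv.2 a b (Fin.lt_def.2 (by omega)) hab h2
        rw [h1] at this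
        cases this
  · intro h v
    refine ⟨fun hv => (mem_invariants_iff hanti hv.2).2 ⟨(h.1 v).1, fun a b hb hl e => ?_⟩,
      fun hv => ?_⟩
    · exact h.dOp_eq_zero ⟨a, b, rfl, hb, hl⟩ rfl hb e
    · by_cases hn : numOnes v = n
      swap
      · exact (h.1 v).2 hn
      by_contra hcv
      refine hv ⟨hn, fun i j hij hl hvj => ?_⟩
      suffices ∀ t, ∀ j : Fin r, (j : ℕ) = i + t → lam i = lam j → v j = true → v i = true from
        this (j - i) j (by have := Fin.lt_def.1 hij; omega) hl hvj
      intro t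
      induction t with
      | zero =>
        intro j hj _ hvj
        rwa [show i = j from Fin.ext hj.symm]
      | succ t ih =>
        intro j hj hl hvj
        obtain ⟨m, hm⟩ : ∃ m : Fin r, (m : ℕ) = i + t := ⟨⟨i + t, by omega⟩, rfl⟩
        have e : lam m = lam i := le_antisymm (hanti (Fin.le_def.2 (by omega)))
          (hl ▸ hanti (Fin.le_def.2 (by omega)))
        refine ih m hm e.symm ?_
        by_contra hvm
        rw [Bool.not_eq_true] at hvm
        exact hcv (h.eq_zero ⟨m, j, rfl, by omega, e.trans hl⟩ rfl (by omega) hvm hvj)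

end Invariants


/-! ## Exactness of the full cube -/

section Evaluation

variable {N k r : ℕ}

variable (N k r) in
/-- The substitution of indices behind `evY`. -/
def evYIdx (i : ℕ) : Idx N k r → Idx N k r
  | Sum.inr (Sum.inl j) => if i ≤ j then xI N k j else yI N k j
  | s => s

variable (N k r) in
/-- The evaluation `y_j ↦ x_j` for all `j ≥ i`. -/
noncomputable def evY (i : ℕ) : Poly N k r →ₐ[ℤ] Poly N k r := MvPolynomial.rename (evYIdx N k r i)

theorem yI_injective : Function.Injective (yI N k : Fin r → Idx N k r) :=
  fun _ _ e => Sum.inl_injective (Sum.inr_injective e)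

theorem xI_ne_yI (i j : Fin r) : xI N k i ≠ yI N k j := by simp [xI, yI]

theorem evYIdx_yI_of_le {i : ℕ} {j : Fin r} (h : i ≤ j) :
    evYIdx N k r i (yI N k j) = xI N k j := if_pos h

theorem evYIdx_yI_of_lt {i : ℕ} {j : Fin r} (h : (j : ℕ) < i) :
    evYIdx N k r i (yI N k j) = yI N k j := if_neg (by omega)

theorem evYIdx_xI (i : ℕ) (j : Fin r) : evYIdx N k r i (xI N k j) = xI N k j := rfl

theorem evY_X (i : ℕ) (s : Idx N k r) :
    evY N k r i (MvPolynomial.X s) = MvPolynomial.X (evYIdx N k r i s) :=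
  MvPolynomial.rename_X _ _

theorem evY_evY {i j : ℕ} (h : i ≤ j) (f : Poly N k r) :
    evY N k r i (evY N k r j f) = evY N k r i f := by
  rw [evY, evY, MvPolynomial.rename_rename]
  congr 2
  funext s
  rcases s with (s | s) | (s | s)
  · rfl
  · rfl
  · change evYIdx N k r i (if j ≤ s then xI N k s else yI N k s) = if i ≤ s then _ else _
    split_ifs with h1 h2 h2
    · rfl
    · omega
    · exact evYIdx_yI_of_le h2
    · exact evYIdx_yI_of_lt (by omega)
  · rfl

theorem evY_of_le {i : ℕ} (h : r ≤ i) (f : Poly N k r) : evY N k r i f = f := by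
  have : evYIdx N k r i = id := by
    funext s
    rcases s with (s | s) | (s | s)
    · rfl
    · rfl
    · exact evYIdx_yI_of_lt (by omega)
    · rfl
  rw [evY, this, MvPolynomial.rename_id_apply]

theorem evY_rename {i : ℕ} (σ : Equiv.Perm (Idx N k r))
    (h : ∀ s, evYIdx N k r i (σ s) = σ (evYIdx N k r i s)) (f : Poly N k r) :
    evY N k r i (MvPolynomial.rename σ f) = MvPolynomial.rename σ (evY N k r i f) := by
  rw [evY, MvPolynomial.rename_rename, MvPolynomial.rename_rename]
  congr 2
  funext s
  exact h s

theorem evY_sOp {i l : ℕ} (h : l + 1 < i) (f : Poly N k r) :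
    evY N k r i (sOp N k r l f) = sOp N k r l (evY N k r i f) := by
  unfold sOp
  split_ifs with hl
  · refine evY_rename _ (fun s => ?_) f
    rcases s with (s | s) | (s | s)
    · change evYIdx N k r i (Equiv.swap _ _ (xI N k s)) = Equiv.swap _ _ (xI N k s)
      rw [xI_injective.swap_apply]
      rfl
    · rw [Equiv.swap_apply_of_ne_of_ne (by simp [xI]) (by simp [xI])]
      exact (Equiv.swap_apply_of_ne_of_ne (by simp [xI, evYIdx]) (by simp [xI, evYIdx])).symm
    · change evYIdx N k r i (Equiv.swap _ _ (yI N k s)) =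
        Equiv.swap _ _ (evYIdx N k r i (yI N k s))
      rw [swap_xI_yI]
      rcases Nat.lt_or_ge (s : ℕ) i with hs | hs
      · rw [Equiv.Perm.one_apply, evYIdx_yI_of_lt hs, swap_xI_yI]; rfl
      · rw [Equiv.Perm.one_apply, evYIdx_yI_of_le hs, swap_xI_apply] <;> simp <;> omega
    · rw [Equiv.swap_apply_of_ne_of_ne (by simp [xI]) (by simp [xI])]
      exact (Equiv.swap_apply_of_ne_of_ne (by simp [xI, evYIdx]) (by simp [xI, evYIdx])).symm
  · rfl

variable (N k) in
/-- The product of the differences `y_j - x_m` over `j ≤ i`. -/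
noncomputable def yProd (i m : Fin r) : Poly N k r :=
  ∏ j ∈ Finset.Iic i, (MvPolynomial.X (yI N k j) - MvPolynomial.X (xI N k m))

theorem yProd_ne_zero (i m : Fin r) : yProd N k i m ≠ 0 :=
  Finset.prod_ne_zero_iff.2 fun _ _ => X_sub_X_ne_zero (xI_ne_yI _ _).symm

/-- The generating function of the elementary symmetric polynomials of Y, evaluated at -x_i. -/
theorem Qpoly_eq {i : Fin r} (h : ¬ (i : ℕ) + 1 < r) : Qpoly N k i = yProd N k i i := by
  have h1 := congrArg (Polynomial.eval₂ (MvPolynomial.rename (yI N k)).toRingHom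
    (-MvPolynomial.X (xI N k i) : Poly N k r)) (MvPolynomial.prod_C_add_X_eq_sum_esymm ℤ (Fin r))
  simp only [Polynomial.eval₂_finsetProd, Polynomial.eval₂_add, Polynomial.eval₂_X,
    Polynomial.eval₂_C, Polynomial.eval₂_finsetSum, Polynomial.eval₂_mul, Polynomial.eval₂_pow,
    Fintype.card_fin] at h1
  have e : Finset.Iic i = Finset.univ := by
    ext j
    simp only [Finset.mem_Iic, Finset.mem_univ, iff_true, Fin.le_def]
    omega
  rw [yProd, e, Qpoly, ← Finset.sum_range_reflect]
  trans ∑ j ∈ Finset.range (r + 1), esymmY N k r j * (-MvPolynomial.X (xI N k i)) ^ (r - j)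
  · refine Finset.sum_congr rfl fun j hj => ?_
    have hj' : j ≤ r := Nat.lt_succ_iff.1 (Finset.mem_range.1 hj)
    rw [show r + 1 - 1 - j = r - j by omega, show r - (r - j) = j by omega,
      neg_pow (MvPolynomial.X (xI N k i) : Poly N k r)]
    ring
  · refine h1.symm.trans ?_
    refine Finset.prod_congr rfl fun j _ => ?_
    change -_ + MvPolynomial.rename _ _ = _
    rw [MvPolynomial.rename_X]
    ring

theorem evY_yProd {i j : Fin r} (h : (j : ℕ) = i + 1) (m : Fin r) :
    evY N k r j (yProd N k j m) =
      yProd N k i m * (MvPolynomial.X (xI N k j) - MvPolynomial.X (xI N k m)) := by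
  have e : Finset.Iic j = insert j (Finset.Iic i) := by
    ext a
    simp only [Finset.mem_Iic, Finset.mem_insert, Fin.le_def, Fin.ext_iff]
    omega
  have hj : j ∉ Finset.Iic i := by simp [Fin.lt_def, h]
  rw [yProd, e, Finset.prod_insert hj, map_mul, mul_comm, map_prod]
  congr 1
  · refine Finset.prod_congr rfl fun a ha => ?_
    have : (a : ℕ) ≤ i := Fin.le_def.1 (Finset.mem_Iic.1 ha)
    rw [map_sub, evY_X, evY_X, evYIdx_yI_of_lt (by omega), evYIdx_xI]
  · rw [map_sub, evY_X, evY_X, evYIdx_yI_of_le le_rfl, evYIdx_xI]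

theorem evY_yProd_self {i : ℕ} {j : Fin r} (h : i ≤ j) : evY N k r i (yProd N k j j) = 0 := by
  rw [yProd, map_prod]
  refine Finset.prod_eq_zero (Finset.mem_Iic.2 le_rfl) ?_
  rw [map_sub, evY_X, evY_X, evYIdx_yI_of_le h, evYIdx_xI, sub_self]

/-- With zeros after `i`, the edge map is ∂_i D s_i. After the substitution, D s_i f vanishes and
its swap acquires the factor x_{i+1} - x_i, which cancels the denominator of ∂_i. What remains is
multiplication. -/
theorem evY_edgeMap {w : Fin r → Bool} (i : Fin r) (hw : ∀ j, i < j → w j = false)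
    (f : Poly N k r) :
    evY N k r (i + 1) (edgeMap N k w i f) = yProd N k i i * evY N k r (i + 1) f := by
  induction i using fin_down_induction generalizing f with
  | last i hi =>
    rw [edgeMap_last hi, LinearMap.mulLeft_apply, evY_of_le (by omega), evY_of_le (by omega),
      Qpoly_eq hi]
  | step i hi ih =>
    obtain ⟨j, hj⟩ : ∃ j : Fin r, j = ⟨i + 1, hi⟩ := ⟨_, rfl⟩
    have hj' : (j : ℕ) = i + 1 := by rw [hj]
    rw [← hj] at ih
    have hij : i < j := Fin.lt_def.2 (by omega)
    have ih := fun f => ih (fun a ha => hw a (hij.trans ha)) f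
    rw [edgeMap_cons_false (l := i) rfl hj' (hw j hij), Module.End.mul_apply,
      Module.End.mul_apply]
    set h := edgeMap N k w j (sOp N k r i f) with hh
    have eh := ih (sOp N k r i f)
    rw [← hh] at eh
    have hE : ∀ p : Poly N k r, evY N k r (i + 1) p = evY N k r (i + 1) (evY N k r (j + 1) p) :=
      fun p => (evY_evY (by omega) p).symm
    have hs : ∀ p : Poly N k r, sOp N k r i p =
        MvPolynomial.rename (Equiv.swap (xI N k i) (xI N k j)) p := fun p => by
      subst hj
      rw [sOp, dif_pos hi]
      rfl
    have hd : (MvPolynomial.X (xI N k i) - MvPolynomial.X (xI N k j)) * dOp N k r i h =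
        h - sOp N k r i h := by
      subst hj
      rw [hs, dOp, dif_pos hi]
      exact divDiff_spec _ _ _ h
    -- By induction the value contains the factor y_{i+1} - x_{i+1}, and the substitution now
    -- reaches y_{i+1}.
    have h0 : evY N k r (i + 1) h = 0 := by
      rw [hE, eh, map_mul, evY_yProd_self (by omega), zero_mul]
    have hsy : sOp N k r i (yProd N k j j) = yProd N k j i := by
      rw [hs, yProd, yProd, map_prod]
      refine Finset.prod_congr rfl fun a _ => ?_
      rw [map_sub, MvPolynomial.rename_X, MvPolynomial.rename_X, Equiv.swap_apply_right,
        swap_xI_yI]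
      rfl
    -- The swap commutes with the substitution from `j + 1` on but not with the one from `j` on, so
    -- the former is applied first. Swapping replaces x_j by x_i in the product, and then y_j ↦ x_j
    -- yields x_j - x_i.
    have h1 : evY N k r (i + 1) (sOp N k r i h) = yProd N k i i *
        (MvPolynomial.X (xI N k j) - MvPolynomial.X (xI N k i)) * evY N k r (i + 1) f := by
      rw [hE, evY_sOp (by omega), eh, hs, map_mul, ← hs, ← hs, hsy, ← evY_sOp (by omega), sOp_sOp,
        map_mul, ← hE, ← hj', evY_yProd hj']
    have h2 := congrArg (evY N k r (i + 1)) hd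
    rw [map_mul, map_sub, map_sub, h0, h1, evY_X, evY_X, evYIdx_xI, evYIdx_xI] at h2
    apply mul_left_cancel₀ (X_sub_X_ne_zero (xI_ne (N := N) (k := k) (a := i) (b := j) (by omega)))
    rw [h2]
    ring

/-! ### Lifting along the evaluations -/

variable (N k r) in
/-- The colouring in which only the variables `y_j` with `j < i`, the variables `Z` and the variables
`W` are identified. -/
def colY (i : ℕ) : Idx N k r → (Fin r ⊕ Option (Fin r)) ⊕ Bool
  | Sum.inl (Sum.inl j) => Sum.inl (Sum.inl j)
  | Sum.inl (Sum.inr _) => Sum.inr true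
  | Sum.inr (Sum.inl j) => Sum.inl (Sum.inr (if (j : ℕ) < i then none else some j))
  | Sum.inr (Sum.inr _) => Sum.inr false

theorem colY_yI (i : ℕ) (j : Fin r) :
    colY N k r i (yI N k j) = Sum.inl (Sum.inr (if (j : ℕ) < i then none else some j)) := rfl

theorem colY_eq_xI {i : ℕ} {j : Fin r} {s : Idx N k r} (h : colY N k r i s = Sum.inl (Sum.inl j)) :
    s = xI N k j := by
  rcases s with (s | s) | (s | s) <;> simp [colY] at h
  rw [h]; rfl

theorem X_xI_mem_colY (i : ℕ) (j : Fin r) :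
    (MvPolynomial.X (xI N k j) : Poly N k r) ∈ colorInv (colY N k r i) := by
  refine mem_colorInv.2 fun σ hσ => ?_
  rw [MvPolynomial.rename_X, colY_eq_xI (hσ (xI N k j))]

/-- Losing symmetry in y_j for j ≥ i does not enlarge the image of the substitution: expand in
powers of y_i with more symmetric coefficients and replace y_i by x_i, which has the same image. -/
theorem exists_lift_evY {i : ℕ} (hi : i ≤ r) {g : Poly N k r} (hg : g ∈ colorInv (colY N k r i)) :
    ∃ f ∈ coeffRing N k r, evY N k r i f = evY N k r i g := by
  induction hi using Nat.decreasingInduction generalizing g with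
  | self =>
    refine ⟨g, colorInv_mono (fun a b h => ?_) hg, rfl⟩
    rcases a with (a | a) | (a | a) <;> rcases b with (b | b) | (b | b) <;>
      simp [coeffColor] at h <;> simp [colY, h]
  | of_succ i hi ih =>
    have hg' : g ∈ colorInv (splitOff (colY N k r (i + 1)) (yI N k ⟨i, hi⟩)) := by
      refine colorInv_mono (fun a b h => ?_) hg
      obtain ⟨h1, h2⟩ := Prod.ext_iff.1 h
      simp only [splitOff, decide_eq_decide] at h1 h2
      rcases a with (a | a) | (a | a) <;> rcases b with (b | b) | (b | b) <;>
        simp [colY, yI, Fin.ext_iff] at h1 h2 ⊢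
      · exact h1
      · have e : (a : ℕ) = b ∨ ((a : ℕ) < i ∧ (b : ℕ) < i) := by
          split_ifs at h1 <;> simp [Fin.ext_iff] at h1 <;> omega
        rcases e with e | ⟨e1, e2⟩
        · rw [show a = b from Fin.ext e]
        · rw [if_pos e1, if_pos e2]
    obtain ⟨G, hG, e⟩ := splitOff_expansion_exists hg'
    obtain ⟨f, hf, ef⟩ := ih (g := ∑ l ∈ Finset.range (classCard (colY N k r (i + 1))
      (yI N k ⟨i, hi⟩)), G l * MvPolynomial.X (xI N k ⟨i, hi⟩) ^ l)
      (sum_mem fun l _ => mul_mem (hG l) (pow_mem (X_xI_mem_colY _ _) _))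
    refine ⟨f, hf, ?_⟩
    rw [← evY_evY (Nat.le_succ i), ef, evY_evY (Nat.le_succ i), e, map_sum, map_sum]
    refine Finset.sum_congr rfl fun l _ => ?_
    rw [map_mul, map_mul, map_pow, map_pow, evY_X, evY_X, evYIdx_xI,
      evYIdx_yI_of_le (j := ⟨i, hi⟩) le_rfl]

theorem evYIdx_swap {i : ℕ} {s t : Idx N k r} (hst : s ≠ t)
    (h : colY N k r i s = colY N k r i t) (u : Idx N k r) :
    evYIdx N k r i (Equiv.swap s t u) = Equiv.swap s t (evYIdx N k r i u) := by
  have fix : ∀ {s t : Idx N k r}, s ≠ t → colY N k r i s = colY N k r i t →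
      ∀ u, evYIdx N k r i u = s ↔ u = s := by
    intro s t hst h u
    rcases s with (s | s) | (s | s)
    · exact absurd (colY_eq_xI h.symm).symm hst
    · rcases u with (u | u) | (u | u) <;> simp [evYIdx]
      split_ifs <;> simp [xI, yI]
    · have hs : (s : ℕ) < i := by
        by_contra hs
        rcases t with (t | t) | (t | t) <;> simp [colY] at h
        rw [if_neg hs] at h
        split_ifs at h
        exact hst (by rw [Option.some.inj h])
      rcases u with (u | u) | (u | u) <;> simp [evYIdx]
      split_ifs with hu
      · simp only [xI, reduceCtorEq, false_iff]
        rintro rfl; omega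
      · simp [yI]
    · rcases u with (u | u) | (u | u) <;> simp [evYIdx]
      split_ifs <;> simp [xI, yI]
  have h1 := fix hst h
  have h2 := fix hst.symm h.symm
  rcases eq_or_ne u s with rfl | hus
  · rw [Equiv.swap_apply_left, (h1 u).2 rfl, Equiv.swap_apply_left, (h2 t).2 rfl]
  rcases eq_or_ne u t with rfl | hut
  · rw [Equiv.swap_apply_right, (h2 u).2 rfl, Equiv.swap_apply_right, (h1 s).2 rfl]
  rw [Equiv.swap_apply_of_ne_of_ne hus hut,
    Equiv.swap_apply_of_ne_of_ne (fun e => hus ((h1 u).1 e)) fun e => hut ((h2 u).1 e)]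

theorem evY_mem_colorInv {i : ℕ} {f : Poly N k r} (hf : f ∈ colorInv (colY N k r i)) :
    evY N k r i f ∈ colorInv (colY N k r i) :=
  mem_colorInv_iff_swap.2 fun s t hst h => by
    rw [← evY_rename _ (evYIdx_swap hst h), mem_colorInv_iff_swap.1 hf s t hst h]

theorem coeffRing_le_colY (i : ℕ) : coeffRing N k r ≤ colorInv (colY N k r i) :=
  colorInv_mono fun a b h => by
    rcases a with (a | a) | (a | a) <;> rcases b with (b | b) | (b | b) <;>
      simp [colY] at h <;> simp [coeffColor, h]

theorem yProd_eq (i : Fin r) : yProd N k i i =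
    ∏ s with colY N k r (i + 1) s = Sum.inl (Sum.inr none),
      (MvPolynomial.X s - MvPolynomial.X (xI N k i)) := by
  rw [yProd]
  refine Finset.prod_bij (fun j _ => yI N k j) (fun j hj => ?_) (fun _ _ _ _ e => yI_injective e)
    (fun s hs => ?_) fun _ _ => rfl
  · have := Fin.le_def.1 (Finset.mem_Iic.1 hj)
    rw [Finset.mem_filter, colY_yI, if_pos (by omega)]
    exact ⟨Finset.mem_univ _, rfl⟩
  · rcases s with (s | s) | (s | s) <;> simp [colY] at hs
    exact ⟨s, Finset.mem_Iic.2 (Fin.le_def.2 (by omega)), rfl⟩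

theorem yProd_mem (i : Fin r) : yProd N k i i ∈ colorInv (colY N k r (i + 1)) := by
  refine mem_colorInv.2 fun σ hσ => ?_
  rw [yProd_eq, map_prod]
  refine Finset.prod_equiv σ (fun s => by simp [hσ]) fun s _ => ?_
  rw [map_sub, MvPolynomial.rename_X, MvPolynomial.rename_X, colY_eq_xI (hσ (xI N k i))]

theorem evY_yProd_succ (i : Fin r) : evY N k r (i + 1) (yProd N k i i) = yProd N k i i := by
  rw [yProd, map_prod]
  refine Finset.prod_congr rfl fun a ha => ?_
  have : (a : ℕ) ≤ i := Fin.le_def.1 (Finset.mem_Iic.1 ha)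
  rw [map_sub, evY_X, evY_X, evYIdx_yI_of_lt (by omega), evYIdx_xI]

/-- The kernel of the next evaluation is generated by `yProd`. -/
theorem exists_of_evY_eq_zero (i : Fin r) {f : Poly N k r} (hf : f ∈ coeffRing N k r)
    (h0 : evY N k r i f = 0) :
    ∃ g ∈ coeffRing N k r, evY N k r (i + 1) f = yProd N k i i * evY N k r (i + 1) g := by
  obtain ⟨h, hh⟩ : ∃ h, h = evY N k r (i + 1) f := ⟨_, rfl⟩
  have hm : h ∈ colorInv (colY N k r (i + 1)) := hh ▸ evY_mem_colorInv (coeffRing_le_colY _ hf)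
  -- The two substitutions differ exactly by y_i ↦ x_i, which therefore sends `h` to 0.
  have hdiv : (MvPolynomial.X (xI N k i) - MvPolynomial.X (yI N k i)) ∣ h := by
    rw [← neg_sub, neg_dvd, X_sub_X_dvd_iff, ← h0, hh]
    rw [subst, evY, evY, MvPolynomial.rename_rename]
    congr 2
    funext s
    rcases s with (s | s) | (s | s)
    · exact Function.update_of_ne (xI_ne_yI _ _) _ _
    · exact Function.update_of_ne (by simp [yI, evYIdx]) _ _
    · change Function.update id _ _ (evYIdx N k r (i + 1) (yI N k s)) = evYIdx N k r i (yI N k s)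
      rcases Nat.lt_trichotomy s i with h | h | h
      · rw [evYIdx_yI_of_lt (by omega), evYIdx_yI_of_lt (by omega)]
        exact Function.update_of_ne (fun e => h.ne (congrArg Fin.val (yI_injective e))) _ _
      · obtain rfl : s = i := Fin.ext h
        rw [evYIdx_yI_of_lt (by omega), evYIdx_yI_of_le le_rfl]
        exact Function.update_self _ _ _
      · rw [evYIdx_yI_of_le (by omega), evYIdx_yI_of_le (by omega)]
        exact Function.update_of_ne (xI_ne_yI _ _) _ _
    · exact Function.update_of_ne (by simp [yI, evYIdx]) _ _
  -- Symmetry of `h` in the y_j with j ≤ i spreads one linear factor to all of them.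
  have hprod : yProd N k i i ∣ h := by
    have h1 := prod_X_sub_X_dvd (Finset.Iic i) (xI N k i) (yI N k) h
      (fun j _ => xI_ne_yI _ _) (fun a _ b _ e => yI_injective e) (fun j hj => ?_)
    · rw [yProd]
      simp only [← neg_sub (MvPolynomial.X (xI N k i))]
      rw [Finset.prod_neg]
      exact (IsUnit.mul_left_dvd (IsUnit.pow _ isUnit_one.neg)).2 h1
    · rcases eq_or_ne j i with rfl | hji
      · exact hdiv
      have hj' := Fin.le_def.1 (Finset.mem_Iic.1 hj)
      have h2 := map_dvd (MvPolynomial.rename (Equiv.swap (yI N k i) (yI N k j))) hdiv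
      rwa [mem_colorInv_iff_swap.1 hm (yI N k i) (yI N k j) (fun e => hji (yI_injective e).symm)
        (by rw [colY_yI, colY_yI, if_pos (by omega), if_pos (by omega)]), map_sub,
        MvPolynomial.rename_X, MvPolynomial.rename_X, Equiv.swap_apply_left,
        Equiv.swap_apply_of_ne_of_ne (xI_ne_yI _ _) (xI_ne_yI _ _)] at h2
  obtain ⟨q, hq⟩ := hprod
  have hqm : q ∈ colorInv (colY N k r (i + 1)) := mem_colorInv.2 fun σ hσ => by
    apply mul_left_cancel₀ (yProd_ne_zero (N := N) (k := k) i i)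
    have e := mem_colorInv.1 hm σ hσ
    rw [hq, map_mul, mem_colorInv.1 (yProd_mem i) σ hσ] at e
    exact e
  obtain ⟨g, hg, eg⟩ := exists_lift_evY (Nat.succ_le_of_lt i.2) hqm
  refine ⟨g, hg, ?_⟩
  rw [← evY_evY le_rfl, ← hh, hq, map_mul, evY_yProd_succ]
  exact congrArg _ eg.symm

end Evaluation

/-! ### The full cube as an iterated mapping cone -/

section CubeExact

variable {N k r : ℕ}

/-- The chains supported on the vertices whose first `i` entries are `0`. -/
def IsSupp (i : ℕ) (c : Cube N k r) : Prop :=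
  ∀ v (j : Fin r), (j : ℕ) < i → v j = true → c v = 0

theorem IsSupp.differential {i : ℕ} {c : Cube N k r} (hc : IsSupp i c) :
    IsSupp i (differential N k r c) := by
  intro v j hj hv
  rw [differential_apply]
  refine Finset.sum_eq_zero fun a _ => ?_
  split_ifs with ha
  · rfl
  · rw [hc _ j hj (by rw [Function.update_of_ne (by rintro rfl; exact ha hv), hv]), map_zero]

theorem IsSupp.sub {i : ℕ} {c c' : Cube N k r} (hc : IsSupp i c) (hc' : IsSupp i c') :
    IsSupp i (c - c') := fun v j hj hv => by
  rw [Pi.sub_apply, hc v j hj hv, hc' v j hj hv, sub_zero]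

theorem IsSupp.add {i : ℕ} {c c' : Cube N k r} (hc : IsSupp i c) (hc' : IsSupp i c') :
    IsSupp i (c + c') := fun v j hj hv => by
  rw [Pi.add_apply, hc v j hj hv, hc' v j hj hv, add_zero]

theorem IsSupp.mono {i j : ℕ} (h : i ≤ j) {c : Cube N k r} (hc : IsSupp j c) : IsSupp i c :=
  fun v a ha => hc v a (ha.trans_le h)

/-- The contraction of a chain along the `i`-th direction of the cube. -/
noncomputable def lower (i : Fin r) (c : Cube N k r) : Cube N k r :=
  fun v => if v i then 0 else c (Function.update v i true)

/-- The translation of a chain along the `i`-th direction of the cube. -/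
noncomputable def raise (i : Fin r) (c : Cube N k r) : Cube N k r :=
  fun v => if v i then c (Function.update v i false) else 0

theorem lower_apply {i : Fin r} {v : Fin r → Bool} (c : Cube N k r) (h : v i = false) :
    lower i c v = c (Function.update v i true) := by simp [lower, h]

theorem lower_apply_true {i : Fin r} {v : Fin r → Bool} (c : Cube N k r) (h : v i = true) :
    lower i c v = 0 := by simp [lower, h]

theorem IsSupp.lower {i : Fin r} {c : Cube N k r} (hc : IsSupp i c) :
    IsSupp (i + 1) (lower i c) := by
  intro v j hj hv
  rcases eq_or_ne j i with rfl | hji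
  · exact lower_apply_true c hv
  · unfold FlagResolution.lower
    split_ifs
    · rfl
    · exact hc _ j (by have := fun e => hji (Fin.ext e); omega) (by
        rw [Function.update_of_ne hji, hv])

theorem IsSupp.raise {i : Fin r} {c : Cube N k r} (hc : IsSupp (i + 1) c) :
    IsSupp i (raise i c) := by
  intro v j hj hv
  unfold FlagResolution.raise
  split_ifs
  · exact hc _ j (by omega) (by
      rw [Function.update_of_ne (by rintro rfl; exact lt_irrefl _ hj), hv])
  · rfl

theorem lower_raise {i : Fin r} {c : Cube N k r} (hc : IsSupp (i + 1) c) :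
    lower i (raise i c) = c := by
  funext v
  rcases hv : v i with _ | _
  · rw [lower_apply _ hv, raise, if_pos (Function.update_self _ _ _), Function.update_idem,
      ← hv, Function.update_eq_self]
  · rw [lower_apply_true _ hv, hc v i (Nat.lt_succ_self _) hv]

theorem lower_mem {i : Fin r} {n : ℕ} {c : Cube N k r} (hc : c ∈ chains N k r (n + 1)) :
    lower i c ∈ chains N k r n := by
  intro v
  unfold lower
  split_ifs with h
  · exact ⟨zero_mem _, fun _ => rfl⟩
  · exact ⟨(hc _).1, fun hv => (hc _).2 (by rw [numOnes_update (by simpa using h)]; omega)⟩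

theorem raise_mem {i : Fin r} {n : ℕ} {c : Cube N k r} (hc : c ∈ chains N k r n) :
    raise i c ∈ chains N k r (n + 1) := by
  intro v
  unfold raise
  split_ifs with h
  · refine ⟨(hc _).1, fun hv => (hc _).2 fun e => hv ?_⟩
    rw [← e, ← numOnes_update (v := Function.update v i false) (i := i)
      (Function.update_self _ _ _), Function.update_idem, ← h, Function.update_eq_self]
  · exact ⟨zero_mem _, fun _ => rfl⟩

theorem lower_sub (i : Fin r) (c c' : Cube N k r) : lower i (c - c') = lower i c - lower i c' := by
  funext v
  simp only [lower, Pi.sub_apply]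
  split_ifs <;> simp

/-- Edge maps in directions after `i` do not read the `i`-th entry, and earlier directions
contribute nothing by the support condition. So the face with `i`-th entry 1 carries the same
differential, without a sign. -/
theorem lower_differential {i : Fin r} {c : Cube N k r} (hc : IsSupp i c) :
    lower i (differential N k r c) = differential N k r (lower i c) := by
  funext w
  rcases hw : w i with _ | _
  · rw [lower_apply _ hw, differential_apply, differential_apply]
    refine Finset.sum_congr rfl fun j _ => ?_
    rcases eq_or_ne j i with rfl | hji
    · rw [Function.update_self, if_pos rfl, hw, lower_apply_true _ (Function.update_self _ _ _),
        map_zero]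
      rfl
    rw [Function.update_of_ne hji, lower_apply _ (by rw [Function.update_of_ne hji.symm, hw]),
      Function.update_comm hji.symm]
    split_ifs
    · rfl
    rcases lt_or_gt_of_ne hji with h | h
    · rw [hc _ j (Fin.lt_def.1 h) (by rw [Function.update_of_ne hji, Function.update_self]),
        map_zero, map_zero]
    · rw [edgeMap_congr j fun l hl => ?_]
      exact Function.update_of_ne (h.trans hl).ne' _ _
  · rw [lower_apply_true _ hw, hc.lower.differential w i (Nat.lt_succ_self _) hw]

theorem isSupp_succ_of_lower_eq_zero {i : Fin r} {c : Cube N k r} (hc : IsSupp i c)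
    (h : lower i c = 0) : IsSupp (i + 1) c := by
  intro v j hj hv
  rcases eq_or_ne j i with rfl | hji
  · have := congrFun h (Function.update v j false)
    rwa [lower_apply _ (Function.update_self _ _ _), Function.update_idem, ← hv,
      Function.update_eq_self] at this
  · exact hc v j (by have := fun e => hji (Fin.ext e); omega) hv

theorem numOnes_zero : numOnes (fun _ : Fin r => false) = 0 := by simp [numOnes]

theorem chains_zero_apply {n : ℕ} {c : Cube N k r} (hc : c ∈ chains N k r (n + 1)) :
    c (fun _ => false) = 0 :=
  (hc _).2 (by rw [numOnes_zero]; omega)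

/-- The component at the zero vertex of the differential, after evaluating. -/
theorem evY_differential (i : ℕ) {c : Cube N k r} (hc : IsSupp i c) :
    evY N k r i (differential N k r c fun _ => false) = 0 := by
  rw [differential_apply, map_sum]
  refine Finset.sum_eq_zero fun j _ => ?_
  rw [if_neg (by simp)]
  rcases lt_or_ge (j : ℕ) i with h | h
  · rw [hc _ j h (Function.update_self _ _ _), map_zero, map_zero]
  · rw [← evY_evY (show i ≤ j + 1 by omega), evY_edgeMap j fun _ _ => rfl, map_mul,
      evY_yProd_self h, zero_mul]

/-- Directions after `i` carry a factor y_j - x_j that the substitution kills; earlier ones are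
excluded by the support. -/
theorem evY_differential_succ (i : Fin r) {c : Cube N k r} (hc : IsSupp i c) :
    evY N k r (i + 1) (differential N k r c fun _ => false) =
      yProd N k i i * evY N k r (i + 1) (c (Function.update (fun _ => false) i true)) := by
  rw [differential_apply, map_sum, Finset.sum_eq_single i]
  · rw [if_neg (by simp), evY_edgeMap i fun _ _ => rfl]
  · intro j _ hji
    rw [if_neg (by simp)]
    rcases lt_or_gt_of_ne hji with h | h
    · rw [hc _ j h (Function.update_self _ _ _), map_zero, map_zero]
    · rw [← evY_evY (show (i : ℕ) + 1 ≤ j + 1 by have := Fin.lt_def.1 h; omega),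
        evY_edgeMap j fun _ _ => rfl, map_mul, evY_yProd_self (Fin.lt_def.1 h), zero_mul]
  · simp

/-- The long exact sequence of the cone in direction `i`, written with elements. On degree 0
homology the connecting map is multiplication by `yProd`: injectivity removes higher homology, and
its cokernel is the image of the next substitution. -/
theorem exists_differential_eq {i : ℕ} (hi : i ≤ r) {n : ℕ} {b : Cube N k r}
    (hb : b ∈ chains N k r n) (hs : IsSupp i b) (hd : differential N k r b = 0)
    (h0 : evY N k r i (b fun _ => false) = 0) :
    ∃ c ∈ chains N k r (n + 1), IsSupp i c ∧ differential N k r c = b := by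
  induction hi using Nat.decreasingInduction generalizing n b with
  | self =>
    refine ⟨0, zero_mem _, fun _ _ _ _ => rfl, ?_⟩
    rw [map_zero]
    funext v
    by_cases hv : ∃ j, v j = true
    · obtain ⟨j, hj⟩ := hv
      exact (hs v j j.2 hj).symm
    · obtain rfl : v = fun _ => false := by
        funext j
        simpa using fun h => hv ⟨j, h⟩
      rw [evY_of_le le_rfl] at h0
      exact h0.symm
  | of_succ i hi ih =>
    obtain ⟨i, rfl⟩ : ∃ j : Fin r, (j : ℕ) = i := ⟨⟨i, hi⟩, rfl⟩
    -- it suffices to modify `b` by a boundary so that the induction hypothesis applies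
    suffices ∃ c ∈ chains N k r (n + 1), IsSupp i c ∧ IsSupp (i + 1) (b - differential N k r c) ∧
        evY N k r (i + 1) ((b - differential N k r c) fun _ => false) = 0 by
      obtain ⟨c, hc, hcs, hbs, hb0⟩ := this
      obtain ⟨c', hc', hcs', e⟩ := ih (sub_mem hb (differential_mem hc)) hbs
        (by rw [map_sub, hd, differential_differential, sub_zero]) hb0
      exact ⟨c' + c, add_mem hc' hc, (hcs'.mono (Nat.le_succ _)).add hcs, by
        rw [map_add, e, sub_add_cancel]⟩
    rcases n with _ | m
    -- Degree 0 uses the cokernel: `g`, placed at the vertex with the single entry `i` equal to 1,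
    -- has a boundary that agrees with `b` after the finer substitution.
    · obtain ⟨g, hg, e⟩ := exists_of_evY_eq_zero i (hb _).1 h0
      have hgs : IsSupp (i + 1) (Pi.single (fun _ => false) g : Cube N k r) := by
        intro v j _ hv
        refine Pi.single_eq_of_ne (fun h => ?_) _
        rw [h] at hv
        exact absurd hv (by simp)
      have hgc : (Pi.single (fun _ => false) g : Cube N k r) ∈ chains N k r 0 := by
        intro v
        rcases eq_or_ne v fun _ => false with rfl | hv
        · rw [Pi.single_eq_same]
          exact ⟨hg, fun h => absurd numOnes_zero h⟩
        · rw [Pi.single_eq_of_ne hv]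
          exact ⟨zero_mem _, fun _ => rfl⟩
      have hc := raise_mem (i := i) hgc
      refine ⟨_, hc, hgs.raise, ?_, ?_⟩
      · intro v j _ hv
        refine (sub_mem hb (differential_mem hc) v).2 fun h => ?_
        have := Finset.card_eq_zero.1 h
        rw [Finset.filter_eq_empty_iff] at this
        exact this (Finset.mem_univ j) hv
      · rw [Pi.sub_apply, map_sub, evY_differential_succ i hgs.raise, e, raise,
          if_pos (Function.update_self _ _ _), Function.update_idem]
        have : Function.update (fun _ : Fin r => false) i false = fun _ => false :=
          Function.update_eq_self_iff.2 rfl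
        rw [this, Pi.single_eq_same, sub_self]
    -- Positive degree uses injectivity: the cycle condition at the zero vertex says that a nonzero
    -- product times this value vanishes.
    · have hl0 : evY N k r (i + 1) (lower i b fun _ => false) = 0 := by
        have h1 := evY_differential_succ i hs
        rw [hd, Pi.zero_apply, map_zero] at h1
        rw [lower_apply _ rfl]
        exact (mul_eq_zero.1 h1.symm).resolve_left (yProd_ne_zero _ _)
      obtain ⟨γ, hγ, hγs, e⟩ := ih (lower_mem (i := i) hb) hs.lower
        (by rw [← lower_differential hs, hd]; funext v; simp [lower]) hl0
      have hc := raise_mem (i := i) hγ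
      refine ⟨_, hc, hγs.raise, isSupp_succ_of_lower_eq_zero (hs.sub hγs.raise.differential) ?_, ?_⟩
      · rw [lower_sub, lower_differential hγs.raise, lower_raise hγs, e, sub_self]
      · rw [chains_zero_apply (sub_mem hb (differential_mem hc)), map_zero]

/-- Exactness of the complex, with the kernel of the evaluation `y_j ↦ x_j` in degree zero. -/
theorem exactAt_adjSet (lam : Fin r → ℕ) :
    ExactAt N k r (fun _ b => differential N k r b = 0 ∧ evY N k r 0 (b fun _ => false) = 0)
      (adjSet lam) := by
  refine ExactAt.adjSet lam (fun n c hc h => ⟨h, ?_⟩) fun n b hb hZ => ?_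
  · rw [chains_zero_apply hc, map_zero]
  · obtain ⟨c, hc, -, e⟩ := exists_differential_eq (Nat.zero_le r) hb.1
      (fun _ j hj => absurd hj (Nat.not_lt_zero _)) hZ.1 hZ.2
    exact ⟨c, ⟨hc, fun l hl => absurd hl (Set.notMem_empty _)⟩, e⟩

end CubeExact

/-! ## Freeness over the symmetric polynomials -/

section HomogBasis

variable {τ : Type} {γ : Type*}

theorem isHomogeneous_iff_degree {f : MvPolynomial τ ℤ} {n : ℕ} :
    f.IsHomogeneous n ↔ ∀ s, f.coeff s ≠ 0 → s.degree = n := by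
  unfold MvPolynomial.IsHomogeneous MvPolynomial.IsWeightedHomogeneous
  rw [show (1 : τ → ℕ) = fun _ => 1 from rfl, ← Finsupp.degree_eq_weight_one]

theorem homogeneousComponent_mul {f u : MvPolynomial τ ℤ} {e : ℕ} (hu : u.IsHomogeneous e) (n : ℕ) :
    MvPolynomial.homogeneousComponent n (f * u) =
      if e ≤ n then MvPolynomial.homogeneousComponent (n - e) f * u else 0 := by
  conv_lhs => rw [← MvPolynomial.sum_homogeneousComponent f, Finset.sum_mul, map_sum]
  have h : ∀ m, MvPolynomial.homogeneousComponent n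
      (MvPolynomial.homogeneousComponent m f * u) =
      if m + e = n then MvPolynomial.homogeneousComponent m f * u else 0 := fun m => by
    rw [MvPolynomial.homogeneousComponent_of_mem
      ((MvPolynomial.homogeneousComponent_isHomogeneous m f).mul hu)]
    simp only [eq_comm]
  simp only [h]
  split_ifs with hen
  · rw [Finset.sum_congr rfl fun m _ => if_congr (show m + e = n ↔ m = n - e by omega) rfl rfl,
      Finset.sum_ite_eq']
    split_ifs with hm
    · rfl
    · rw [MvPolynomial.homogeneousComponent_eq_zero _ _ (by simp at hm; omega), zero_mul]
  · exact Finset.sum_eq_zero fun m _ => if_neg (by omega)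

theorem homogeneousComponent_mem_colorInv {κ : τ → γ} {f : MvPolynomial τ ℤ}
    (hf : f ∈ colorInv κ) (n : ℕ) : MvPolynomial.homogeneousComponent n f ∈ colorInv κ :=
  mem_colorInv.2 fun σ hσ => by
    rw [MvPolynomial.rename_homogeneousComponent, mem_colorInv.1 hf σ hσ]

/-- A homogeneous basis, containing `1`, of the polynomial ring over the subring `colorInv κ`. -/
structure HomogBasis (κ : τ → γ) where
  ι : Type
  fin : Fintype ι
  u : ι → MvPolynomial τ ℤ
  deg : ι → ℕ
  homog : ∀ i, (u i).IsHomogeneous (deg i)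
  one : ι
  u_one : u one = 1
  repr : MvPolynomial τ ℤ → ι → MvPolynomial τ ℤ
  repr_mem : ∀ f i, repr f i ∈ colorInv κ
  sum_repr : ∀ f, ∑ i, repr f i * u i = f
  unique : ∀ g : ι → MvPolynomial τ ℤ, (∀ i, g i ∈ colorInv κ) → ∑ i, g i * u i = 0 → ∀ i, g i = 0

attribute [instance] HomogBasis.fin

variable [Fintype τ] [DecidableEq τ]

theorem HomogBasis.of_injective {κ : τ → γ} (h : Function.Injective κ) :
    Nonempty (HomogBasis κ) :=
  ⟨{ ι := Unit
     fin := inferInstance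
     u := fun _ => 1
     deg := fun _ => 0
     homog := fun _ => MvPolynomial.isHomogeneous_one _ _
     one := ()
     u_one := rfl
     repr := fun f _ => f
     repr_mem := fun f _ => mem_colorInv_iff_swap.2 fun a b hab e => absurd (h e) hab
     sum_repr := fun f => by simp
     unique := fun g _ h i => by simpa using h }⟩

/-- A tower of free extensions: the basis elements are multiplied by the powers of one variable. -/
theorem HomogBasis.of_splitOff [DecidableEq γ] {κ : τ → γ} {t : τ}
    (B : HomogBasis (splitOff κ t)) : Nonempty (HomogBasis κ) := by
  choose G hG hsum using fun (f : MvPolynomial τ ℤ) (i : B.ι) =>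
    splitOff_expansion_exists (B.repr_mem f i)
  have hpos : 0 < classCard κ t := Finset.card_pos.2 ⟨t, by simp⟩
  refine ⟨{ ι := B.ι × Fin (classCard κ t)
            fin := inferInstance
            u := fun p => MvPolynomial.X t ^ (p.2 : ℕ) * B.u p.1
            deg := fun p => p.2 + B.deg p.1
            homog := fun p => (MvPolynomial.isHomogeneous_X_pow t _).mul (B.homog p.1)
            one := (B.one, ⟨0, hpos⟩)
            u_one := by simp [B.u_one]
            repr := fun f p => G f p.1 p.2
            repr_mem := fun f p => hG f p.1 p.2
            sum_repr := fun f => ?_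
            unique := fun g hg h => ?_ }⟩
  · conv_rhs => rw [← B.sum_repr f]
    rw [Fintype.sum_prod_type]
    refine Finset.sum_congr rfl fun i _ => ?_
    conv_rhs => rw [hsum f i, Finset.sum_range, Finset.sum_mul]
    exact Finset.sum_congr rfl fun l _ => by ring
  · rw [Fintype.sum_prod_type] at h
    let g' : B.ι → ℕ → MvPolynomial τ ℤ := fun i l =>
      if hl : l < classCard κ t then g (i, ⟨l, hl⟩) else 0
    have hg' : ∀ i l, g' i l ∈ colorInv κ := fun i l => by
      simp only [g']
      split_ifs
      · exact hg _
      · exact zero_mem _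
    have e : ∀ i, ∑ l : Fin (classCard κ t), g (i, l) * MvPolynomial.X t ^ (l : ℕ) =
        ∑ l ∈ Finset.range (classCard κ t), g' i l * MvPolynomial.X t ^ l := fun i => by
      rw [Finset.sum_range]
      exact Finset.sum_congr rfl fun l _ => by simp [g']
    have h1 := B.unique
      (fun i => ∑ l ∈ Finset.range (classCard κ t), g' i l * MvPolynomial.X t ^ l)
      (fun i => sum_mem fun l _ => mul_mem
        (colorInv_mono (fun a b hab => congrArg Prod.fst hab) (hg' i l))
        (pow_mem (mem_colorInv.2 fun σ hσ => by
          have := congrArg Prod.snd (hσ t)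
          simp only [splitOff, decide_true, decide_eq_true_eq] at this
          rw [MvPolynomial.rename_X, this]) _)) (by
        rw [← h]
        refine Finset.sum_congr rfl fun i _ => ?_
        rw [← e, Finset.sum_mul]
        exact Finset.sum_congr rfl fun l _ => by ring)
    rintro ⟨i, l⟩
    have h2 := splitOff_expansion_unique (κ := κ) (t := t) (g' i) (fun _ => 0) (hg' i)
      (fun _ => zero_mem _) (by rw [h1 i]; simp) l l.2
    simpa [g'] using h2

omit [Fintype τ] [DecidableEq τ] in
theorem HomogBasis.congr {γ' : Type*} {κ : τ → γ} {κ' : τ → γ'}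
    (h : ∀ a b, κ a = κ b ↔ κ' a = κ' b) (B : HomogBasis κ) : Nonempty (HomogBasis κ') := by
  have e : ∀ f, f ∈ colorInv κ ↔ f ∈ colorInv κ' := fun f =>
    ⟨fun hf => colorInv_mono (fun a b => (h a b).2) hf,
      fun hf => colorInv_mono (fun a b => (h a b).1) hf⟩
  exact ⟨{ B with
    repr_mem := fun f i => (e _).1 (B.repr_mem f i)
    unique := fun g hg => B.unique g fun i => (e _).2 (hg i) }⟩

theorem exists_homogBasis [DecidableEq γ] (κ : τ → γ) : Nonempty (HomogBasis κ) := by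
  -- Interpolates between the given coloring, for the empty set, and an injective one, for the full
  -- set.
  let κS : Finset τ → τ → γ × Option τ := fun S a => (κ a, if a ∈ S then some a else none)
  have h0 : Nonempty (HomogBasis (κS ∅)) := by
    have hu : Nonempty (HomogBasis (κS Finset.univ)) :=
      HomogBasis.of_injective fun a b h => by simpa [κS] using congrArg Prod.snd h
    revert hu
    generalize (Finset.univ : Finset τ) = S
    induction S using Finset.induction_on with
    | empty => exact id
    | insert t S ht ih =>
      rintro ⟨B⟩
      obtain ⟨B'⟩ := B.congr (κ' := splitOff (κS S) t) fun a b => by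
        by_cases hat : a = t <;> by_cases hbt : b = t <;> by_cases ha : a ∈ S <;>
          by_cases hb : b ∈ S <;> simp_all [κS, splitOff]
        exact fun _ e => hbt e.symm
      exact ih B'.of_splitOff
  obtain ⟨B⟩ := h0
  exact B.congr fun a b => by simp [κS]

end HomogBasis

/-! ### Independence detected on constant terms -/

section Nakayama

variable {τ : Type}

/-- A family of polynomials whose constant terms are linearly independent is linearly independent. -/
theorem eq_zero_of_constantCoeff {I K : Type*} [Fintype I] (b : I → K → MvPolynomial τ ℤ)
    (hb : ∀ c : I → ℤ, (∀ k, ∑ i, c i * MvPolynomial.constantCoeff (b i k) = 0) → ∀ i, c i = 0)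
    (a : I → MvPolynomial τ ℤ) (h : ∀ k, ∑ i, a i * b i k = 0) (i : I) : a i = 0 := by
  classical
  suffices ∀ n, ∀ s : τ →₀ ℕ, s.degree = n → ∀ i, (a i).coeff s = 0 from
    MvPolynomial.ext _ _ fun s => this _ s rfl i
  intro n
  induction n using Nat.strong_induction_on with
  | _ n ih =>
    intro s hs
    refine hb _ fun k => ?_
    have h1 := congrArg (MvPolynomial.coeff s) (h k)
    rw [MvPolynomial.coeff_sum, MvPolynomial.coeff_zero] at h1
    rw [← h1]
    refine Finset.sum_congr rfl fun i _ => ?_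
    -- All coefficients of `a` in lower degrees are already zero, so only constant terms of `b` meet
    -- the coefficient at `s`.
    rw [MvPolynomial.coeff_mul, Finset.sum_eq_single (s, 0)]
    · rfl
    · rintro ⟨p, q⟩ hpq hne
      rw [Finset.HasAntidiagonal.mem_antidiagonal] at hpq
      dsimp only at hpq ⊢
      have hq : q ≠ 0 := by
        rintro rfl
        exact hne (by rw [← hpq, add_zero])
      have hd : p.degree + q.degree = n := by rw [← hs, ← hpq, map_add]
      have hq' : q.degree ≠ 0 := fun e => hq ((Finsupp.degree_eq_zero_iff q).1 e)
      rw [ih p.degree (by omega) p rfl i, zero_mul]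
    · intro h
      exact absurd (by simp) h

end Nakayama

/-! ### Invariants as a free graded module -/

section Free

variable {τ : Type} [Fintype τ] [DecidableEq τ] {γ : Type*} {κ : τ → γ}

/-- The families of symmetric coefficients of the invariant polynomials of degree `n`. -/
def HomogBasis.coeffs (B : HomogBasis (fun _ : τ => ())) (κ : τ → γ) (n : ℕ) :
    Submodule ℤ (B.ι → MvPolynomial τ ℤ) where
  carrier := {α | (∀ k, α k ∈ colorInv fun _ : τ => ()) ∧
    (∀ k s, (α k).coeff s ≠ 0 → s.degree + B.deg k = n) ∧ ∑ k, α k * B.u k ∈ colorInv κ}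
  zero_mem' := ⟨fun _ => zero_mem _, fun k s h => absurd (by simp) h, by simp⟩
  add_mem' {α β} ha hb := ⟨fun k => add_mem (ha.1 k) (hb.1 k), fun k s h => by
    rw [Pi.add_apply, MvPolynomial.coeff_add] at h
    by_cases h0 : (α k).coeff s = 0
    · exact hb.2.1 k s fun h1 => h (by rw [h0, h1, add_zero])
    · exact ha.2.1 k s h0, by
    simp only [Pi.add_apply, add_mul, Finset.sum_add_distrib]
    exact add_mem ha.2.2 hb.2.2⟩
  smul_mem' z α ha := ⟨fun k => zsmul_mem (ha.1 k) z, fun k s h => ha.2.1 k s fun h0 => h (by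
    rw [Pi.smul_apply, MvPolynomial.coeff_smul, h0, smul_zero]), by
    simp only [Pi.smul_apply, smul_mul_assoc, ← Finset.smul_sum]
    exact zsmul_mem ha.2.2 z⟩

omit [Fintype τ] [DecidableEq τ] in
theorem HomogBasis.coeffs_homog {B : HomogBasis (fun _ : τ => ())} {n : ℕ}
    {α : B.ι → MvPolynomial τ ℤ} (h : α ∈ B.coeffs κ n) (k : B.ι) :
    α k = 0 ∨ (B.deg k ≤ n ∧ (α k).IsHomogeneous (n - B.deg k)) := by
  by_cases h0 : α k = 0
  · exact Or.inl h0
  obtain ⟨s, hs⟩ := MvPolynomial.ne_zero_iff.1 h0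
  have := h.2.1 k s hs
  refine Or.inr ⟨by omega, isHomogeneous_iff_degree.2 fun s hs => ?_⟩
  have := h.2.1 k s hs
  omega

omit [Fintype τ] [DecidableEq τ] in
theorem HomogBasis.isHomogeneous_sum {B : HomogBasis (fun _ : τ => ())} {n : ℕ}
    {α : B.ι → MvPolynomial τ ℤ} (h : α ∈ B.coeffs κ n) :
    (∑ k, α k * B.u k).IsHomogeneous n := by
  refine MvPolynomial.IsHomogeneous.sum _ _ _ fun k _ => ?_
  rcases B.coeffs_homog h k with h | ⟨h1, h2⟩
  · rw [h, zero_mul]; exact MvPolynomial.isHomogeneous_zero _ _ _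
  · have := h2.mul (B.homog k)
    rwa [Nat.sub_add_cancel h1] at this

omit [Fintype τ] [DecidableEq τ] in
theorem HomogBasis.exists_coeffs (B : HomogBasis (fun _ : τ => ())) {f : MvPolynomial τ ℤ}
    (hf : f ∈ colorInv κ) (n : ℕ) :
    ∃ α ∈ B.coeffs κ n, MvPolynomial.homogeneousComponent n f = ∑ k, α k * B.u k := by
  have e : MvPolynomial.homogeneousComponent n f = ∑ k, (if B.deg k ≤ n then
      MvPolynomial.homogeneousComponent (n - B.deg k) (B.repr f k) else 0) * B.u k := by
    conv_lhs => rw [← B.sum_repr f, map_sum]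
    refine Finset.sum_congr rfl fun k _ => ?_
    rw [homogeneousComponent_mul (B.homog k)]
    split_ifs <;> simp
  refine ⟨_, ⟨fun k => ?_, fun k s h => ?_, ?_⟩, e⟩
  · split_ifs
    · exact homogeneousComponent_mem_colorInv (B.repr_mem f k) _
    · exact zero_mem _
  · split_ifs at h with hk
    · have := MvPolynomial.homogeneousComponent_isHomogeneous _ _ |>.degree_eq_sum_deg_support
        (MvPolynomial.mem_support_iff.2 h)
      have h2 := isHomogeneous_iff_degree.1
        (MvPolynomial.homogeneousComponent_isHomogeneous _ _) s h
      omega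
    · exact absurd (by simp) h
  · rw [← e]
    exact homogeneousComponent_mem_colorInv hf _

omit [Fintype τ] [DecidableEq τ] in
/-- The inclusion of the invariants splits over the symmetric polynomials. -/
theorem HomogBasis.exists_retract (B : HomogBasis (fun _ : τ => ())) (V : HomogBasis κ) :
    ∃ w : B.ι → MvPolynomial τ ℤ, (∀ k, w k ∈ colorInv κ) ∧
      (∀ k, (w k).IsHomogeneous (B.deg k)) ∧
      ∀ n, ∀ α ∈ B.coeffs κ n, ∑ k, α k * B.u k = ∑ k, α k * w k := by
  classical
  -- The retraction takes the coordinate at the basis element 1 of `V`; the homogeneous component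
  -- makes it preserve degrees.
  refine ⟨fun k => MvPolynomial.homogeneousComponent (B.deg k) (V.repr (B.u k) V.one),
    fun k => homogeneousComponent_mem_colorInv (V.repr_mem _ _) _,
    fun k => MvPolynomial.homogeneousComponent_isHomogeneous _ _, fun n α hα => ?_⟩
  -- An invariant polynomial has two expansions in `V`: itself times 1, and the one obtained by
  -- expanding each `u k`.
  have h1 := V.unique
    (fun j => ∑ k, α k * V.repr (B.u k) j - if j = V.one then ∑ k, α k * B.u k else 0)
    (fun j => sub_mem (sum_mem fun k _ => mul_mem
      (symmetric_le_colorInv κ (mem_colorInv_const.1 (hα.1 k))) (V.repr_mem _ _)) (by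
        split_ifs
        · exact hα.2.2
        · exact zero_mem _)) (by
      simp only [sub_mul, Finset.sum_sub_distrib, ite_mul, zero_mul, Finset.sum_ite_eq',
        Finset.mem_univ, if_true, V.u_one, mul_one, Finset.sum_mul]
      rw [Finset.sum_comm, sub_eq_zero]
      refine Finset.sum_congr rfl fun k _ => ?_
      conv_rhs => rw [← V.sum_repr (B.u k), Finset.mul_sum]
      exact Finset.sum_congr rfl fun j _ => mul_assoc _ _ _) V.one
  rw [if_pos rfl, sub_eq_zero] at h1
  conv_lhs => rw [← MvPolynomial.homogeneousComponent_eq_self (B.isHomogeneous_sum hα), ← h1,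
    map_sum]
  refine Finset.sum_congr rfl fun k _ => ?_
  rcases B.coeffs_homog hα k with h | ⟨h2, h3⟩
  · simp [h]
  · rw [mul_comm, homogeneousComponent_mul h3, if_pos (by omega), mul_comm,
      show n - (n - B.deg k) = B.deg k by omega]

/-- The ring of invariants is free over the symmetric polynomials, with a homogeneous basis. -/
theorem exists_homogeneous_basis [DecidableEq γ] (κ : τ → γ) :
    ∃ (I : Type) (m : I → MvPolynomial τ ℤ) (deg : I → ℕ), (∀ i, (m i).IsHomogeneous (deg i)) ∧
      LinearIndependent (MvPolynomial.symmetricSubalgebra τ ℤ) m ∧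
      ∀ f, f ∈ Submodule.span (MvPolynomial.symmetricSubalgebra τ ℤ) (Set.range m) ↔
        f ∈ colorInv κ := by
  classical
  obtain ⟨B⟩ := exists_homogBasis (fun _ : τ => ())
  obtain ⟨V⟩ := exists_homogBasis κ
  obtain ⟨w, hw, hwd, hret⟩ := B.exists_retract V
  let cc : (B.ι → MvPolynomial τ ℤ) →ₗ[ℤ] (B.ι → ℤ) := LinearMap.pi fun k =>
    (MvPolynomial.constantCoeff (R := ℤ) (σ := τ)).toAddMonoidHom.toIntLinearMap ∘ₗ
      LinearMap.proj k
  have hcc : ∀ α k, cc α k = MvPolynomial.constantCoeff (α k) := fun _ _ => rfl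
  -- The degree `n` part modulo symmetric polynomials of positive degree, seen inside a finite free
  -- ℤ-module. It is free because ℤ is a principal ideal domain, and lifting its bases gives the
  -- desired generators.
  let Q : ℕ → Submodule ℤ (B.ι → ℤ) := fun n => (B.coeffs κ n).map cc
  let J : ℕ → Type := fun n => Module.Free.ChooseBasisIndex ℤ (Q n)
  let bQ : ∀ n, Module.Basis (J n) ℤ (Q n) := fun n => Module.Free.chooseBasis ℤ (Q n)
  choose α hα hαQ using fun (i : Σ n, J n) => (bQ i.1 i.2).2
  let m : (Σ n, J n) → MvPolynomial τ ℤ := fun i => ∑ k, α i k * B.u k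
  let A := MvPolynomial.symmetricSubalgebra τ ℤ
  have hspan : ∀ n, ∀ β ∈ B.coeffs κ n, ∑ k, β k * B.u k ∈ Submodule.span A (Set.range m) := by
    intro n
    induction n using Nat.strong_induction_on with
    | _ n ih =>
      intro β hβ
      let c := (bQ n).repr ⟨cc β, Submodule.mem_map_of_mem hβ⟩
      have hc : cc β = ∑ j, c j • cc (α ⟨n, j⟩) := by
        have := congrArg Subtype.val ((bQ n).sum_repr ⟨cc β, Submodule.mem_map_of_mem hβ⟩)
        refine this.symm.trans ?_
        rw [AddSubmonoidClass.coe_finsetSum]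
        refine Finset.sum_congr rfl fun j _ => ?_
        rw [hαQ]
        rfl
      -- Removing the lifted generators leaves coefficients without constant term; the retraction
      -- then rewrites the rest through the invariants `w k`.
      let β' := β - ∑ j, c j • α ⟨n, j⟩
      have hβ' : β' ∈ B.coeffs κ n :=
        sub_mem hβ (sum_mem fun j _ => Submodule.smul_mem _ _ (hα ⟨n, j⟩))
      have hcβ' : cc β' = 0 := by
        rw [map_sub, hc, map_sum, sub_eq_zero]
        exact Finset.sum_congr rfl fun j _ => (map_zsmul _ _ _).symm
      have e : ∑ k, β k * B.u k = ∑ k, β' k * w k + ∑ j, c j • m ⟨n, j⟩ := by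
        rw [← hret n β' hβ', ← sub_eq_iff_eq_add, eq_comm]
        simp only [m, Finset.smul_sum, β', Pi.sub_apply, Finset.sum_apply, Pi.smul_apply, sub_mul,
          Finset.sum_sub_distrib, Finset.sum_mul, smul_mul_assoc]
        rw [Finset.sum_comm]
      rw [e]
      refine add_mem (sum_mem fun k _ => ?_) (sum_mem fun j _ =>
        zsmul_mem (Submodule.subset_span (Set.mem_range_self (⟨n, j⟩ : Σ n, J n))) _)
      by_cases h0 : β' k = 0
      · rw [h0, zero_mul]; exact zero_mem _
      obtain ⟨s, hs⟩ := MvPolynomial.ne_zero_iff.1 h0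
      have hs0 : s ≠ 0 := by
        rintro rfl
        exact hs (congrFun hcβ' k)
      -- A nonzero coefficient without constant term has positive degree, so `w k` has degree below
      -- `n` and the induction hypothesis covers it.
      have hlt : B.deg k < n := by
        have := hβ'.2.1 k s hs
        have : s.degree ≠ 0 := fun e => hs0 ((Finsupp.degree_eq_zero_iff s).1 e)
        omega
      obtain ⟨α', hα', e'⟩ := B.exists_coeffs (hw k) (B.deg k)
      have h1 := ih _ hlt α' hα'
      rw [← e', MvPolynomial.homogeneousComponent_eq_self (hwd k)] at h1
      exact Submodule.smul_mem _ (⟨β' k, mem_colorInv_const.1 (hβ'.1 k)⟩ : A) h1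
  refine ⟨Σ n, J n, m, Sigma.fst, fun i => B.isHomogeneous_sum (hα i), ?_, fun f => ⟨fun hf => ?_,
    fun hf => ?_⟩⟩
  · rw [linearIndependent_iff']
    intro S g hg i hi
    have hk : ∀ k, ∑ i : S, (g i : MvPolynomial τ ℤ) * α i k = 0 := by
      refine B.unique _ (fun k => sum_mem fun i _ => mul_mem
        (mem_colorInv_const.2 (g i).2) ((hα i).1 k)) ?_
      rw [← hg, ← Finset.sum_coe_sort S]
      simp only [Finset.sum_mul]
      rw [Finset.sum_comm]
      refine Finset.sum_congr rfl fun i _ => ?_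
      rw [Algebra.smul_def, Finset.mul_sum]
      exact Finset.sum_congr rfl fun k _ => mul_assoc _ _ _
    refine Subtype.ext (eq_zero_of_constantCoeff (fun (i : S) k => α i k) (fun c hc => ?_)
      (fun i : S => (g i : MvPolynomial τ ℤ)) hk ⟨i, hi⟩)
    let c' : (Σ n, J n) → ℤ := fun i => if h : i ∈ S then c ⟨i, h⟩ else 0
    have hc' : ∀ k, ∑ i ∈ S, c' i * cc (α i) k = 0 := fun k => by
      rw [← hc k, ← Finset.sum_coe_sort S]
      exact Finset.sum_congr rfl fun i _ => by rw [hcc]; simp [c']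
    -- Constant terms of generators of different degrees live on disjoint sets of coordinates, so a
    -- relation splits by degree.
    have hdeg : ∀ i k, B.deg k ≠ i.1 → cc (α i) k = 0 := fun i k h => by
      by_contra h0
      have := (hα i).2.1 k 0 h0
      rw [map_zero, zero_add] at this
      exact h this
    rintro ⟨⟨n, j⟩, hi⟩
    have hn : ∑ j, c' ⟨n, j⟩ • bQ n j = 0 := by
      refine Subtype.ext (funext fun k => ?_)
      rw [AddSubmonoidClass.coe_finsetSum, Finset.sum_apply]
      have e : ∀ j, (↑(c' ⟨n, j⟩ • bQ n j) : B.ι → ℤ) k = c' ⟨n, j⟩ * cc (α ⟨n, j⟩) k := fun j => by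
        rw [hαQ ⟨n, j⟩]; rfl
      simp only [e]
      by_cases hkn : B.deg k = n
      · let T : Finset (Σ n, J n) := Finset.univ.map (Function.Embedding.sigmaMk n)
        trans ∑ i ∈ T, c' i * cc (α i) k
        · rw [Finset.sum_map]; rfl
        rw [Finset.sum_subset (Finset.subset_union_left (s₂ := S)) fun i _ hi => ?_,
          ← Finset.sum_subset (Finset.subset_union_right (s₁ := T)) fun i _ hi => ?_]
        · exact hc' k
        · rw [show c' i = 0 from dif_neg hi, zero_mul]
        · rw [hdeg i k, mul_zero]
          rintro e
          obtain ⟨n', j'⟩ := i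
          obtain rfl : n' = n := e.symm.trans hkn
          exact hi (Finset.mem_map.2 ⟨j', Finset.mem_univ _, rfl⟩)
      · exact Finset.sum_eq_zero fun j _ => by rw [hdeg _ k hkn, mul_zero]
    have := Fintype.linearIndependent_iff.1 (bQ n).linearIndependent _ hn j
    simpa [c', hi] using this
  · induction hf using Submodule.span_induction with
    | mem x hx => obtain ⟨i, rfl⟩ := hx; exact (hα i).2.2
    | zero => exact zero_mem _
    | add x y _ _ hx hy => exact add_mem hx hy
    | smul a x _ hx => exact mul_mem (symmetric_le_colorInv κ a.2) hx
  · rw [← MvPolynomial.sum_homogeneousComponent f]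
    refine sum_mem fun n _ => ?_
    obtain ⟨β, hβ, e⟩ := B.exists_coeffs hf n
    rw [e]
    exact hspan n β hβ

end Free

/-! ## The terms of the complex are free -/

section FreeTerms

variable {N k r : ℕ}

theorem exists_basis_Fterm (lam : Fin r → ℕ) (n : ℕ) :
    ∃ (I : Type) (b : Module.Basis I (HBU N k r) (Fterm N k lam n)),
      ∀ i, ∃ d, IsHomog (b i : Cube N k r) d := by
  classical
  have h : ∀ v : Fin r → Bool, ∃ (I : Type) (m : I → Poly N k r) (deg : I → ℕ),
      (∀ i, (m i).IsHomogeneous (deg i)) ∧ LinearIndependent (HBU N k r) m ∧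
      Submodule.span (HBU N k r) (Set.range m) =
        if numOnes v = n ∧ Admissible lam v then invariants N k lam v else ⊥ := fun v => by
    split_ifs
    · obtain ⟨I, m, deg, h1, h2, h3⟩ := exists_homogeneous_basis (termColor N k lam v)
      exact ⟨I, m, deg, h1, h2, Submodule.ext fun f => (h3 f).trans (mem_invariants ..).symm⟩
    · exact ⟨Empty, Empty.elim, Empty.elim, fun i => i.elim, linearIndependent_empty_type, by simp⟩
  choose I m deg h1 h2 h3 using h
  let u : (Σ v, I v) → Cube N k r := fun i => Pi.single i.1 (m i.1 i.2)
  have hu : LinearIndependent (HBU N k r) u := Pi.linearIndependent_single m h2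
  have hspan : Submodule.span (HBU N k r) (Set.range u) = Fterm N k lam n := by
    refine le_antisymm (Submodule.span_le.2 ?_) fun c hc => ?_
    · rintro _ ⟨⟨v, i⟩, rfl⟩
      refine Submodule.mem_pi.2 fun v' _ => ?_
      rcases eq_or_ne v' v with rfl | hv
      · rw [show u ⟨v', i⟩ v' = m v' i from Pi.single_eq_same _ _, ← h3]
        exact Submodule.subset_span ⟨i, rfl⟩
      · rw [show u ⟨v, i⟩ v' = 0 from Pi.single_eq_of_ne hv _]
        exact zero_mem _
    · rw [← Finset.univ_sum_single c]
      refine sum_mem fun v _ => ?_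
      have hv := Submodule.mem_pi.1 hc v (Set.mem_univ _)
      rw [← h3] at hv
      have := Submodule.mem_map_of_mem (f := LinearMap.single (HBU N k r)
        (fun _ : Fin r → Bool => Poly N k r) v) hv
      rw [Submodule.map_span] at this
      refine Submodule.span_mono ?_ this
      rintro _ ⟨_, ⟨i, rfl⟩, rfl⟩
      exact ⟨⟨v, i⟩, rfl⟩
  refine ⟨Σ v, I v, (Module.Basis.span hu).map (LinearEquiv.ofEq _ _ hspan), fun i =>
    ⟨deg i.1 i.2 + shift i.1, ?_⟩⟩
  have e : (((Module.Basis.span hu).map (LinearEquiv.ofEq _ _ hspan) i : Fterm N k lam n) :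
      Cube N k r) = u i := by
    rw [Module.Basis.map_apply, LinearEquiv.coe_ofEq_apply, Module.Basis.span_apply]
  rw [e]
  intro v s hs
  rcases eq_or_ne v i.1 with rfl | hv
  · simp only [u, Pi.single_eq_same] at hs
    rw [isHomogeneous_iff_degree.1 (h1 _ _) s (MvPolynomial.mem_support_iff.1 hs)]
  · simp only [u, Pi.single_eq_of_ne hv] at hs
    exact absurd hs (by simp)

end FreeTerms

/-! ## The differential preserves the grading -/

section Grading

/-- A polynomial all of whose monomials have degree `b - a`. -/
def HasDegree {τ : Type} (f : MvPolynomial τ ℤ) (a b : ℕ) : Prop :=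
  ∀ s, f.coeff s ≠ 0 → s.degree + a = b

section

variable {τ : Type} {f g : MvPolynomial τ ℤ} {a b : ℕ}

theorem HasDegree.shift_left {c : ℕ} (h : HasDegree f (a + c) (b + c)) : HasDegree f a b :=
  fun s hs => by have := h s hs; omega

theorem hasDegree_zero (a b : ℕ) : HasDegree (0 : MvPolynomial τ ℤ) a b :=
  fun s hs => absurd (MvPolynomial.coeff_zero s) hs

theorem HasDegree.sum {ι : Type*} {S : Finset ι} {f : ι → MvPolynomial τ ℤ}
    (h : ∀ i ∈ S, HasDegree (f i) a b) : HasDegree (∑ i ∈ S, f i) a b := fun s hs => by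
  rw [MvPolynomial.coeff_sum] at hs
  obtain ⟨i, hi, hne⟩ := Finset.exists_ne_zero_of_sum_ne_zero hs
  exact h i hi s hne

theorem HasDegree.rename (h : HasDegree f a b) (σ : Equiv.Perm τ) :
    HasDegree (MvPolynomial.rename σ f) a b := fun s hs => by
  obtain ⟨t, rfl, ht⟩ := MvPolynomial.coeff_rename_ne_zero _ _ _ hs
  rw [Finsupp.degree_mapDomain]
  exact h t ht

theorem HasDegree.mul_homogeneous {n : ℕ} (hg : g.IsHomogeneous n) (h : HasDegree f a b) :
    HasDegree (g * f) a (b + n) := fun s hs => by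
  classical
  rw [MvPolynomial.coeff_mul] at hs
  obtain ⟨⟨p, q⟩, hpq, hne⟩ := Finset.exists_ne_zero_of_sum_ne_zero hs
  rw [Finset.HasAntidiagonal.mem_antidiagonal] at hpq
  have h1 := isHomogeneous_iff_degree.1 hg p (left_ne_zero_of_mul hne)
  have h2 := h q (right_ne_zero_of_mul hne)
  rw [← hpq, map_add]
  dsimp only
  omega

/-- Multiplication by a nonzero homogeneous polynomial of a domain shifts homogeneous components
injectively, so degrees can be read off the product. -/
theorem HasDegree.of_mul {n : ℕ} (hg : g.IsHomogeneous n) (hg0 : g ≠ 0)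
    (h : HasDegree (g * f) a b) : HasDegree f (a + n) b := fun s hs => by
  have h1 : MvPolynomial.homogeneousComponent (s.degree + n) (g * f) ≠ 0 := by
    rw [mul_comm, homogeneousComponent_mul hg, if_pos (by omega), Nat.add_sub_cancel]
    refine mul_ne_zero (fun h0 => hs ?_) hg0
    have := congrArg (MvPolynomial.coeff s) h0
    rwa [MvPolynomial.coeff_homogeneousComponent, if_pos rfl] at this
  obtain ⟨t, ht⟩ := MvPolynomial.ne_zero_iff.1 h1
  rw [MvPolynomial.coeff_homogeneousComponent] at ht
  split_ifs at ht with hd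
  · have := h t ht
    omega
  · exact absurd rfl ht

end

variable {N k r : ℕ}

theorem HasDegree.sOp {f : Poly N k r} {a b : ℕ} (h : HasDegree f a b) (l : ℕ) :
    HasDegree (sOp N k r l f) a b := by
  unfold FlagResolution.sOp
  split_ifs
  · exact h.rename _
  · exact h

theorem HasDegree.dOp {f : Poly N k r} {a b : ℕ} (h : HasDegree f a b) (l : ℕ) :
    HasDegree (dOp N k r l f) (a + 1) b := by
  unfold FlagResolution.dOp
  split_ifs with hl
  · refine HasDegree.of_mul ((MvPolynomial.isHomogeneous_X _ _).sub
      (MvPolynomial.isHomogeneous_X _ _)) (X_sub_X_ne_zero (xI_ne_succ N k ⟨l, by omega⟩ hl)) ?_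
    rw [divDiff_spec]
    intro s hs
    rw [MvPolynomial.coeff_sub] at hs
    by_cases h0 : f.coeff s = 0
    · exact h.rename _ s fun h1 => hs (by rw [h0, h1, sub_zero])
    · exact h s h0
  · exact hasDegree_zero _ _

theorem Qpoly_isHomogeneous (i : Fin r) : (Qpoly N k i).IsHomogeneous r := by
  refine MvPolynomial.IsHomogeneous.sum _ _ _ fun j hj => ?_
  have hj' : j ≤ r := Nat.lt_succ_iff.1 (Finset.mem_range.1 hj)
  have h1 : ((-1) ^ j : Poly N k r).IsHomogeneous 0 := by
    simpa using ((MvPolynomial.isHomogeneous_one (Idx N k r) ℤ).neg).pow j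
  have h2 : (esymmY N k r (r - j)).IsHomogeneous (r - j) := by
    refine MvPolynomial.IsHomogeneous.rename_isHomogeneous ?_
    rw [MvPolynomial.esymm]
    refine MvPolynomial.IsHomogeneous.sum _ _ _ fun t ht => ?_
    have := MvPolynomial.IsHomogeneous.prod t (fun i => (MvPolynomial.X i : MvPolynomial _ ℤ))
      (fun _ => 1) fun i _ => MvPolynomial.isHomogeneous_X _ _
    rwa [Finset.sum_const, (Finset.mem_powersetCard.1 ht).2, smul_eq_mul, mul_one] at this
  have h3 := (h1.mul h2).mul (MvPolynomial.isHomogeneous_X_pow (R := ℤ) (xI N k i) j)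
  rwa [zero_add, Nat.sub_add_cancel hj'] at h3

/-- Multiplication by Q raises the degree by `r`, and each layer of the recursion contains exactly
one divided difference, lowering it by 1. The net change `i + 1` is the jump of the shift along the
edge. -/
theorem HasDegree.edgeMap {w : Fin r → Bool} (i : Fin r) {f : Poly N k r} {a b : ℕ}
    (h : HasDegree f a b) : HasDegree (edgeMap N k w i f) a (b + (i + 1)) := by
  induction i using fin_down_induction generalizing f a b with
  | last i hi =>
    rw [edgeMap_last hi, LinearMap.mulLeft_apply, show (i : ℕ) + 1 = r by omega]
    exact h.mul_homogeneous (Qpoly_isHomogeneous i)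
  | step i hi ih =>
    rcases hw : w ⟨i + 1, hi⟩ with _ | _
    · rw [edgeMap_false hi hw, Module.End.mul_apply, Module.End.mul_apply]
      exact HasDegree.shift_left (c := 1) ((ih (h.sOp i)).dOp i)
    · rw [edgeMap_true hi hw, Module.End.mul_apply, Module.End.mul_apply]
      exact HasDegree.shift_left (c := 1) ((ih (h.dOp i)).sOp i)

theorem shift_update {v : Fin r → Bool} {i : Fin r} (h : v i = false) :
    shift (Function.update v i true) = shift v + (i + 1) := by
  have e : Finset.univ.filter (fun j => Function.update v i true j = true) =
      insert i (Finset.univ.filter fun j => v j = true) := by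
    ext j
    rcases eq_or_ne j i with rfl | hj
    · simp
    · simp [hj]
  rw [shift, e, Finset.sum_insert (by simp [h]), shift, add_comm]

theorem isHomog_differential {c : Cube N k r} {d : ℕ} (hc : IsHomog c d) :
    IsHomog (differential N k r c) d := by
  have hc' : ∀ v, HasDegree (c v) (shift v) d := fun v s hs =>
    hc v s (MvPolynomial.mem_support_iff.2 hs)
  suffices ∀ v, HasDegree (differential N k r c v) (shift v) d from
    fun v s hs => this v s (MvPolynomial.mem_support_iff.1 hs)
  intro v
  rw [differential_apply]
  refine HasDegree.sum fun i _ => ?_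
  split_ifs with h
  · exact hasDegree_zero _ _
  · have h1 := hc' (Function.update v i true)
    rw [shift_update (by simpa using h)] at h1
    exact (h1.edgeMap i).shift_left

end Grading

/-! ## Characters of the torus -/

section CircleCharacters

open MeasureTheory AddCircle

/-- A continuous character of the circle is a power. -/
theorem circle_character_eq_zpow (φ : Circle →ₜ* Circle) : ∃ n : ℤ, ∀ z, φ z = z ^ n := by
  by_contra! hne
  let f : C(UnitAddCircle, ℂ) :=
    ⟨fun t => φ (toCircle t), continuous_subtype_val.comp
      (φ.continuous_toFun.comp continuous_toCircle)⟩
  have hf : ∀ t, f t = φ (toCircle t) := fun _ => rfl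
  have hcoeff : ∀ n, fourierCoeff f n = 0 := by
    intro n
    obtain ⟨z, hz⟩ := hne n
    -- A character distinct from the n-th power; being nontrivial, it has Haar integral zero by
    -- translation invariance.
    let g : UnitAddCircle → ℂ := fun t => fourier (-n) t • f t
    have hadd : ∀ t a, g (t + a) = g t * g a := fun t a => by
      simp only [g, hf, smul_eq_mul, fourier_apply, smul_add, toCircle_add, map_mul, Circle.coe_mul]
      ring
    obtain ⟨a, rfl⟩ : ∃ a, toCircle a = z := ⟨(homeomorphCircle one_ne_zero).symm z, by
      rw [← homeomorphCircle_apply one_ne_zero, Homeomorph.apply_symm_apply]⟩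
    have ha : g a ≠ 1 := fun h => hz (by
      simp only [g, hf, smul_eq_mul, fourier_apply, ← Circle.coe_mul] at h
      have h' := Circle.ext (h.trans Circle.coe_one.symm)
      rw [neg_smul, toCircle_neg, inv_mul_eq_one, toCircle_zsmul] at h'
      exact h'.symm)
    have h1 : ∫ t, g (t + a) ∂haarAddCircle = ∫ t, g t ∂haarAddCircle :=
      integral_add_right_eq_self g a
    simp only [hadd, integral_mul_const] at h1
    have h2 : (∫ t, g t ∂haarAddCircle) * (g a - 1) = 0 := by rw [mul_sub, h1, mul_one, sub_self]
    exact (mul_eq_zero.1 h2).resolve_right (sub_ne_zero.2 ha)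
  -- All Fourier coefficients vanish, so the function would be zero, whereas it takes values of
  -- modulus 1.
  have hs := hasSum_fourier_series_of_summable (f := f) (by
    rw [show fourierCoeff f = 0 from funext hcoeff]; exact summable_zero)
  have h0 : f = 0 := hs.unique (by
    have e : (fun i => fourierCoeff f i • fourier i) =
        fun _ : ℤ => (0 : C(UnitAddCircle, ℂ)) := funext fun i => by
      rw [hcoeff]
      exact zero_smul ℂ (fourier i)
    rw [e]
    exact hasSum_zero)
  have := congrArg (fun F : C(UnitAddCircle, ℂ) => F 0) h0
  exact Circle.coe_ne_zero _ this

end CircleCharacters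

/-! ### The character lattice of the torus of J_λ -/

section Lattice

variable {N k r : ℕ}

/-- The indeterminates `X`, `Z` and `W`, which are coordinates on the torus of `J_lam`. -/
abbrev FreeIdx (N k r : ℕ) : Type := Fin r ⊕ (Fin (k - r) ⊕ Fin (N - k - r))

/-- The coordinate of the torus to which an indeterminate restricts. -/
def toFree : Idx N k r → FreeIdx N k r
  | Sum.inl (Sum.inl i) => Sum.inl i
  | Sum.inl (Sum.inr i) => Sum.inr (Sum.inl i)
  | Sum.inr (Sum.inl i) => Sum.inl i
  | Sum.inr (Sum.inr i) => Sum.inr (Sum.inr i)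

/-- The indeterminate of a coordinate of the torus. -/
def ofFree : FreeIdx N k r → Idx N k r
  | Sum.inl i => Sum.inl (Sum.inl i)
  | Sum.inr (Sum.inl i) => Sum.inl (Sum.inr i)
  | Sum.inr (Sum.inr i) => Sum.inr (Sum.inr i)

theorem toFree_ofFree (j : FreeIdx N k r) : toFree (ofFree j) = j := by
  rcases j with j | (j | j) <;> rfl

theorem ofFree_toFree (a : Idx N k r) : ofFree (toFree a) = evYIdx N k r 0 a := by
  rcases a with (a | a) | (a | a) <;> rfl

theorem ofFree_injective : Function.Injective (ofFree : FreeIdx N k r → Idx N k r) :=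
  Function.LeftInverse.injective toFree_ofFree

variable (lam : Fin r → ℕ)

theorem circle_mul_star (z : Circle) : (z : ℂ) * star (z : ℂ) = 1 := by
  have h := Circle.coe_inv_eq_conj z
  rw [Complex.star_def, ← h, ← Circle.coe_mul, mul_inv_cancel, Circle.coe_one]

/-- The torus of `J_lam` is parametrized by its coordinates. -/
noncomputable def torusHom (N k : ℕ) {r : ℕ} (lam : Fin r → ℕ) :
    (FreeIdx N k r → Circle) →ₜ* torus (Jgroup N k lam) where
  toFun θ := ⟨⟨Matrix.diagonal fun a => (θ (toFree a) : ℂ), by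
      rw [Matrix.mem_unitaryGroup_iff, Matrix.star_eq_conjTranspose, Matrix.diagonal_conjTranspose,
        Matrix.diagonal_mul_diagonal, ← Matrix.diagonal_one]
      congr 1
      funext a
      exact circle_mul_star _⟩,
    ⟨Matrix.diagonal fun i => (θ (Sum.inl i) : ℂ),
      Matrix.diagonal fun i => (θ (Sum.inr (Sum.inl i)) : ℂ),
      Matrix.diagonal fun i => (θ (Sum.inr (Sum.inr i)) : ℂ),
      fun a b h => Matrix.diagonal_apply_ne _ fun e => h (e ▸ rfl), by
      rw [Matrix.fromBlocks_diagonal, Matrix.fromBlocks_diagonal, Matrix.fromBlocks_diagonal]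
      funext a
      rcases a with (a | a) | (a | a) <;> rfl⟩,
    Matrix.isDiag_diagonal _⟩
  map_one' := by
    ext a b
    simp
  map_mul' θ θ' := by
    refine Subtype.ext (Subtype.ext ?_)
    change Matrix.diagonal _ = Matrix.diagonal _ * Matrix.diagonal _
    rw [Matrix.diagonal_mul_diagonal]
    rfl
  continuous_toFun := by
    refine Continuous.subtype_mk (Continuous.subtype_mk ?_ _) _
    exact Continuous.matrix_diagonal (by fun_prop)

theorem coordChar_torusHom (θ : FreeIdx N k r → Circle) (a : Idx N k r) :
    coordChar (Jgroup N k lam) a (torusHom N k lam θ) = θ (toFree a) :=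
  Circle.ext (Matrix.diagonal_apply_eq _ _)

theorem coordChar_yI (t : torus (Jgroup N k lam)) (i : Fin r) :
    coordChar (Jgroup N k lam) (yI N k i) t = coordChar (Jgroup N k lam) (xI N k i) t := by
  obtain ⟨U, V, W, -, h⟩ := t.2.1
  refine Circle.ext ?_
  change ((t : Matrix.unitaryGroup (Idx N k r) ℂ) : Matrix (Idx N k r) (Idx N k r) ℂ) _ _ =
    ((t : Matrix.unitaryGroup (Idx N k r) ℂ) : Matrix (Idx N k r) (Idx N k r) ℂ) _ _
  rw [h]
  rfl

theorem coordChar_ofFree_toFree (a : Idx N k r) :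
    coordChar (Jgroup N k lam) (ofFree (toFree a)) = coordChar (Jgroup N k lam) a := by
  rcases a with (a | a) | (a | a)
  · rfl
  · rfl
  · exact ContinuousMonoidHom.ext fun t => (coordChar_yI lam t a).symm
  · rfl

theorem torusHom_coordChar (t : torus (Jgroup N k lam)) :
    torusHom N k lam (fun j => coordChar (Jgroup N k lam) (ofFree j) t) = t := by
  refine Subtype.ext (Subtype.ext (Matrix.ext fun a b => ?_))
  change Matrix.diagonal _ a b = _
  rcases eq_or_ne a b with rfl | hab
  · rw [Matrix.diagonal_apply_eq]
    exact congrArg (fun φ : torus (Jgroup N k lam) →ₜ* Circle => (φ t : ℂ))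
      (coordChar_ofFree_toFree lam a)
  · rw [Matrix.diagonal_apply_ne _ hab, torus_isDiag _ t hab]

/-- The character of the torus with given exponents. -/
noncomputable def latticeHom (N k : ℕ) {r : ℕ} (lam : Fin r → ℕ) :
    (FreeIdx N k r → ℤ) →ₗ[ℤ] CharLattice (Jgroup N k lam) :=
  Fintype.linearCombination ℤ fun j =>
    Additive.ofMul (coordChar (Jgroup N k lam) (ofFree j) : PontryaginDual (torus (Jgroup N k lam)))

/-- The evaluation of characters at a point. -/
noncomputable def evalChar {G : Type*} [Monoid G] [TopologicalSpace G] (t : G) : PontryaginDual G →* Circle where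
  toFun χ := χ t
  map_one' := rfl
  map_mul' _ _ := rfl

theorem latticeHom_apply (n : FreeIdx N k r → ℤ) (t : torus (Jgroup N k lam)) :
    evalChar t (latticeHom N k lam n).toMul =
      ∏ j, coordChar (Jgroup N k lam) (ofFree j) t ^ n j := by
  rw [latticeHom, Fintype.linearCombination_apply, toMul_sum, map_prod]
  refine Finset.prod_congr rfl fun j _ => ?_
  rw [toMul_zsmul, map_zpow]
  rfl

theorem exists_zpow_ne_one {n : ℤ} (hn : n ≠ 0) : ∃ z : Circle, z ^ n ≠ 1 := by
  by_contra! h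
  have h1 : ((Circle.exp (Real.pi / n) ^ n : Circle) : ℂ) = 1 := by rw [h, Circle.coe_one]
  rw [← Circle.exp_zsmul, zsmul_eq_mul, mul_div_cancel₀ _ (Int.cast_ne_zero.2 hn),
    Circle.coe_exp, Complex.exp_pi_mul_I] at h1
  norm_num at h1

/-- Both halves test on the coordinate circles: a nonzero exponent is detected there, and the
restriction of a character to each of them is a power. The coordinate circles generate the torus. -/
theorem latticeHom_bijective : Function.Bijective (latticeHom N k lam) := by
  classical
  constructor
  · rw [injective_iff_map_eq_zero]
    intro n hn
    by_contra h0
    obtain ⟨j, hj⟩ := Function.ne_iff.1 h0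
    obtain ⟨z, hz⟩ := exists_zpow_ne_one hj
    refine hz ?_
    have h1 := latticeHom_apply lam n (torusHom N k lam (Pi.mulSingle j z))
    rw [hn, toMul_zero, map_one, Finset.prod_eq_single j] at h1
    · rw [coordChar_torusHom, toFree_ofFree, Pi.mulSingle_eq_same] at h1
      exact h1.symm
    · intro j' _ hj'
      rw [coordChar_torusHom, toFree_ofFree, Pi.mulSingle_eq_of_ne hj', one_zpow]
    · simp
  · intro χ
    have hχ : ∀ j, ∃ m : ℤ, ∀ z : Circle,
        evalChar (torusHom N k lam (Pi.mulSingle j z)) χ.toMul = z ^ m := fun j =>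
      circle_character_eq_zpow
        { toFun := fun z => evalChar (torusHom N k lam (Pi.mulSingle j z)) χ.toMul
          map_one' := by
            rw [Pi.mulSingle_one, map_one]
            exact map_one χ.toMul
          map_mul' := fun z z' => by
            rw [Pi.mulSingle_mul, map_mul]
            exact map_mul χ.toMul _ _
          continuous_toFun := (ContinuousMonoidHom.continuous_toFun χ.toMul).comp
            ((torusHom N k lam).continuous_toFun.comp (continuous_mulSingle (A := fun _ => Circle) j)) }
    choose n hn using hχ
    refine ⟨n, Additive.toMul.injective (ContinuousMonoidHom.ext fun t => ?_)⟩
    refine (latticeHom_apply lam n t).trans ?_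
    let F : (FreeIdx N k r → Circle) →* Circle :=
      { toFun := fun θ => evalChar (torusHom N k lam θ) χ.toMul
        map_one' := by
          rw [map_one]
          exact map_one χ.toMul
        map_mul' := fun θ θ' => by
          rw [map_mul]
          exact map_mul χ.toMul _ _ }
    have hF := map_prod F (fun j => Pi.mulSingle j (coordChar (Jgroup N k lam) (ofFree j) t))
      Finset.univ
    rw [Finset.univ_prod_mulSingle] at hF
    have ht : F (fun j => coordChar (Jgroup N k lam) (ofFree j) t) = evalChar t χ.toMul :=
      congrArg (fun t => evalChar t χ.toMul) (torusHom_coordChar lam t)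
    refine Eq.trans ?_ (hF.symm.trans ht)
    exact Finset.prod_congr rfl fun j _ => (hn j _).symm

/-- The diagonal entries at `X`, `Z` and `W` are a basis of the character lattice. -/
noncomputable def latticeBasis (N k : ℕ) {r : ℕ} (lam : Fin r → ℕ) :
    Module.Basis (FreeIdx N k r) ℤ (CharLattice (Jgroup N k lam)) :=
  (Pi.basisFun ℤ _).map (LinearEquiv.ofBijective _ (latticeHom_bijective lam))

/-- The cohomology of the torus is a polynomial ring. -/
noncomputable def freeEquiv (N k : ℕ) {r : ℕ} (lam : Fin r → ℕ) :
    MvPolynomial (FreeIdx N k r) ℤ ≃ₐ[ℤ] HBT (Jgroup N k lam) :=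
  (SymmetricAlgebra.equivMvPolynomial (latticeBasis N k lam)).symm

theorem freeEquiv_X (j : FreeIdx N k r) :
    freeEquiv N k lam (MvPolynomial.X j) = coordClass (Jgroup N k lam) (ofFree j) := by
  classical
  rw [freeEquiv, SymmetricAlgebra.equivMvPolynomial_symm_X, coordClass]
  congr 1
  rw [latticeBasis, Module.Basis.map_apply, LinearEquiv.ofBijective_apply, Pi.basisFun_apply,
    latticeHom, Fintype.linearCombination_apply_single, one_smul]

theorem coordClass_ofFree_toFree (a : Idx N k r) :
    coordClass (Jgroup N k lam) (ofFree (toFree a)) = coordClass (Jgroup N k lam) a :=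
  congrArg (fun χ : torus (Jgroup N k lam) →ₜ* Circle =>
    SymmetricAlgebra.ι ℤ (CharLattice (Jgroup N k lam))
      (Additive.ofMul (χ : PontryaginDual (torus (Jgroup N k lam)))))
    (coordChar_ofFree_toFree lam a)

theorem aeval_coordClass (f : Poly N k r) :
    MvPolynomial.aeval (coordClass (Jgroup N k lam)) f =
      freeEquiv N k lam (MvPolynomial.rename toFree f) := by
  have : MvPolynomial.aeval (coordClass (Jgroup N k lam)) =
      ((freeEquiv N k lam).toAlgHom).comp (MvPolynomial.rename toFree) := by
    refine MvPolynomial.algHom_ext fun a => ?_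
    rw [MvPolynomial.aeval_X, AlgHom.comp_apply, MvPolynomial.rename_X]
    exact ((freeEquiv_X lam (toFree a)).trans (coordClass_ofFree_toFree lam a)).symm
  rw [this]
  rfl

/-- On the torus the only relations between diagonal entries are y_i = x_i; the remaining
identifications are injective. This matches the kernel of the augmentation with the exactness of the
cube in degree 0. -/
theorem aeval_coordClass_eq_zero_iff (f : Poly N k r) :
    MvPolynomial.aeval (coordClass (Jgroup N k lam)) f = 0 ↔ evY N k r 0 f = 0 := by
  have h : evY N k r 0 f = MvPolynomial.rename ofFree (MvPolynomial.rename toFree f) := by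
    rw [MvPolynomial.rename_rename, evY]
    congr 2
    exact (funext ofFree_toFree).symm
  rw [aeval_coordClass, map_eq_zero_iff _ (freeEquiv N k lam).injective, h,
    map_eq_zero_iff _ (MvPolynomial.rename_injective _ ofFree_injective)]

end Lattice

/-! ## The action of the Weyl group -/

section ConjAct

variable {ι : Type} [Fintype ι] [DecidableEq ι]

theorem conjAct_aeval {J : Subgroup (Matrix.unitaryGroup ι ℂ)}
    {g : Matrix.unitaryGroup ι ℂ} {hg : ∀ t ∈ torus J, g * t * g⁻¹ ∈ torus J}
    {σ : Equiv.Perm ι}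
    (hσ : ∀ i, (coordChar J i).comp (conjHom J g hg) = coordChar J (σ i))
    (f : MvPolynomial ι ℤ) :
    conjAct J g hg (MvPolynomial.aeval (coordClass J) f) =
      MvPolynomial.aeval (coordClass J) (MvPolynomial.rename σ f) := by
  have h1 : ∀ i, conjAct J g hg (coordClass J i) = coordClass J (σ i) := by
    intro i
    rw [conjAct, coordClass, SymmetricAlgebra.lift_ι_apply, coordClass, ← hσ i]
    rfl
  have h2 : (conjAct J g hg).comp (MvPolynomial.aeval (coordClass J)) =
      (MvPolynomial.aeval (coordClass J)).comp (MvPolynomial.rename σ) := by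
    ext i
    simp [h1]
  exact DFunLike.congr_fun h2 f

theorem mem_HB_iff {J : Subgroup (Matrix.unitaryGroup ι ℂ)} {x : HBT J} :
    x ∈ HB J ↔ ∀ g ∈ J, ∀ hg : ∀ t ∈ torus J, g * t * g⁻¹ ∈ torus J, conjAct J g hg x = x := by
  simp only [HB, Algebra.mem_iInf, AlgHom.mem_equalizer, AlgHom.id_apply]

/-- The submodule of symmetric powers contains the values of homogeneous polynomials. -/
theorem aeval_coordClass_mem_pow (J : Subgroup (Matrix.unitaryGroup ι ℂ)) {f : MvPolynomial ι ℤ}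
    {d : ℕ} (hf : f.IsHomogeneous d) : MvPolynomial.aeval (coordClass J) f ∈
      LinearMap.range (SymmetricAlgebra.ι ℤ (CharLattice J)) ^ d := by
  have h : f ∈ MvPolynomial.homogeneousSubmodule ι ℤ 1 ^ d := by
    rw [MvPolynomial.homogeneousSubmodule_one_pow]
    exact hf
  have h1 := Submodule.mem_map_of_mem
    (f := (MvPolynomial.aeval (R := ℤ) (coordClass J)).toLinearMap) h
  rw [Submodule.map_pow] at h1
  suffices hle : (MvPolynomial.homogeneousSubmodule ι ℤ 1).map
      (MvPolynomial.aeval (R := ℤ) (coordClass J)).toLinearMap ≤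
      LinearMap.range (SymmetricAlgebra.ι ℤ (CharLattice J)) from
    (pow_le_pow_left' hle d : _ ≤ _) h1
  rw [MvPolynomial.homogeneousSubmodule_one_eq_span_X, Submodule.map_span, Submodule.span_le]
  rintro _ ⟨_, ⟨a, rfl⟩, rfl⟩
  rw [AlgHom.toLinearMap_apply, MvPolynomial.aeval_X]
  exact ⟨_, rfl⟩

theorem CohomBJ.val_mem {J : Subgroup (Matrix.unitaryGroup ι ℂ)} (x : CohomBJ J) : x.val ∈ HB J :=
  Subtype.property x

theorem CohomBJ.val_injective {J : Subgroup (Matrix.unitaryGroup ι ℂ)} :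
    Function.Injective (CohomBJ.val : CohomBJ J → HBT J) :=
  Subtype.val_injective

end ConjAct

/-! ### Weyl group invariants as invariants of a coloring -/

section Weyl

variable {N k r : ℕ} (lam : Fin r → ℕ)

/-- The blocks of the matrices in `J_lam`. -/
def blockColor (N k : ℕ) {r : ℕ} (lam : Fin r → ℕ) : Idx N k r → (ℕ ⊕ ℕ) ⊕ Bool
  | Sum.inl (Sum.inl i) => Sum.inl (Sum.inl (lam i))
  | Sum.inl (Sum.inr _) => Sum.inr true
  | Sum.inr (Sum.inl i) => Sum.inl (Sum.inr (lam i))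
  | Sum.inr (Sum.inr _) => Sum.inr false

theorem Jgroup_apply_eq_zero {g : Matrix.unitaryGroup (Idx N k r) ℂ} (hg : g ∈ Jgroup N k lam)
    {a b : Idx N k r} (h : blockColor N k lam a ≠ blockColor N k lam b) :
    (g : Matrix (Idx N k r) (Idx N k r) ℂ) a b = 0 := by
  obtain ⟨U, V, W, hU, e⟩ := hg
  rw [e]
  rcases a with (a | a) | (a | a) <;> rcases b with (b | b) | (b | b) <;>
    simp [blockColor] at h ⊢ <;> exact hU _ _ h

/-- `g` commutes with the projection to a block, so the trace over that block is invariant under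
conjugation. -/
theorem sum_block_conj {g : Matrix.unitaryGroup (Idx N k r) ℂ} (hg : g ∈ Jgroup N k lam)
    (t : Matrix.unitaryGroup (Idx N k r) ℂ) (c : (ℕ ⊕ ℕ) ⊕ Bool) :
    ∑ a with blockColor N k lam a = c,
        ((g * t * g⁻¹ : Matrix.unitaryGroup (Idx N k r) ℂ) : Matrix (Idx N k r) (Idx N k r) ℂ) a a =
      ∑ a with blockColor N k lam a = c, (t : Matrix (Idx N k r) (Idx N k r) ℂ) a a := by
  let P : Matrix (Idx N k r) (Idx N k r) ℂ :=
    Matrix.diagonal fun a => if blockColor N k lam a = c then 1 else 0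
  have hP : ∀ M : Matrix (Idx N k r) (Idx N k r) ℂ,
      ∑ a with blockColor N k lam a = c, M a a = Matrix.trace (P * M) := fun M => by
    simp [P, Matrix.trace, Matrix.diagonal_mul, Finset.sum_filter]
  have hcomm : P * (g : Matrix (Idx N k r) (Idx N k r) ℂ) =
      (g : Matrix (Idx N k r) (Idx N k r) ℂ) * P := by
    ext a b
    simp only [P, Matrix.diagonal_mul, Matrix.mul_diagonal]
    by_cases h : blockColor N k lam a = blockColor N k lam b
    · rw [h, mul_comm]
    · rw [Jgroup_apply_eq_zero lam hg h, zero_mul, mul_zero]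
  have hinv : ((g⁻¹ : Matrix.unitaryGroup (Idx N k r) ℂ) : Matrix (Idx N k r) (Idx N k r) ℂ) *
      (g : Matrix (Idx N k r) (Idx N k r) ℂ) = 1 :=
    congrArg Subtype.val (inv_mul_cancel g)
  rw [hP, hP]
  change Matrix.trace (P * ((g : Matrix (Idx N k r) (Idx N k r) ℂ) *
    (t : Matrix (Idx N k r) (Idx N k r) ℂ) *
    ((g⁻¹ : Matrix.unitaryGroup (Idx N k r) ℂ) : Matrix (Idx N k r) (Idx N k r) ℂ))) = _
  rw [← mul_assoc, ← mul_assoc, hcomm, mul_assoc, mul_assoc, Matrix.trace_mul_comm, mul_assoc,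
    mul_assoc, hinv, mul_one]

/-- Conjugation by an element of `J_lam` that normalizes the torus permutes the diagonal entries
within the blocks. -/
theorem exists_perm_block (g : Matrix.unitaryGroup (Idx N k r) ℂ) (hgJ : g ∈ Jgroup N k lam)
    (hg : ∀ t ∈ torus (Jgroup N k lam), g * t * g⁻¹ ∈ torus (Jgroup N k lam)) :
    ∃ σ : Equiv.Perm (Idx N k r), (∀ a, blockColor N k lam (σ a) = blockColor N k lam a) ∧
      ∀ a, (coordChar (Jgroup N k lam) a).comp (conjHom (Jgroup N k lam) g hg) =
        coordChar (Jgroup N k lam) (σ a) := by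
  classical
  let T := torus (Jgroup N k lam)
  let χ : Idx N k r → (T →* ℂ) := fun i =>
    Circle.coeHom.comp (coordChar (Jgroup N k lam) i).toMonoidHom
  let χ' : Idx N k r → (T →* ℂ) := fun i =>
    Circle.coeHom.comp ((coordChar (Jgroup N k lam) i).comp
      (conjHom (Jgroup N k lam) g hg)).toMonoidHom
  have inj : Function.Injective
      (fun φ : T →ₜ* Circle => (Circle.coeHom.comp φ.toMonoidHom : T →* ℂ)) := by
    intro φ ψ h
    ext t
    exact DFunLike.congr_fun h t
  -- Within each block the two families of characters have the same sum, hence the same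
  -- multiplicities, since distinct characters are linearly independent. The permutation matches
  -- equal characters inside each block.
  have card : ∀ p : ((ℕ ⊕ ℕ) ⊕ Bool) × (T →* ℂ),
      Fintype.card {a // (blockColor N k lam a, χ' a) = p} =
        Fintype.card {a // (blockColor N k lam a, χ a) = p} := by
    rintro ⟨c, φ⟩
    have tr : ∑ a with blockColor N k lam a = c, ((χ' a : T →* ℂ) : T → ℂ) =
        ∑ a with blockColor N k lam a = c, ((χ a : T →* ℂ) : T → ℂ) := by
      funext t
      rw [Finset.sum_apply, Finset.sum_apply]
      exact sum_block_conj lam hgJ t c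
    have cnt : ∑ a with blockColor N k lam a = c, Finsupp.single (χ' a) (1 : ℂ) =
        ∑ a with blockColor N k lam a = c, Finsupp.single (χ a) (1 : ℂ) := by
      apply linearIndependent_monoidHom T ℂ
      simpa [map_sum, Finsupp.linearCombination_single] using tr
    have h := DFunLike.congr_fun cnt φ
    simp only [Finsupp.finsetSum_apply, Finsupp.single_apply, Finset.sum_boole] at h
    rw [Finset.filter_filter, Finset.filter_filter] at h
    rw [Fintype.card_subtype, Fintype.card_subtype]
    simp only [Prod.mk.injEq]
    exact_mod_cast h
  let e : Idx N k r ≃ Idx N k r :=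
    (Equiv.sigmaFiberEquiv fun a => (blockColor N k lam a, χ' a)).symm.trans
      ((Equiv.sigmaCongrRight fun p => Fintype.equivOfCardEq (card p)).trans
        (Equiv.sigmaFiberEquiv fun a => (blockColor N k lam a, χ a)))
  have he : ∀ a, (blockColor N k lam (e a), χ (e a)) = (blockColor N k lam a, χ' a) := fun a =>
    (Fintype.equivOfCardEq (card (blockColor N k lam a, χ' a)) ⟨a, rfl⟩).2
  exact ⟨e, fun a => congrArg Prod.fst (he a), fun a => inj (congrArg Prod.snd (he a)).symm⟩

theorem aeval_mem_HB {f : Poly N k r} (hf : f ∈ colorInv (blockColor N k lam)) :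
    MvPolynomial.aeval (coordClass (Jgroup N k lam)) f ∈ HB (Jgroup N k lam) := by
  refine mem_HB_iff.2 fun g hgJ hg => ?_
  obtain ⟨σ, hσ, hχ⟩ := exists_perm_block lam g hgJ hg
  exact (conjAct_aeval hχ f).trans (congrArg _ (mem_colorInv.1 hf σ hσ))

/-- The permutation of the indeterminates given by permutations of `X` and `Y` (the same one), of
`Z` and of `W`. -/
def blockPerm (σ : Equiv.Perm (Fin r)) (ζ : Equiv.Perm (Fin (k - r)))
    (ω : Equiv.Perm (Fin (N - k - r))) : Equiv.Perm (Idx N k r) :=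
  Equiv.sumCongr (Equiv.sumCongr σ ζ) (Equiv.sumCongr σ ω)

/-- The permutation matrix, as a unitary matrix. -/
noncomputable def permUnitary (τ : Equiv.Perm (Idx N k r)) : Matrix.unitaryGroup (Idx N k r) ℂ :=
  ⟨τ.permMatrix ℂ, by
    rw [Matrix.mem_unitaryGroup_iff, Matrix.star_eq_conjTranspose, Matrix.conjTranspose_permMatrix,
      ← Matrix.permMatrix_mul, inv_mul_cancel, Matrix.permMatrix_one]⟩

theorem permUnitary_conj (τ : Equiv.Perm (Idx N k r)) (t : Matrix.unitaryGroup (Idx N k r) ℂ) :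
    ((permUnitary τ * t * (permUnitary τ)⁻¹ : Matrix.unitaryGroup (Idx N k r) ℂ) :
      Matrix (Idx N k r) (Idx N k r) ℂ) =
      (t : Matrix (Idx N k r) (Idx N k r) ℂ).submatrix τ τ := by
  change τ.permMatrix ℂ * (t : Matrix (Idx N k r) (Idx N k r) ℂ) *
    (τ.permMatrix ℂ).conjTranspose = _
  rw [Matrix.conjTranspose_permMatrix, PEquiv.toMatrix_toPEquiv_mul, PEquiv.mul_toMatrix_toPEquiv]
  rfl

theorem permUnitary_mem {σ : Equiv.Perm (Fin r)} (hσ : ∀ i, lam (σ i) = lam i)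
    (ζ : Equiv.Perm (Fin (k - r))) (ω : Equiv.Perm (Fin (N - k - r))) :
    permUnitary (blockPerm σ ζ ω) ∈ Jgroup N k lam := by
  refine ⟨σ.permMatrix ℂ, ζ.permMatrix ℂ, ω.permMatrix ℂ, fun a b h => ?_, ?_⟩
  · have : σ a ≠ b := fun e => h (by rw [← e, hσ])
    simp [PEquiv.toMatrix_apply, this]
  · change (blockPerm σ ζ ω).permMatrix ℂ = _
    ext a b
    rcases a with (a | a) | (a | a) <;> rcases b with (b | b) | (b | b) <;>
      simp [PEquiv.toMatrix_apply, blockPerm]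

theorem permUnitary_normalizes {σ : Equiv.Perm (Fin r)} (hσ : ∀ i, lam (σ i) = lam i)
    (ζ : Equiv.Perm (Fin (k - r))) (ω : Equiv.Perm (Fin (N - k - r))) :
    ∀ t ∈ torus (Jgroup N k lam), permUnitary (blockPerm σ ζ ω) * t *
      (permUnitary (blockPerm σ ζ ω))⁻¹ ∈ torus (Jgroup N k lam) := by
  intro t ht
  have h := permUnitary_mem lam hσ ζ ω
  refine ⟨(Jgroup N k lam).mul_mem ((Jgroup N k lam).mul_mem h ht.1)
    ((Jgroup N k lam).inv_mem h), ?_⟩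
  change Matrix.IsDiag _
  rw [permUnitary_conj]
  exact Matrix.IsDiag.submatrix ht.2 (Equiv.injective _)

theorem coordChar_permUnitary {σ : Equiv.Perm (Fin r)} (hσ : ∀ i, lam (σ i) = lam i)
    (ζ : Equiv.Perm (Fin (k - r))) (ω : Equiv.Perm (Fin (N - k - r))) (i : Idx N k r) :
    (coordChar (Jgroup N k lam) i).comp (conjHom (Jgroup N k lam) (permUnitary (blockPerm σ ζ ω))
      (permUnitary_normalizes lam hσ ζ ω)) = coordChar (Jgroup N k lam) (blockPerm σ ζ ω i) := by
  refine ContinuousMonoidHom.ext fun t => Circle.ext ?_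
  exact congrFun (congrFun (permUnitary_conj (blockPerm σ ζ ω) t) i) i

/-- The coloring of the torus coordinates whose invariants are the cohomology of `BJ_lam`. -/
def freeColor (N k : ℕ) {r : ℕ} (lam : Fin r → ℕ) : FreeIdx N k r → ℕ ⊕ Bool
  | Sum.inl i => Sum.inl (lam i)
  | Sum.inr (Sum.inl _) => Sum.inr true
  | Sum.inr (Sum.inr _) => Sum.inr false

theorem freeEquiv_eq_aeval (p : MvPolynomial (FreeIdx N k r) ℤ) :
    freeEquiv N k lam p =
      MvPolynomial.aeval (coordClass (Jgroup N k lam)) (MvPolynomial.rename ofFree p) := by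
  rw [aeval_coordClass, MvPolynomial.rename_rename,
    show toFree ∘ ofFree = id from funext toFree_ofFree, MvPolynomial.rename_id_apply]

theorem aeval_rename_blockPerm (σ : Equiv.Perm (Fin r)) (ζ : Equiv.Perm (Fin (k - r)))
    (ω : Equiv.Perm (Fin (N - k - r))) (p : MvPolynomial (FreeIdx N k r) ℤ) :
    MvPolynomial.aeval (coordClass (Jgroup N k lam))
        (MvPolynomial.rename (blockPerm σ ζ ω) (MvPolynomial.rename ofFree p)) =
      freeEquiv N k lam
        (MvPolynomial.rename (Equiv.sumCongr σ (Equiv.sumCongr ζ ω)) p) := by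
  rw [aeval_coordClass, MvPolynomial.rename_rename, MvPolynomial.rename_rename]
  congr 3
  funext j
  rcases j with j | (j | j) <;> rfl

theorem conjAct_freeEquiv {σ : Equiv.Perm (Fin r)} (hσ : ∀ i, lam (σ i) = lam i)
    (ζ : Equiv.Perm (Fin (k - r))) (ω : Equiv.Perm (Fin (N - k - r)))
    (p : MvPolynomial (FreeIdx N k r) ℤ) :
    conjAct (Jgroup N k lam) (permUnitary (blockPerm σ ζ ω))
        (permUnitary_normalizes lam hσ ζ ω) (freeEquiv N k lam p) =
      freeEquiv N k lam
        (MvPolynomial.rename (Equiv.sumCongr σ (Equiv.sumCongr ζ ω)) p) := by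
  rw [freeEquiv_eq_aeval, ← aeval_rename_blockPerm]
  exact conjAct_aeval (coordChar_permUnitary lam hσ ζ ω) _

/-- Permutation matrices acting equally on X and Y lie in J_λ and normalize the torus; they already
impose the full symmetry. -/
theorem mem_colorInv_of_mem_HB {p : MvPolynomial (FreeIdx N k r) ℤ}
    (hp : freeEquiv N k lam p ∈ HB (Jgroup N k lam)) : p ∈ colorInv (freeColor N k lam) := by
  have key : ∀ (σ : Equiv.Perm (Fin r)) (_ : ∀ i, lam (σ i) = lam i)
      (ζ : Equiv.Perm (Fin (k - r))) (ω : Equiv.Perm (Fin (N - k - r))),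
      MvPolynomial.rename (Equiv.sumCongr σ (Equiv.sumCongr ζ ω)) p = p := fun σ hσ ζ ω =>
    (freeEquiv N k lam).injective ((conjAct_freeEquiv lam hσ ζ ω p).symm.trans
      (mem_HB_iff.1 hp _ (permUnitary_mem lam hσ ζ ω) (permUnitary_normalizes lam hσ ζ ω)))
  refine mem_colorInv_iff_swap.2 fun s t hst h => ?_
  rcases s with s | (s | s) <;> rcases t with t | (t | t) <;> simp [freeColor] at h
  · rw [← Equiv.Perm.sumCongr_swap_one, ← Equiv.Perm.sumCongr_one]
    exact key _ (swap_preserves h) 1 1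
  · rw [← Equiv.Perm.sumCongr_one_swap, ← Equiv.Perm.sumCongr_swap_one]
    exact key 1 (fun _ => rfl) _ 1
  · rw [← Equiv.Perm.sumCongr_one_swap, ← Equiv.Perm.sumCongr_one_swap]
    exact key 1 (fun _ => rfl) 1 _

/-- Provides the preimage for surjectivity of the augmentation: a polynomial in X, Z and W alone is
trivially symmetric in Y. -/
theorem rename_ofFree_mem {p : MvPolynomial (FreeIdx N k r) ℤ}
    (hp : p ∈ colorInv (freeColor N k lam)) :
    MvPolynomial.rename ofFree p ∈ colorInv (termColor N k lam fun _ => false) := by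
  have key : ∀ s t : FreeIdx N k r, s ≠ t → freeColor N k lam s = freeColor N k lam t →
      MvPolynomial.rename (Equiv.swap (ofFree s) (ofFree t)) (MvPolynomial.rename ofFree p) =
        MvPolynomial.rename ofFree p := fun s t hst h => by
    conv_rhs => rw [← mem_colorInv_iff_swap.1 hp s t hst h]
    rw [MvPolynomial.rename_rename, MvPolynomial.rename_rename]
    congr 2
    funext j
    exact ofFree_injective.swap_apply s t j
  refine mem_colorInv_iff_swap.2 fun a b hab h => ?_
  rcases a with (a | a) | (a | a) <;> rcases b with (b | b) | (b | b) <;> simp [termColor] at h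
  · exact key (Sum.inl a) (Sum.inl b) (fun e => hab (by rw [Sum.inl.inj e])) (congrArg Sum.inl h)
  · exact key (Sum.inr (Sum.inl a)) (Sum.inr (Sum.inl b))
      (fun e => hab (by rw [Sum.inl.inj (Sum.inr.inj e)])) rfl
  · rw [MvPolynomial.rename_rename]
    congr 2
    funext j
    rcases j with j | (j | j) <;>
      exact Equiv.swap_apply_of_ne_of_ne (by simp [ofFree]) (by simp [ofFree])
  · exact key (Sum.inr (Sum.inr a)) (Sum.inr (Sum.inr b))
      (fun e => hab (by rw [Sum.inr.inj (Sum.inr.inj e)])) rfl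

theorem colorInv_termColor_le :
    colorInv (termColor N k lam fun _ => false) ≤ colorInv (blockColor N k lam) :=
  colorInv_mono fun a b h => by
    rcases a with (a | a) | (a | a) <;> rcases b with (b | b) | (b | b) <;>
      simp [blockColor] at h <;> simp [termColor, h]

end Weyl

/-! ## The augmentation -/

section Augmentation

variable {N k r : ℕ} (lam : Fin r → ℕ)

theorem apply_zero_mem {c : Cube N k r} (hc : c ∈ Fterm N k lam 0) :
    c (fun _ => false) ∈ colorInv (termColor N k lam fun _ => false) := by
  have h := Submodule.mem_pi.1 hc (fun _ => false) (Set.mem_univ _)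
  rw [if_pos ⟨numOnes_zero, fun _ _ _ _ h => h⟩] at h
  exact mem_invariants.1 h

/-- The augmentation of the complex: evaluation of the component at the zero vertex at the diagonal
entries. -/
noncomputable def augmentation (lam : Fin r → ℕ) :
    Fterm N k lam 0 →ₗ[HBU N k r] CohomBJ (Jgroup N k lam) where
  toFun c := (⟨MvPolynomial.aeval (coordClass (Jgroup N k lam)) ((c : Cube N k r) fun _ => false),
    aeval_mem_HB lam (colorInv_termColor_le lam (apply_zero_mem lam c.2))⟩ :
      HB (Jgroup N k lam))
  map_add' _ _ := Subtype.ext (map_add _ _ _)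
  map_smul' _ _ := Subtype.ext (map_mul _ _ _)

theorem augmentation_val (c : Fterm N k lam 0) : (augmentation lam c).val =
    MvPolynomial.aeval (coordClass (Jgroup N k lam)) ((c : Cube N k r) fun _ => false) := rfl

theorem augmentation_eq_zero_iff (c : Fterm N k lam 0) :
    augmentation lam c = 0 ↔ evY N k r 0 ((c : Cube N k r) fun _ => false) = 0 := by
  rw [← aeval_coordClass_eq_zero_iff lam]
  exact Subtype.ext_iff

theorem single_mem_Fterm {f : Poly N k r} (hf : f ∈ colorInv (termColor N k lam fun _ => false)) :
    (Pi.single (fun _ => false) f : Cube N k r) ∈ Fterm N k lam 0 := by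
  classical
  refine Submodule.mem_pi.2 fun v _ => ?_
  rcases eq_or_ne v fun _ => false with rfl | hv
  · rw [Pi.single_eq_same, if_pos ⟨numOnes_zero, fun _ _ _ _ h => h⟩]
    exact mem_invariants.2 hf
  · rw [Pi.single_eq_of_ne hv]
    exact zero_mem _

theorem augmentation_surjective :
    Function.Surjective (augmentation lam : Fterm N k lam 0 →ₗ[HBU N k r] _) := by
  intro h
  obtain ⟨p, hp⟩ := (freeEquiv N k lam).surjective h.val
  have hm : freeEquiv N k lam p ∈ HB (Jgroup N k lam) := by
    rw [hp]
    exact h.val_mem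
  refine ⟨⟨_, single_mem_Fterm lam (rename_ofFree_mem lam (mem_colorInv_of_mem_HB lam hm))⟩,
    CohomBJ.val_injective ?_⟩
  rw [augmentation_val, ← hp, freeEquiv_eq_aeval]
  exact congrArg _ (Pi.single_eq_same (M := fun _ => Poly N k r) _ _)

theorem augmentation_isHomog (c : Fterm N k lam 0) {d : ℕ} (hc : IsHomog (c : Cube N k r) d) :
    (augmentation lam c).IsHomog d := by
  refine aeval_coordClass_mem_pow _ (isHomogeneous_iff_degree.2 fun s hs => ?_)
  have := hc _ s (MvPolynomial.mem_support_iff.2 hs)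
  rwa [show shift (fun _ : Fin r => false) = 0 by simp [shift], add_zero] at this

theorem differential_chains_zero {c : Cube N k r} (hc : c ∈ chains N k r 0) :
    differential N k r c = 0 := by
  funext w
  rw [differential_apply]
  refine Finset.sum_eq_zero fun i _ => ?_
  split_ifs with h
  · rfl
  · rw [(hc _).2 (by rw [numOnes_update (by simpa using h)]; omega), map_zero]

end Augmentation
end FlagResolution

open FlagResolution in
theorem proposition3p8 (N k r : ℕ) (hk : k ≤ N) (hr : r ≤ min k (N - k))
    (lam : Fin r → ℕ) (hanti : Antitone lam) (hpos : ∀ i, 0 < lam i) :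
    ∃ (hd : ∀ n, ∀ c ∈ Fterm N k lam (n + 1), differential N k r c ∈ Fterm N k lam n)
      (ε : Fterm N k lam 0 →ₗ[HBU N k r] CohomBJ (Jgroup N k lam)),
      -- the terms are free, with homogeneous bases
      (∀ n, ∃ (I : Type) (b : Module.Basis I (HBU N k r) (Fterm N k lam n)),
        ∀ i, ∃ d, IsHomog (b i : Cube N k r) d) ∧
      -- the augmented complex is exact
      (∀ n, Function.Exact ((differential N k r).restrict (hd (n + 1)))
        ((differential N k r).restrict (hd n))) ∧
      Function.Exact ((differential N k r).restrict (hd 0)) ε ∧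
      Function.Surjective ε ∧
      -- the maps preserve the internal grading
      (∀ n, ∀ c ∈ Fterm N k lam (n + 1), ∀ d, IsHomog c d → IsHomog (differential N k r c) d) ∧
      (∀ (c : Fterm N k lam 0) (d : ℕ), IsHomog (c : Cube N k r) d →
        (ε c).IsHomog d) := by
  have hd : ∀ n, ∀ c ∈ Fterm N k lam (n + 1), differential N k r c ∈ Fterm N k lam n :=
    fun n c hc => (mem_Fterm_iff hanti).2 ((mem_Fterm_iff hanti).1 hc).differential
  have hex : ∀ n, ∀ b ∈ Fterm N k lam n, differential N k r b = 0 →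
      evY N k r 0 (b fun _ => false) = 0 →
      ∃ c ∈ Fterm N k lam (n + 1), differential N k r c = b := fun n b hb h1 h2 => by
    obtain ⟨c, hc, e⟩ := exactAt_adjSet lam n b ((mem_Fterm_iff hanti).1 hb) ⟨h1, h2⟩
    exact ⟨c, (mem_Fterm_iff hanti).2 hc, e⟩
  refine ⟨hd, augmentation lam, exists_basis_Fterm lam, fun n b => ⟨fun h => ?_, ?_⟩,
    fun b => ⟨fun h => ?_, ?_⟩, augmentation_surjective lam,
    fun n c _ d hc => isHomog_differential hc, fun c d hc => augmentation_isHomog lam c hc⟩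
  -- In positive degree the component at the zero vertex is zero, so the condition on the
  -- substitution is automatic.
  · obtain ⟨c, hc, e⟩ := hex (n + 1) b b.2 (congrArg Subtype.val h) (by
      rw [chains_zero_apply ((mem_Fterm_iff hanti).1 b.2).1, map_zero])
    exact ⟨⟨c, hc⟩, Subtype.ext e⟩
  · rintro ⟨c, rfl⟩
    exact Subtype.ext (differential_differential _)
  -- In degree 0 every chain is a cycle, and vanishing of the augmentation supplies the condition on
  -- the substitution.
  · obtain ⟨c, hc, e⟩ := hex 0 b b.2
      (differential_chains_zero ((mem_Fterm_iff hanti).1 b.2).1)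
      ((augmentation_eq_zero_iff lam b).1 h)
    exact ⟨⟨c, hc⟩, Subtype.ext e⟩
  · rintro ⟨c, rfl⟩
    exact (augmentation_eq_zero_iff lam _).2
      (evY_differential 0 fun _ j hj => absurd hj (Nat.not_lt_zero _))
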